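/- Let $d\in\{2,3\}$, $T>0$, $\mathbb T^d=\mathbb R^d/\mathbb Z^d$. Let $\nu,\mu:(0,\infty)\to[0,\infty)$ be continuous and $p\in C^2(0,\infty)$, and consider the compressible Navier–Stokes system $$\partial_t\varrho+\nabla\cdot(\varrho\mathbf u)=0,\qquad \partial_t(\varrho\mathbf u)+\nabla\cdot(\varrho\mathbf u\otimes\mathbf u)+\nabla(p(\varrho))-\nabla\cdot(\nu(\varrho)\mathbb D\mathbf u)-\nabla(\mu(\varrho)\nabla\cdot\mathbf u)=0$$ on $\mathbb T^d\times(0,T)$, where $\mathbb D\mathbf u=\frac12(\nabla\mathbf u+\nabla^\top\mathbf u)$, with initial data $\varrho(\cdot,0)=\varrho_0$, $(\varrho\mathbf u)(\cdot,0)=\varrho_0\mathbf u_0$, where $\varrho_0,\varrho_0\mathbf u_0\in L^1(\mathbb T^d)$. Let $(\varrho,\mathbf u)$ be a weak solution, that is: (i) $\int_0^T\int_{\mathbb T^d}(\varrho\,\partial_t\varphi+\varrho\mathbf u\cdot\nabla\varphi)\,dx\,dt=0$ for all $\varphi\in C_0^\infty(\mathbb T^d\times(0,T))$; (ii) $\int_0^T\int_{\mathbb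 T^d}\big(\varrho\mathbf u\cdot\partial_t\psi+\varrho\mathbf u\otimes\mathbf u:\nabla\psi+p(\varrho)\nabla\cdot\psi-\nu(\varrho)\mathbb D\mathbf u:\nabla\psi-\mu(\varrho)(\nabla\cdot\mathbf u)(\nabla\cdot\psi)\big)\,dx\,dt=0$ for all $\psi\in C_0^\infty(\mathbb T^d\times(0,T))^d$; (iii) $\int_{\mathbb T^d}\varrho(x,t)\varphi(x)\,dx\to\int_{\mathbb T^d}\varrho_0\varphi\,dx$ and $\int_{\mathbb T^d}(\varrho\mathbf u)(x,t)\cdot\psi(x)\,dx\to\int_{\mathbb T^d}\varrho_0\mathbf u_0\cdot\psi\,dx$ as $t\to0^+$, for all $\varphi\in C^\infty(\mathbb T^d)$ and $\psi\in C^\infty(\mathbb T^d)^d$. Assume that $0<c_1\le\varrho(x,t)\le c_2<\infty$ for a.e. $(x,t)$ and $\mathbf u\in L^\infty(0,T;L^2(\mathbb T^d))\cap L^2(0,T;H^1(\mathbb T^d))$. Assume moreover that for some $\varepsilon>0$, with $\sup_t$ the essential supremum over $t\in(0,T)$ and $\sup_h$ taken over $h\in\mathbb R^d$ with $0<|h|<\varepsilon$: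 - if $d=2$: $\ \sup_{t}\sup_{h}|h|^{-1/2}\|\varrho(\cdot+h,t)-\varrho(\cdot,t)\|_{L^2(\mathbb T^2)}<\infty$; - if $d=3$: $\ \mathbf u\in L^4(\mathbb T^3\times(0,T))$ and $\sup_{t}\sup_{h}|h|^{-1/2}\|\varrho(\cdot+h,t)-\varrho(\cdot,t)\|_{L^{12/5}(\mathbb T^3)}<\infty$. Let $\mathcal P(r)=r\int_1^r\frac{p(z)}{z^2}\,dz$. Then the energy equality $$\int_{\mathbb T^d}\Big(\tfrac12\varrho|\mathbf u|^2+\mathcal P(\varrho)\Big)(x,t)\,dx+\int_0^t\!\int_{\mathbb T^d}\nu(\varrho)|\mathbb D\mathbf u|^2\,dx\,ds+\int_0^t\!\int_{\mathbb T^d}\mu(\varrho)|\nabla\cdot\mathbf u|^2\,dx\,ds=\int_{\mathbb T^d}\Big(\tfrac12\varrho_0|\mathbf u_0|^2+\mathcal P(\varrho_0)\Big)dx$$ holds, with all integrands integrable, for almost every $t\in(0,T)$, and also for every $t\in(0,T)$ at which $\varrho$ and $\varrho\mathbf u$ are weakly continuous in time, i.e. $\varrho(\cdot,t),(\varrho\mathbf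 u)(\cdot,t)\in L^1(\mathbb T^d)$ and, for all smooth $\varphi,\psi$ on $\mathbb T^d$, the functions $s\mapsto\int_{\mathbb T^d}\varrho(x,s)\varphi(x)\,dx$ and $s\mapsto\int_{\mathbb T^d}(\varrho\mathbf u)(x,s)\cdot\psi(x)\,dx$ are continuous at $s=t$. In particular it holds for every $t\in(0,T)$ if $\varrho$ and $\varrho\mathbf u$ are weakly continuous in time on $(0,T)$. -/

import Mathlib

open MeasureTheory Filter Topology
open scoped ContDiff

noncomputable section

namespace CNS

/-- The torus `ℝ^d / ℤ^d`, with its normalised Lebesgue (Haar) measure `volume`. -/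
abbrev Torus (d : ℕ) : Type := UnitAddTorus (Fin d)

/-- The vector space `ℝ^d` with its Euclidean norm. -/
abbrev Vec (d : ℕ) : Type := EuclideanSpace ℝ (Fin d)

/-- The quotient map `ℝ^d → ℝ^d / ℤ^d`. -/
def toTorus {d : ℕ} (y : Vec d) : Torus d := fun i => ((y i : ℝ) : UnitAddCircle)

/-- Product measure on the space-time cylinder `(0,T) × 𝕋^d` (time is the first variable). -/
def spaceTime (d : ℕ) (T : ℝ) : Measure (ℝ × Torus d) :=
  (volume.restrict (Set.Ioo 0 T)).prod volume

/-- The partial derivative `∂φ/∂x_j` of a function on the torus. -/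
def pd {d : ℕ} (j : Fin d) (φ : Torus d → ℝ) (x : Torus d) : ℝ :=
  deriv (fun s : ℝ => φ (x + toTorus (EuclideanSpace.single j s))) 0

/-- The time derivative of a space-time function. -/
def dt {d : ℕ} (φ : ℝ → Torus d → ℝ) (t : ℝ) (x : Torus d) : ℝ :=
  deriv (fun s : ℝ => φ s x) t

/-- `φ ∈ C^∞(𝕋^d)`: the periodic lift of `φ` to `ℝ^d` is smooth. -/
def IsSmooth {d : ℕ} (φ : Torus d → ℝ) : Prop :=
  ContDiff ℝ ∞ (fun y : Vec d => φ (toTorus y))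

/-- `φ ∈ C_0^∞(𝕋^d × (0,T))`: smooth, and vanishing for times outside a compact
subinterval of `(0,T)`. -/
structure IsTest {d : ℕ} (T : ℝ) (φ : ℝ → Torus d → ℝ) : Prop where
  smooth : ContDiff ℝ ∞ (fun z : ℝ × Vec d => φ z.1 (toTorus z.2))
  support : ∃ a b : ℝ, 0 < a ∧ b < T ∧ ∀ t, t ∉ Set.Icc a b → ∀ x, φ t x = 0

/-- `A` is the weak gradient of the vector field `v` on the torus, `A i j = ∂_j v_i`. -/
def HasWeakGrad {d : ℕ} (v : Torus d → Vec d)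
    (A : Torus d → Matrix (Fin d) (Fin d) ℝ) : Prop :=
  ∀ φ : Torus d → ℝ, IsSmooth φ → ∀ i j : Fin d,
    ∫ x, v x i * pd j φ x = - ∫ x, A x i j * φ x

/-- `u ∈ L^∞(0,T; L^2(𝕋^d))`. -/
def MemLinfL2 {d : ℕ} (T : ℝ) (u : ℝ → Torus d → Vec d) : Prop :=
  AEStronglyMeasurable (Function.uncurry u) (spaceTime d T) ∧
  ∃ M : ℝ, ∀ᵐ t ∂(volume.restrict (Set.Ioo 0 T)),
    eLpNorm (u t) 2 volume ≤ ENNReal.ofReal M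

/-- `u ∈ L^2(0,T; H^1(𝕋^d))` with (spatial, weak) gradient `G`. -/
structure MemL2H1 {d : ℕ} (T : ℝ) (u : ℝ → Torus d → Vec d)
    (G : ℝ → Torus d → Matrix (Fin d) (Fin d) ℝ) : Prop where
  memLp : MemLp (Function.uncurry u) 2 (spaceTime d T)
  memLp_grad : ∀ i j : Fin d,
    MemLp (fun z : ℝ × Torus d => G z.1 z.2 i j) 2 (spaceTime d T)
  weakGrad : ∀ᵐ t ∂(volume.restrict (Set.Ioo 0 T)), HasWeakGrad (u t) (G t)

/-- The strain tensor `𝔻 = (A + Aᵀ) / 2` of a velocity gradient `A`. -/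
def strain {d : ℕ} (A : Matrix (Fin d) (Fin d) ℝ) : Matrix (Fin d) (Fin d) ℝ :=
  (1 / 2 : ℝ) • (A + A.transpose)

/-- The contraction `A : B = ∑ A_ij B_ij` of two tensors. -/
def contract {d : ℕ} (A B : Matrix (Fin d) (Fin d) ℝ) : ℝ :=
  ∑ i, ∑ j, A i j * B i j

/-- The gradient `(∇ψ)_ij = ∂_j ψ_i` of a smooth vector field given by its components. -/
def grad {d : ℕ} (ψ : Fin d → Torus d → ℝ) (x : Torus d) : Matrix (Fin d) (Fin d) ℝ :=
  fun i j => pd j (ψ i) x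

/-- Weak solutions of the compressible Navier-Stokes system
`∂_t ϱ + ∇·(ϱ u) = 0`,
`∂_t (ϱ u) + ∇·(ϱ u ⊗ u) + ∇(p(ϱ)) - ∇·(ν(ϱ) 𝔻u) - ∇(μ(ϱ) ∇·u) = 0`
on `𝕋^d × (0,T)` with initial data `(ϱ₀, ϱ₀ u₀)`, where `G` is the spatial gradient of `u`
(so that `𝔻u = strain G` and `∇·u = trace G`). -/
structure IsWeakSolution {d : ℕ} (T : ℝ) (p ν μ : ℝ → ℝ)
    (ϱ : ℝ → Torus d → ℝ) (u : ℝ → Torus d → Vec d)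
    (G : ℝ → Torus d → Matrix (Fin d) (Fin d) ℝ)
    (ϱ₀ : Torus d → ℝ) (u₀ : Torus d → Vec d) : Prop where
  continuity : ∀ φ : ℝ → Torus d → ℝ, IsTest T φ →
    ∫ t in Set.Ioo 0 T, ∫ x,
      (ϱ t x * dt φ t x + ∑ j, ϱ t x * u t x j * pd j (φ t) x) = 0
  momentum : ∀ ψ : Fin d → ℝ → Torus d → ℝ, (∀ i, IsTest T (ψ i)) →
    ∫ t in Set.Ioo 0 T, ∫ x,
      ((∑ i, ϱ t x * u t x i * dt (ψ i) t x)
        + contract (fun i j => ϱ t x * u t x i * u t x j) (grad (fun i => ψ i t) x)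
        + p (ϱ t x) * (grad (fun i => ψ i t) x).trace
        - ν (ϱ t x) * contract (strain (G t x)) (grad (fun i => ψ i t) x)
        - μ (ϱ t x) * (G t x).trace * (grad (fun i => ψ i t) x).trace) = 0
  integrable_init : Integrable ϱ₀
  init : ∀ φ : Torus d → ℝ, IsSmooth φ →
    Tendsto (fun t => ∫ x, ϱ t x * φ x) (𝓝[>] (0 : ℝ)) (𝓝 (∫ x, ϱ₀ x * φ x))
  integrable_init_mom : Integrable (fun x => ϱ₀ x • u₀ x)
  init_mom : ∀ ψ : Fin d → Torus d → ℝ, (∀ i, IsSmooth (ψ i)) →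
    Tendsto (fun t => ∫ x, ∑ i, ϱ t x * u t x i * ψ i x) (𝓝[>] (0 : ℝ))
      (𝓝 (∫ x, ∑ i, ϱ₀ x * u₀ x i * ψ i x))

/-- The bound `sup_t sup_{|h|<ε} |h|^{-1/2} ‖ϱ(·+h,t) - ϱ(·,t)‖_{L^q(𝕋^d)} < ∞`
for some `ε > 0`; the supremum over `t ∈ (0,T)` is the essential one. -/
def HalfBesov {d : ℕ} (T : ℝ) (q : ENNReal) (ϱ : ℝ → Torus d → ℝ) : Prop :=
  ∃ ε > (0 : ℝ), ∃ C : ℝ, ∀ᵐ t ∂(volume.restrict (Set.Ioo 0 T)),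
    ∀ h : Vec d, ‖h‖ < ε →
      eLpNorm (fun x => ϱ t (x + toTorus h) - ϱ t x) q volume
        ≤ ENNReal.ofReal (C * ‖h‖ ^ (1 / 2 : ℝ))

/-- The pressure potential `𝒫(r) = r ∫_1^r p(z) / z^2 dz`. -/
def pressurePotential (p : ℝ → ℝ) (r : ℝ) : ℝ :=
  r * ∫ z in (1 : ℝ)..r, p z / z ^ 2

/-- The energy density `½ r |v|² + 𝒫(r)`. -/
def energyDensity {d : ℕ} (p : ℝ → ℝ) (r : ℝ) (v : Vec d) : ℝ :=
  1 / 2 * r * ‖v‖ ^ 2 + pressurePotential p r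

/-- The energy equality at time `t`, together with the integrability of
everything that is integrated in it. -/
structure EnergyEquality {d : ℕ} (p ν μ : ℝ → ℝ)
    (ϱ : ℝ → Torus d → ℝ) (u : ℝ → Torus d → Vec d)
    (G : ℝ → Torus d → Matrix (Fin d) (Fin d) ℝ)
    (ϱ₀ : Torus d → ℝ) (u₀ : Torus d → Vec d) (t : ℝ) : Prop where
  integrable_init : Integrable (fun x => energyDensity p (ϱ₀ x) (u₀ x))
  integrable_energy : Integrable (fun x => energyDensity p (ϱ t x) (u t x))
  integrable_shear : Integrable (fun z : ℝ × Torus d =>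
    ν (ϱ z.1 z.2) * contract (strain (G z.1 z.2)) (strain (G z.1 z.2))) (spaceTime d t)
  integrable_bulk : Integrable (fun z : ℝ × Torus d =>
    μ (ϱ z.1 z.2) * (G z.1 z.2).trace ^ 2) (spaceTime d t)
  equality :
    (∫ x, energyDensity p (ϱ t x) (u t x))
      + (∫ s in Set.Ioo 0 t, ∫ x,
          ν (ϱ s x) * contract (strain (G s x)) (strain (G s x)))
      + (∫ s in Set.Ioo 0 t, ∫ x, μ (ϱ s x) * (G s x).trace ^ 2)
    = ∫ x, energyDensity p (ϱ₀ x) (u₀ x)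

/-- `ϱ` and `ϱ u` are continuous at the time `t` as functions with values in the
distributions on the torus (in particular they are integrable in space at that time). -/
structure WeaklyContinuousAt {d : ℕ} (ϱ : ℝ → Torus d → ℝ) (u : ℝ → Torus d → Vec d)
    (t : ℝ) : Prop where
  integrable : Integrable (ϱ t)
  integrable_mom : Integrable (fun x => ϱ t x • u t x)
  density : ∀ φ : Torus d → ℝ, IsSmooth φ →
    ContinuousAt (fun s => ∫ x, ϱ s x * φ x) t
  momentum : ∀ ψ : Fin d → Torus d → ℝ, (∀ i, IsSmooth (ψ i)) →
    ContinuousAt (fun s => ∫ x, ∑ i, ϱ s x * u s x i * ψ i x) t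

end CNS

end

open scoped ENNReal NNReal

noncomputable section

namespace CNS

variable {d : ℕ}

/-! Let η be a smoothing kernel of width δ and put R = η * ϱ, M = η * (ϱu), V = M / R. Density and
momentum are averaged separately, and V, the Favre average `favre`, is the velocity used in the
energy argument. Testing the weak equations with translates of η turns them into ordinary
differential equations in time for R and M at each point x, so both are absolutely continuous in t
and the usual chain rule applies. With N = ϱu⊗u + p(ϱ)I - S, where S is the viscous stress,
integration by parts in space gives the exact identity d/dt ∫ (|M|²/(2R) + 𝒫(R)) = ∫ (η * N - V⊗M -
p(R)I) : ∇V, because 𝒫'' = p'/r makes the pressure terms combine (`Slice.integral_energyRate`,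
`Evolution.energy_identity`).

It remains to let δ → 0. Since ϱ is bounded above and below and u is in L⁴, the bracket converges in
L² to -S (`Slice.tendsto_residualFlux`). The decisive point is that ∇V stays bounded in L², although
derivatives fall on the rough density (`eLpNorm_favrePD_le`). After antisymmetrisation, ∂V is a
double average of differences u(x-y) - u(x-z) over |y|, |z| ≤ δ, with a weight of mass O(1/δ); each
difference is O(δ) in L² because ∇u is in L². As V - η * u → 0 in L², it follows that ∇V converges
weakly to ∇u (`Slice.tendsto_favrePD`). The pairing of a strongly and a weakly convergent sequence
gives the dissipation at almost every time, and a majorant built from products of L²(0,T) functions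
allows integration in time (`Evolution.tendsto_integral_fluxWork`).

At the end times the averaged energies converge because M → ϱu and V → u in L²
(`State.tendsto_totalEnergy`). The primitives in time are continuous from the right, so the density
bounds and the L² bound on the momentum, known at almost every time, hold for the averages at every
time in [0,T); removing the average gives them for the initial data and at times of weak continuity
(`Mollifier.state`). In two dimensions the L⁴ bound on u comes from `ladyzhenskaya` integrated in
time. -/

instance : IsProbabilityMeasure (volume : Measure UnitAddCircle) :=
  ⟨by simp [AddCircle.measure_univ]⟩

instance : IsProbabilityMeasure (volume : Measure (Torus d)) := by
  rw [volume_pi]; infer_instance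

instance : (volume : Measure (Torus d)).IsNegInvariant :=
  Measure.IsAddHaarMeasure.isNegInvariant_of_regular volume

/-! ### Coordinate shifts and differential calculus on the torus -/

/-- The translation by `s` in the `j`-th coordinate direction. -/
def shift (j : Fin d) (s : ℝ) : Torus d := toTorus (EuclideanSpace.single j s)

lemma toTorus_add (y z : Vec d) : toTorus (y + z) = toTorus y + toTorus z := by
  ext i; simp [toTorus]

lemma toTorus_sub (y z : Vec d) : toTorus (y - z) = toTorus y - toTorus z := by
  ext i; simp [toTorus]

lemma toTorus_surjective : Function.Surjective (toTorus : Vec d → Torus d) := by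
  intro x
  choose y hy using fun i => QuotientAddGroup.mk_surjective (x i)
  exact ⟨WithLp.toLp 2 y, funext fun i => hy i⟩

lemma isOpenQuotientMap_toTorus : IsOpenQuotientMap (toTorus : Vec d → Torus d) := by
  have h1 : IsOpenQuotientMap (Pi.map fun (_ : Fin d) (y : ℝ) => (y : UnitAddCircle)) :=
    IsOpenQuotientMap.piMap fun _ => QuotientAddGroup.isOpenQuotientMap_mk
  have h2 := h1.comp (EuclideanSpace.equiv (Fin d) ℝ).toHomeomorph.isOpenQuotientMap
  exact h2

lemma shift_apply (j : Fin d) (s : ℝ) (i : Fin d) :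
    shift j s i = if i = j then (s : UnitAddCircle) else 0 := by
  simp only [shift, toTorus, PiLp.single_apply]
  split_ifs <;> simp

lemma shift_add (j : Fin d) (s t : ℝ) : shift j (s + t) = shift j s + shift j t := by
  ext i; simp only [shift_apply, Pi.add_apply]; split_ifs <;> simp

@[simp] lemma shift_zero (j : Fin d) : shift j 0 = 0 := by
  ext i; simp [shift_apply]

lemma continuous_shift (j : Fin d) : Continuous (shift j) := by
  refine continuous_pi fun i => ?_
  simp only [shift_apply]
  split_ifs
  · exact AddCircle.continuous_mk' (1 : ℝ)
  · exact continuous_const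

/-- `f'` is everywhere the partial derivative `∂f/∂x_j`. -/
def HasPD (j : Fin d) (f f' : Torus d → ℝ) : Prop :=
  ∀ x, HasDerivAt (fun s : ℝ => f (x + shift j s)) (f' x) 0

namespace HasPD

variable {j : Fin d} {f f' g g' : Torus d → ℝ}

lemma pd_eq (h : HasPD j f f') : pd j f = f' := funext fun x => (h x).deriv

lemma hasDerivAt (h : HasPD j f f') (x : Torus d) (s : ℝ) :
    HasDerivAt (fun s : ℝ => f (x + shift j s)) (f' (x + shift j s)) s := by
  have h1 := h (x + shift j s)
  have h2 : HasDerivAt (fun t : ℝ => t - s) 1 s := (hasDerivAt_id s).sub_const s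
  have h3 : HasDerivAt (fun t : ℝ => f (x + shift j s + shift j t)) (f' (x + shift j s)) (s - s) := by
    simpa using h1
  have h4 := HasDerivAt.comp (h := fun t : ℝ => t - s) s h3 h2
  rw [mul_one] at h4
  refine h4.congr_of_eventuallyEq (Eventually.of_forall fun t => ?_)
  simp only [Function.comp]
  rw [add_assoc, ← shift_add]; simp

lemma mul (hf : HasPD j f f') (hg : HasPD j g g') :
    HasPD j (fun x => f x * g x) (fun x => f' x * g x + f x * g' x) := fun x => by
  simpa using (hf x).fun_mul (hg x)

lemma add (hf : HasPD j f f') (hg : HasPD j g g') :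
    HasPD j (fun x => f x + g x) (fun x => f' x + g' x) := fun x => (hf x).add (hg x)

lemma const_mul (c : ℝ) (hf : HasPD j f f') :
    HasPD j (fun x => c * f x) (fun x => c * f' x) := fun x => (hf x).const_mul c

lemma comp {F F' : ℝ → ℝ} (hf : HasPD j f f') (hF : ∀ x, HasDerivAt F (F' (f x)) (f x)) :
    HasPD j (fun x => F (f x)) (fun x => F' (f x) * f' x) := fun x => by
  have h2 : HasDerivAt F (F' (f x)) (f (x + shift j 0)) := by simpa using hF x
  exact h2.comp (0 : ℝ) (hf x)

lemma div (hf : HasPD j f f') (hg : HasPD j g g') (h0 : ∀ x, g x ≠ 0) :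
    HasPD j (fun x => f x / g x) (fun x => (f' x * g x - f x * g' x) / g x ^ 2) := fun x => by
  simpa using (hf x).fun_div (hg x) (by simpa using h0 x)

lemma sub_left (hf : HasPD j f f') (x₀ : Torus d) :
    HasPD j (fun x => f (x₀ - x)) (fun x => - f' (x₀ - x)) := fun x => by
  have h := hf.hasDerivAt (x₀ - x) 0
  have h2 : HasDerivAt (fun s : ℝ => f (x₀ - x + shift j s)) (f' (x₀ - x)) (-(0 : ℝ)) := by
    simpa using h
  have h3 := h2.comp (0 : ℝ) (hasDerivAt_neg (0 : ℝ))
  rw [mul_neg_one] at h3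
  refine h3.congr_of_eventuallyEq (Eventually.of_forall fun t => ?_)
  simp only [Function.comp]
  congr 1
  have : shift j (-t) = - shift j t := by
    rw [eq_neg_iff_add_eq_zero, ← shift_add]; simp
  rw [this]; abel

end HasPD

lemma Continuous.integrable_torus {f : Torus d → ℝ} (hf : Continuous f) : Integrable f :=
  hf.integrable_of_hasCompactSupport (HasCompactSupport.of_compactSpace f)

lemma exists_bound_torus {f : Torus d → ℝ} (hf : Continuous f) :
    ∃ C : ℝ, 0 ≤ C ∧ ∀ x, |f x| ≤ C := by
  obtain ⟨C, hC⟩ := isCompact_univ.exists_bound_of_continuousOn hf.continuousOn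
  exact ⟨C, le_trans (abs_nonneg _) (hC 0 trivial), fun x => hC x trivial⟩

/-- By translation invariance the integral of the shifted function is constant in the shift, so its
derivative under the integral sign vanishes. -/
lemma integral_hasPD {j : Fin d} {f f' : Torus d → ℝ} (h : HasPD j f f') (hf : Continuous f)
    (hf' : Continuous f') : ∫ x, f' x = 0 := by
  obtain ⟨C, -, hC⟩ := exists_bound_torus hf'
  have key := (hasDerivAt_integral_of_dominated_loc_of_deriv_le (μ := (volume : Measure (Torus d)))
    (F := fun (s : ℝ) x => f (x + shift j s)) (F' := fun s x => f' (x + shift j s))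
    (bound := fun _ => C) (x₀ := 0) (s := Set.univ) univ_mem
    (Eventually.of_forall fun s => by fun_prop) (by simpa using Continuous.integrable_torus hf)
    (by fun_prop) (Eventually.of_forall fun x s _ => hC _) (integrable_const _)
    (Eventually.of_forall fun x s _ => h.hasDerivAt x s)).2
  have h1 : (fun s : ℝ => ∫ x, f (x + shift j s)) = fun _ => ∫ x, f x :=
    funext fun s => integral_add_right_eq_self f (shift j s)
  rw [h1] at key
  simpa using key.unique (hasDerivAt_const (0 : ℝ) _)

lemma integral_mul_hasPD {j : Fin d} {f f' g g' : Torus d → ℝ} (h : HasPD j f f')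
    (hf : Continuous f) (hf' : Continuous f') (k : HasPD j g g') (hg : Continuous g)
    (hg' : Continuous g') : ∫ x, f' x * g x = - ∫ x, f x * g' x := by
  have := integral_hasPD (h.mul k) (by fun_prop) (by fun_prop)
  rw [integral_add (Continuous.integrable_torus (by fun_prop))
    (Continuous.integrable_torus (by fun_prop))] at this
  linarith

namespace IsSmooth

variable {φ : Torus d → ℝ}

lemma continuous (h : IsSmooth φ) : Continuous φ :=
  isOpenQuotientMap_toTorus.isQuotientMap.continuous_iff.2 (ContDiff.continuous h)

lemma hasDerivAt_lift (h : IsSmooth φ) (j : Fin d) (y : Vec d) :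
    HasDerivAt (fun s : ℝ => φ (toTorus y + shift j s))
      (fderiv ℝ (fun y : Vec d => φ (toTorus y)) y (EuclideanSpace.single j 1)) 0 := by
  have h1 : HasFDerivAt (fun y : Vec d => φ (toTorus y))
      (fderiv ℝ (fun y : Vec d => φ (toTorus y)) y) (y + (0 : ℝ) • EuclideanSpace.single j (1 : ℝ)) := by
    simpa using (ContDiff.differentiable h (by simp) y).hasFDerivAt
  have h2 : HasDerivAt (fun s : ℝ => y + s • EuclideanSpace.single j (1 : ℝ))
      (EuclideanSpace.single j (1 : ℝ)) 0 := by
    simpa using ((hasDerivAt_id (0 : ℝ)).smul_const (EuclideanSpace.single j (1 : ℝ))).const_add y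
  have h3 := h1.comp_hasDerivAt (0 : ℝ) h2
  refine h3.congr_of_eventuallyEq (Eventually.of_forall fun s => ?_)
  simp only [Function.comp, toTorus_add, shift]
  congr 3
  ext i; simp [PiLp.single_apply]

lemma hasPD (h : IsSmooth φ) (j : Fin d) : HasPD j φ (pd j φ) := by
  intro x
  obtain ⟨y, rfl⟩ := toTorus_surjective x
  have h1 := h.hasDerivAt_lift j y
  have h2 : pd j φ (toTorus y) = _ := h1.deriv
  rw [h2]; exact h1

lemma continuous_pd (h : IsSmooth φ) (j : Fin d) : Continuous (pd j φ) := by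
  refine isOpenQuotientMap_toTorus.isQuotientMap.continuous_iff.2 ?_
  have : pd j φ ∘ toTorus = fun y => fderiv ℝ (fun y : Vec d => φ (toTorus y)) y
      (EuclideanSpace.single j 1) := funext fun y => (h.hasDerivAt_lift j y).deriv
  rw [this]
  exact (ContDiff.continuous_fderiv h (by simp)).clm_apply continuous_const

lemma sub_left (h : IsSmooth φ) (x₀ : Torus d) : IsSmooth (fun x => φ (x₀ - x)) := by
  obtain ⟨y, rfl⟩ := toTorus_surjective x₀
  simp only [IsSmooth, ← toTorus_sub]
  exact ContDiff.comp (g := fun y : Vec d => φ (toTorus y)) h (contDiff_const.sub contDiff_id)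

lemma pd_sub_left (h : IsSmooth φ) (x₀ : Torus d) (j : Fin d) :
    pd j (fun x => φ (x₀ - x)) = fun x => - pd j φ (x₀ - x) :=
  ((h.hasPD j).sub_left x₀).pd_eq

end IsSmooth

/-! ### Construction of smoothing kernels -/

lemma exists_smoothTransition_deriv_bound :
    ∃ B : ℝ, 0 ≤ B ∧ ∀ z, |deriv Real.smoothTransition z| ≤ B := by
  have hc : Continuous (deriv Real.smoothTransition) :=
    (Real.smoothTransition.contDiff (n := 1)).continuous_deriv le_rfl
  obtain ⟨B, hB⟩ := (isCompact_Icc (a := (0 : ℝ)) (b := 1)).exists_bound_of_continuousOn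
    hc.continuousOn
  refine ⟨B, (norm_nonneg _).trans (hB 0 (by simp)), fun z => ?_⟩
  by_cases hz : z ∈ Set.Icc (0 : ℝ) 1
  · exact hB z hz
  · have h0 : deriv Real.smoothTransition z = 0 := by
      rcases lt_or_ge z 0 with h | h
      · have : Real.smoothTransition =ᶠ[𝓝 z] fun _ => 0 := by
          filter_upwards [eventually_lt_nhds h] with w hw
          exact Real.smoothTransition.zero_of_nonpos hw.le
        rw [this.deriv_eq]; simp
      · have h1 : 1 < z := by
          by_contra h2; exact hz ⟨h, not_lt.1 h2⟩
        have : Real.smoothTransition =ᶠ[𝓝 z] fun _ => 1 := by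
          filter_upwards [eventually_gt_nhds h1] with w hw
          exact Real.smoothTransition.one_of_one_le hw.le
        rw [this.deriv_eq]; simp
    rw [h0, abs_zero]
    exact (norm_nonneg _).trans (hB 0 (by simp))

/-- A smooth periodic bump of width `δ` around the integers. -/
def bump (δ y : ℝ) : ℝ := Real.smoothTransition (2 - Real.sin (Real.pi * y) ^ 2 / δ ^ 2)

lemma contDiff_bump (δ : ℝ) : ContDiff ℝ ∞ (bump δ) := by
  unfold bump
  exact Real.smoothTransition.contDiff.comp (by fun_prop)

/-- sin(πy) only changes sign under y ↦ y + 1, so its square has period 1; this is why the square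
enters the bump. -/
lemma bump_periodic (δ : ℝ) : Function.Periodic (bump δ) 1 := by
  intro y
  simp [bump, mul_add, Real.sin_add_pi]

lemma bump_nonneg (δ y : ℝ) : 0 ≤ bump δ y := Real.smoothTransition.nonneg _

lemma deriv_bump (δ y : ℝ) : deriv (bump δ) y =
    deriv Real.smoothTransition (2 - Real.sin (Real.pi * y) ^ 2 / δ ^ 2) *
      (-(2 * Real.sin (Real.pi * y) * (Real.cos (Real.pi * y) * Real.pi) / δ ^ 2)) := by
  have h1 : HasDerivAt (fun y : ℝ => 2 - Real.sin (Real.pi * y) ^ 2 / δ ^ 2)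
      (-(2 * Real.sin (Real.pi * y) * (Real.cos (Real.pi * y) * Real.pi) / δ ^ 2)) y := by
    have h2 : HasDerivAt (fun y : ℝ => Real.pi * y) Real.pi y := by
      simpa using (hasDerivAt_id y).const_mul Real.pi
    simpa using ((h2.sin.fun_pow 2).div_const (δ ^ 2)).const_sub 2
  exact (((Real.smoothTransition.contDiff (n := 1)).differentiable (by simp) _).hasDerivAt.comp y
    h1).deriv

lemma deriv_bump_periodic (δ : ℝ) : Function.Periodic (deriv (bump δ)) 1 := by
  intro y
  rw [← deriv_comp_add_const]
  congr 1
  exact funext fun z => bump_periodic δ z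

/-- The bump already vanishes for sin² ≥ 2δ². The open condition |sin| > 2δ therefore kills the bump
on a neighbourhood, hence its derivative as well. -/
lemma sin_sq_le_of_bump_ne_zero {δ y : ℝ} (hδ : 0 < δ)
    (h : bump δ y ≠ 0 ∨ deriv (bump δ) y ≠ 0) : |Real.sin (Real.pi * y)| ≤ 2 * δ := by
  by_contra! hlt
  have hs : ∀ᶠ z in 𝓝 y, 2 * δ < |Real.sin (Real.pi * z)| :=
    (by fun_prop : Continuous fun z => |Real.sin (Real.pi * z)|).continuousAt.eventually
      (eventually_gt_nhds hlt)
  have h0 : bump δ =ᶠ[𝓝 y] fun _ => 0 := by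
    filter_upwards [hs] with z hz
    refine Real.smoothTransition.zero_of_nonpos ?_
    rw [sub_nonpos, le_div_iff₀ (by positivity), ← sq_abs (Real.sin _)]
    nlinarith
  rcases h with h | h
  · exact h h0.self_of_nhds
  · exact h (by rw [h0.deriv_eq]; simp)

/-- Jordan's inequality after subtracting the nearest integer. It converts a bound on the sine into
a bound on the distance to 0 in the circle. -/
lemma two_mul_norm_le_abs_sin (y : ℝ) : 2 * ‖(y : UnitAddCircle)‖ ≤ |Real.sin (Real.pi * y)| := by
  rw [UnitAddCircle.norm_eq]
  have h1 : |Real.sin (Real.pi * y)| = |Real.sin (Real.pi * (y - round y))| := by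
    rw [mul_sub, mul_comm Real.pi (round y : ℝ), Real.sin_sub_int_mul_pi, abs_mul]
    simp
  rw [h1]
  have h2 : |Real.pi * (y - round y)| ≤ Real.pi / 2 := by
    rw [abs_mul, abs_of_pos Real.pi_pos]
    nlinarith [abs_sub_round y, Real.pi_pos]
  have h3 := Real.mul_abs_le_abs_sin h2
  rwa [abs_mul, abs_of_pos Real.pi_pos, ← mul_assoc, div_mul_cancel₀ _ Real.pi_ne_zero] at h3

/-- Here |sin(πy)| ≤ πδ/4 ≤ δ since π ≤ 4, so the argument of the transition function is at least 1.
-/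
lemma bump_eq_one {δ y : ℝ} (hδ : 0 < δ) (h : ‖(y : UnitAddCircle)‖ ≤ δ / 4) : bump δ y = 1 := by
  rw [UnitAddCircle.norm_eq] at h
  refine Real.smoothTransition.one_of_one_le ?_
  have h1 : |Real.sin (Real.pi * y)| = |Real.sin (Real.pi * (y - round y))| := by
    rw [mul_sub, mul_comm Real.pi (round y : ℝ), Real.sin_sub_int_mul_pi, abs_mul]
    simp
  have h2 : |Real.sin (Real.pi * y)| ≤ δ := by
    rw [h1]
    refine Real.abs_sin_le_abs.trans ?_
    rw [abs_mul, abs_of_pos Real.pi_pos]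
    nlinarith [Real.pi_le_four, Real.pi_pos, abs_nonneg (y - round y)]
  have : Real.sin (Real.pi * y) ^ 2 / δ ^ 2 ≤ 1 := by
    rw [div_le_one (by positivity), ← sq_abs]
    exact pow_le_pow_left₀ (abs_nonneg _) h2 2
  linarith

/-- Normalise the bump by its mass. What matters later is that the gradient constant does not depend
on δ. -/
lemma exists_circle_kernel : ∃ C : ℝ, 0 ≤ C ∧ ∀ δ : ℝ, 0 < δ → δ ≤ 1 →
    ∃ k k' : UnitAddCircle → ℝ, ContDiff ℝ ∞ (fun y : ℝ => k y) ∧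
      (∀ y : ℝ, HasDerivAt (fun y : ℝ => k y) (k' y) y) ∧ (∀ x, 0 ≤ k x) ∧ ∫ x, k x = 1 ∧
      (∀ x, k x ≠ 0 → ‖x‖ ≤ δ) ∧ ∫ x, |k' x| ≤ C / δ := by
  obtain ⟨B, hB0, hB⟩ := exists_smoothTransition_deriv_bound
  -- The derivative has L¹ norm at most 32B before normalisation and the mass is at least δ/2, which
  -- gives 64B/δ; 128 leaves room.
  refine ⟨128 * B, by positivity, fun δ hδ hδ1 => ?_⟩
  set κ : UnitAddCircle → ℝ := (bump_periodic δ).lift with hκ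
  set κ' : UnitAddCircle → ℝ := (deriv_bump_periodic δ).lift with hκ'
  have hκc : ∀ y : ℝ, κ y = bump δ y := fun y => rfl
  have hκc' : ∀ y : ℝ, κ' y = deriv (bump δ) y := fun y => rfl
  have hcont : Continuous κ :=
    QuotientAddGroup.isOpenQuotientMap_mk.isQuotientMap.continuous_iff.2 (contDiff_bump δ).continuous
  have hcont' : Continuous κ' :=
    QuotientAddGroup.isOpenQuotientMap_mk.isQuotientMap.continuous_iff.2
      ((contDiff_bump δ).continuous_deriv (by simp))
  have hint : ∀ f : UnitAddCircle → ℝ, Continuous f → Integrable f := fun f hf =>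
    hf.integrable_of_hasCompactSupport (HasCompactSupport.of_compactSpace f)
  have hnn : ∀ x, 0 ≤ κ x := fun x => by
    obtain ⟨y, rfl⟩ := QuotientAddGroup.mk_surjective x
    exact bump_nonneg δ y
  have hZ : δ / 2 ≤ ∫ x, κ x := by
    have h1 : ∫ x in Metric.closedBall (0 : UnitAddCircle) (δ / 4), (1 : ℝ) = δ / 2 := by
      rw [setIntegral_const, measureReal_def, AddCircle.volume_closedBall, min_eq_right (by linarith),
        ENNReal.toReal_ofReal (by linarith)]
      simp; ring
    rw [← h1]
    calc ∫ x in Metric.closedBall (0 : UnitAddCircle) (δ / 4), (1 : ℝ)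
        = ∫ x in Metric.closedBall (0 : UnitAddCircle) (δ / 4), κ x := by
          refine setIntegral_congr_fun measurableSet_closedBall fun x hx => ?_
          obtain ⟨y, rfl⟩ := QuotientAddGroup.mk_surjective x
          exact (bump_eq_one hδ (by simpa using hx)).symm
      _ ≤ ∫ x, κ x := setIntegral_le_integral (hint κ hcont) (Eventually.of_forall hnn)
  have hZ0 : 0 < ∫ x, κ x := by linarith
  have hsupp : ∀ x, κ x ≠ 0 ∨ κ' x ≠ 0 → ‖x‖ ≤ δ := fun x hx => by
    obtain ⟨y, rfl⟩ := QuotientAddGroup.mk_surjective x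
    have h1 := sin_sq_le_of_bump_ne_zero hδ hx
    have h2 := two_mul_norm_le_abs_sin y
    change ‖(y : UnitAddCircle)‖ ≤ δ
    linarith
  have hbd : ∀ x, |κ' x| ≤ 16 * B / δ := fun x => by
    obtain ⟨y, rfl⟩ := QuotientAddGroup.mk_surjective x
    change |deriv (bump δ) y| ≤ _
    by_cases h0 : deriv (bump δ) y = 0
    · rw [h0, abs_zero]; positivity
    have h1 := sin_sq_le_of_bump_ne_zero hδ (Or.inr h0)
    rw [deriv_bump, abs_mul, abs_neg, abs_div, abs_mul, abs_mul, abs_mul,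
      abs_of_pos Real.pi_pos, abs_of_pos (show (0 : ℝ) < δ ^ 2 by positivity)]
    have h2 : |Real.cos (Real.pi * y)| * Real.pi ≤ 1 * 4 :=
      mul_le_mul (Real.abs_cos_le_one _) Real.pi_le_four Real.pi_pos.le zero_le_one
    calc _ ≤ B * (|2| * (2 * δ) * (1 * 4) / δ ^ 2) := by
          gcongr
          exact hB _
      _ = 16 * B / δ := by
          rw [abs_two]; field_simp; ring
  have hint' : ∫ x, |κ' x| ≤ 32 * B := by
    have h1 : ∫ x, |κ' x| = ∫ x in Metric.closedBall (0 : UnitAddCircle) δ, |κ' x| := by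
      refine (setIntegral_eq_integral_of_forall_compl_eq_zero fun x hx => ?_).symm
      by_contra h
      exact hx (by simpa using hsupp x (Or.inr (by simpa using h)))
    have h2 : volume.real (Metric.closedBall (0 : UnitAddCircle) δ) ≤ 2 * δ := by
      rw [measureReal_def, AddCircle.volume_closedBall, ENNReal.toReal_ofReal (by positivity)]
      exact min_le_right _ _
    rw [h1]
    calc ∫ x in Metric.closedBall (0 : UnitAddCircle) δ, |κ' x|
        ≤ ∫ x in Metric.closedBall (0 : UnitAddCircle) δ, 16 * B / δ :=
          setIntegral_mono (hint _ hcont'.abs).integrableOn (integrable_const _).integrableOn hbd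
      _ = volume.real (Metric.closedBall (0 : UnitAddCircle) δ) * (16 * B / δ) := by
          rw [setIntegral_const, smul_eq_mul]
      _ ≤ 2 * δ * (16 * B / δ) := by gcongr
      _ = 32 * B := by field_simp; ring
  refine ⟨fun x => κ x / ∫ x, κ x, fun x => κ' x / ∫ x, κ x, ?_, ?_, ?_, ?_, ?_, ?_⟩
  · exact (contDiff_bump δ).div_const _
  · intro y
    exact ((contDiff_bump δ).differentiable (by simp) y).hasDerivAt.div_const _
  · exact fun x => div_nonneg (hnn x) hZ0.le
  · rw [integral_div, div_self hZ0.ne']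
  · intro x hx
    exact hsupp x (Or.inl fun h => hx (by simp [h]))
  · simp only [abs_div, abs_of_pos hZ0]
    rw [integral_div, div_le_div_iff₀ hZ0 hδ]
    nlinarith

/-- `η` is a smoothing kernel of width `δ` on the torus, with constant `C` in the
gradient bound. -/
structure IsKernel (C δ : ℝ) (η : Torus d → ℝ) : Prop where
  smooth : IsSmooth η
  nonneg : ∀ x, 0 ≤ η x
  integral_eq_one : ∫ x, η x = 1
  supp : ∀ x, η x ≠ 0 → ‖x‖ ≤ δ
  pd_supp : ∀ j x, pd j η x ≠ 0 → ‖x‖ ≤ δ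
  integral_pd : ∀ j, ∫ x, |pd j η x| ≤ C / δ

/-- A product of circle kernels. The norm on the torus is the maximum of the coordinate norms, so
the support stays in the δ-ball; a partial derivative hits one factor only, and the other factors
integrate to one. -/
lemma exists_kernel (d : ℕ) : ∃ C : ℝ, 0 ≤ C ∧ ∀ δ : ℝ, 0 < δ → δ ≤ 1 →
    ∃ η : Torus d → ℝ, IsKernel C δ η := by
  obtain ⟨C, hC0, hC⟩ := exists_circle_kernel
  refine ⟨C, hC0, fun δ hδ hδ1 => ?_⟩
  obtain ⟨k, k', hs, hd, hnn, h1, hsupp, hk'⟩ := hC δ hδ hδ1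
  have hpd : ∀ (j : Fin d), HasPD j (fun x : Torus d => ∏ i, k (x i))
      (fun x => ∏ i, if i = j then k' (x i) else k (x i)) := fun j x => by
    obtain ⟨y, rfl⟩ := toTorus_surjective x
    have e1 : (fun s : ℝ => ∏ i, k ((toTorus y + shift j s) i)) =
        fun s => k ((y j + s : ℝ) : UnitAddCircle) * ∏ i ∈ Finset.univ.erase j, k (toTorus y i) := by
      funext s
      rw [← Finset.mul_prod_erase _ _ (Finset.mem_univ j)]
      congr 1
      · simp [shift_apply, toTorus]
      · refine Finset.prod_congr rfl fun i hi => ?_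
        simp [shift_apply, Finset.ne_of_mem_erase hi]
    have e2 : (∏ i, if i = j then k' (toTorus y i) else k (toTorus y i)) =
        k' ((y j + 0 : ℝ) : UnitAddCircle) * ∏ i ∈ Finset.univ.erase j, k (toTorus y i) := by
      rw [← Finset.mul_prod_erase _ _ (Finset.mem_univ j)]
      congr 1
      · simp [toTorus]
      · refine Finset.prod_congr rfl fun i hi => ?_
        simp [Finset.ne_of_mem_erase hi]
    rw [e1]
    beta_reduce
    rw [e2]
    exact (HasDerivAt.comp_const_add (y j) 0 (hd (y j + 0))).mul_const _
  have hsupp' : ∀ x, k' x ≠ 0 → ‖x‖ ≤ δ := fun x hx => by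
    obtain ⟨y, rfl⟩ := QuotientAddGroup.mk_surjective x
    by_contra! hlt
    have hev : ∀ᶠ z : ℝ in 𝓝 y, δ < ‖(z : UnitAddCircle)‖ :=
      (continuous_norm.comp (AddCircle.continuous_mk' (1 : ℝ))).continuousAt.eventually
        (eventually_gt_nhds hlt)
    have h0 : (fun z : ℝ => k z) =ᶠ[𝓝 y] fun _ => 0 := by
      filter_upwards [hev] with z hz
      by_contra h
      exact absurd (hsupp z h) (not_le.2 hz)
    have := (hd y).deriv
    rw [h0.deriv_eq] at this
    exact hx (by simpa using this.symm)
  refine ⟨fun x => ∏ i, k (x i), ?_, ?_, ?_, ?_, ?_, ?_⟩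
  · refine contDiff_prod fun i _ => ?_
    exact hs.comp (f := fun y : Vec d => y i) (by fun_prop)
  · exact fun x => Finset.prod_nonneg fun i _ => hnn _
  · rw [integral_fintype_prod_volume_eq_prod (fun _ => k)]
    simp [h1]
  · intro x hx
    rw [pi_norm_le_iff_of_nonneg hδ.le]
    exact fun i => hsupp _ (Finset.prod_ne_zero_iff.1 hx i (Finset.mem_univ i))
  · intro j x hx
    rw [(hpd j).pd_eq] at hx
    rw [pi_norm_le_iff_of_nonneg hδ.le]
    intro i
    have := Finset.prod_ne_zero_iff.1 hx i (Finset.mem_univ i)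
    split_ifs at this
    · exact hsupp' _ this
    · exact hsupp _ this
  · intro j
    rw [(hpd j).pd_eq]
    have e : ∀ x : Torus d, |∏ i, if i = j then k' (x i) else k (x i)| =
        ∏ i, (if i = j then fun z => |k' z| else k) (x i) := fun x => by
      rw [Finset.abs_prod]
      refine Finset.prod_congr rfl fun i _ => ?_
      split_ifs
      · rfl
      · exact abs_of_nonneg (hnn _)
    simp only [e]
    rw [integral_fintype_prod_volume_eq_prod (fun i => if i = j then fun z => |k' z| else k),
      ← Finset.mul_prod_erase _ _ (Finset.mem_univ j), Finset.prod_eq_one]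
    · simpa using hk'
    · intro i hi
      simp [Finset.ne_of_mem_erase hi, h1]

/-! ### Convolution -/

/-- Convolution on the torus. -/
def conv (K f : Torus d → ℝ) (x : Torus d) : ℝ := ∫ y, K y * f (x - y)

lemma conv_eq (K f : Torus d → ℝ) (x : Torus d) : conv K f x = ∫ y, K (x - y) * f y := by
  rw [conv, ← integral_sub_left_eq_self (fun y => K (x - y) * f y) volume x]
  simp

lemma Continuous.integrable_mul_torus {K f : Torus d → ℝ} (hK : Continuous K) (hf : Integrable f) :
    Integrable (fun y => K y * f y) := by
  obtain ⟨C, -, hC⟩ := exists_bound_torus hK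
  exact hf.bdd_mul (c := C) hK.aestronglyMeasurable (Eventually.of_forall hC)

lemma integrable_conv_left {K f : Torus d → ℝ} (hK : Continuous K) (hf : Integrable f)
    (x : Torus d) : Integrable (fun y => K (x - y) * f y) :=
  Continuous.integrable_mul_torus (by fun_prop) hf

lemma integrable_conv_right {K f : Torus d → ℝ} (hK : Continuous K) (hf : Integrable f)
    (x : Torus d) : Integrable (fun y => K y * f (x - y)) :=
  Continuous.integrable_mul_torus hK (hf.comp_sub_left x)

lemma conv_congr_ae {K f g : Torus d → ℝ} (h : f =ᵐ[volume] g) : conv K f = conv K g := by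
  funext x
  simp only [conv_eq]
  exact integral_congr_ae (h.mono fun y hy => by simp only [hy])

lemma continuous_conv {K f : Torus d → ℝ} (hK : Continuous K) (hf : Integrable f) :
    Continuous (conv K f) := by
  obtain ⟨C, -, hC⟩ := exists_bound_torus hK
  have : conv K f = fun x => ∫ y, K (x - y) * f y := funext fun x => conv_eq K f x
  rw [this]
  refine continuous_of_dominated (bound := fun y => C * |f y|)
    (fun x => (integrable_conv_left hK hf x).aestronglyMeasurable)
    (fun x => Eventually.of_forall fun y => ?_) (hf.abs.const_mul C)
    (Eventually.of_forall fun y => by fun_prop)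
  rw [Real.norm_eq_abs, abs_mul]
  exact mul_le_mul_of_nonneg_right (hC _) (abs_nonneg _)

lemma hasPD_conv {j : Fin d} {K K' f : Torus d → ℝ} (h : HasPD j K K') (hK : Continuous K)
    (hK' : Continuous K') (hf : Integrable f) : HasPD j (conv K f) (conv K' f) := by
  intro x
  obtain ⟨C, -, hC⟩ := exists_bound_torus hK'
  have key := (hasDerivAt_integral_of_dominated_loc_of_deriv_le
    (μ := (volume : Measure (Torus d)))
    (F := fun (s : ℝ) y => K (x + shift j s - y) * f y)
    (F' := fun s y => K' (x - y + shift j s) * f y)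
    (bound := fun y => C * |f y|) (x₀ := 0) (s := Set.univ) univ_mem
    (Eventually.of_forall fun s => (integrable_conv_left hK hf _).aestronglyMeasurable)
    (integrable_conv_left hK hf _)
    (by simpa using (integrable_conv_left hK' hf x).aestronglyMeasurable)
    (Eventually.of_forall fun y s _ => by
      rw [Real.norm_eq_abs, abs_mul]
      exact mul_le_mul_of_nonneg_right (hC _) (abs_nonneg _)) (hf.abs.const_mul C)
    (Eventually.of_forall fun y s _ => by
      have := (h.hasDerivAt (x - y) s).mul_const (f y)
      simpa only [sub_add_eq_add_sub] using this)).2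
  simp only [shift_zero, add_zero] at key
  simp only [conv_eq]
  exact key

lemma abs_conv_le {K f : Torus d → ℝ} {C : ℝ} (hC : ∀ x, |K x| ≤ C) (hf : Integrable f)
    (x : Torus d) : |conv K f x| ≤ C * ∫ y, |f y| := by
  rw [conv_eq, ← integral_const_mul]
  rw [← Real.norm_eq_abs]
  refine norm_integral_le_of_norm_le (hf.abs.const_mul C) (Eventually.of_forall fun y => ?_)
  rw [Real.norm_eq_abs, abs_mul]
  exact mul_le_mul_of_nonneg_right (hC _) (abs_nonneg _)

/-! ### Minkowski's inequality for weighted averages -/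

/-- Hölder's inequality for the finite measure with density `k`, followed by Tonelli. The bound on
the slices is needed only where the weight is nonzero, which is how the small support of a kernel
enters. -/
lemma eLpNorm_le_of_enorm_le_lintegral {X Y : Type*} [MeasurableSpace X] [MeasurableSpace Y]
    {μ : Measure X} [SFinite μ] {ν : Measure Y} [SFinite ν] {k : Y → ℝ≥0∞} (hk : Measurable k)
    (hk1 : ∫⁻ y, k y ∂ν ≠ ⊤) {F : X → Y → ℝ}
    (hF : AEStronglyMeasurable (Function.uncurry F) (μ.prod ν)) {g : X → ℝ}
    (hg : ∀ᵐ x ∂μ, ‖g x‖ₑ ≤ ∫⁻ y, k y * ‖F x y‖ₑ ∂ν) {p : ℝ≥0∞} (hp1 : 1 ≤ p) (hp : p ≠ ⊤)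
    {B : ℝ≥0∞} (hB : ∀ y, k y ≠ 0 → eLpNorm (fun x => F x y) p μ ≤ B) :
    eLpNorm g p μ ≤ (∫⁻ y, k y ∂ν) * B := by
  set κ := ∫⁻ y, k y ∂ν with hκ
  set γ := ν.withDensity k with hγ
  have hγu : γ Set.univ = κ := by rw [hγ, withDensity_apply _ MeasurableSet.univ]; simp [hκ]
  have : IsFiniteMeasure γ := ⟨by rw [hγu]; exact hk1.lt_top⟩
  have hac : γ ≪ ν := withDensity_absolutelyContinuous _ _
  have hFγ : AEStronglyMeasurable (Function.uncurry F) (μ.prod γ) :=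
    hF.mono_ac (Measure.AbsolutelyContinuous.prod Measure.AbsolutelyContinuous.rfl hac)
  have hp0 : p ≠ 0 := (zero_lt_one.trans_le hp1).ne'
  have hpr : 1 ≤ p.toReal := by simpa using ENNReal.toReal_mono hp hp1
  have hpr0 : 0 < p.toReal := by linarith
  have hsec : ∀ᵐ x ∂μ, AEStronglyMeasurable (F x) ν := hF.prodMk_left
  have hsecγ : ∀ᵐ x ∂μ, AEStronglyMeasurable (F x) γ := hFγ.prodMk_left
  have hpt : ∀ᵐ x ∂μ, ‖g x‖ₑ ^ p.toReal ≤
      (∫⁻ y, ‖F x y‖ₑ ^ p.toReal ∂γ) * κ ^ (p.toReal - 1) := by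
    filter_upwards [hg, hsec, hsecγ] with x hx h1 h2
    have e1 : ∫⁻ y, k y * ‖F x y‖ₑ ∂ν = eLpNorm (F x) 1 γ := by
      rw [eLpNorm_one_eq_lintegral_enorm, hγ,
        lintegral_withDensity_eq_lintegral_mul₀ hk.aemeasurable h1.enorm]
      rfl
    have e2 := eLpNorm_le_eLpNorm_mul_rpow_measure_univ hp1 h2
    rw [hγu, eLpNorm_eq_lintegral_rpow_enorm_toReal hp0 hp] at e2
    rw [e1] at hx
    calc ‖g x‖ₑ ^ p.toReal ≤ _ := ENNReal.rpow_le_rpow (hx.trans e2) hpr0.le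
      _ = _ := by
        rw [ENNReal.mul_rpow_of_nonneg _ _ hpr0.le, ← ENNReal.rpow_mul, ← ENNReal.rpow_mul]
        congr 2
        · rw [one_div_mul_cancel hpr0.ne', ENNReal.rpow_one]
        · rw [ENNReal.toReal_one]; field_simp
  have hmain : ∫⁻ x, ‖g x‖ₑ ^ p.toReal ∂μ ≤ (κ * B) ^ p.toReal := by
    calc ∫⁻ x, ‖g x‖ₑ ^ p.toReal ∂μ
        ≤ ∫⁻ x, (∫⁻ y, ‖F x y‖ₑ ^ p.toReal ∂γ) * κ ^ (p.toReal - 1) ∂μ := lintegral_mono_ae hpt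
      _ = (∫⁻ x, ∫⁻ y, ‖F x y‖ₑ ^ p.toReal ∂γ ∂μ) * κ ^ (p.toReal - 1) :=
          lintegral_mul_const' _ _ (ENNReal.rpow_ne_top_of_nonneg (by linarith) hk1)
      _ = (∫⁻ y, ∫⁻ x, ‖F x y‖ₑ ^ p.toReal ∂μ ∂γ) * κ ^ (p.toReal - 1) := by
          rw [lintegral_lintegral_swap]
          exact hFγ.enorm.pow_const _
      _ ≤ (∫⁻ _y, B ^ p.toReal ∂γ) * κ ^ (p.toReal - 1) := by
          refine mul_le_mul_left (lintegral_mono_ae ?_) _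
          have hne : ∀ᵐ y ∂γ, k y ≠ 0 := by
            rw [hγ, ae_withDensity_iff hk]
            exact Eventually.of_forall fun y h => h
          filter_upwards [hne] with y hy
          have := hB y hy
          rw [eLpNorm_eq_lintegral_rpow_enorm_toReal hp0 hp] at this
          calc _ = ((∫⁻ x, ‖F x y‖ₑ ^ p.toReal ∂μ) ^ (1 / p.toReal)) ^ p.toReal := by
                rw [← ENNReal.rpow_mul, one_div_mul_cancel hpr0.ne', ENNReal.rpow_one]
            _ ≤ _ := ENNReal.rpow_le_rpow this hpr0.le
      _ = (κ * B) ^ p.toReal := by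
          rw [lintegral_const, hγu, ENNReal.mul_rpow_of_nonneg _ _ hpr0.le, mul_assoc, mul_comm]
          congr 1
          rcases eq_or_ne κ 0 with h | h
          · simp [h, hpr0]
          · nth_rw 1 [← ENNReal.rpow_one κ]
            rw [← ENNReal.rpow_add _ _ h hk1]; congr 1; ring
  rw [eLpNorm_eq_lintegral_rpow_enorm_toReal hp0 hp]
  calc _ ≤ ((κ * B) ^ p.toReal) ^ (1 / p.toReal) := ENNReal.rpow_le_rpow hmain (by positivity)
    _ = κ * B := by rw [← ENNReal.rpow_mul, mul_one_div_cancel hpr0.ne', ENNReal.rpow_one]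

lemma AEStronglyMeasurable.comp_sub_torus {f : Torus d → ℝ} (hf : AEStronglyMeasurable f) :
    AEStronglyMeasurable (fun z : Torus d × Torus d => f (z.1 - z.2)) (volume.prod volume) :=
  hf.comp_quasiMeasurePreserving (quasiMeasurePreserving_sub volume volume)

lemma eLpNorm_comp_sub {f : Torus d → ℝ} (hf : AEStronglyMeasurable f) (p : ℝ≥0∞) (w : Torus d) :
    eLpNorm (fun x => f (x - w)) p volume = eLpNorm f p volume :=
  eLpNorm_comp_measurePreserving hf (measurePreserving_sub_right volume w)

lemma eLpNorm_comp_add {f : Torus d → ℝ} (hf : AEStronglyMeasurable f) (p : ℝ≥0∞) (w : Torus d) :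
    eLpNorm (fun x => f (x + w)) p volume = eLpNorm f p volume :=
  eLpNorm_comp_measurePreserving hf (measurePreserving_add_right volume w)

lemma aestronglyMeasurable_comp_add {f : Torus d → ℝ} (hf : AEStronglyMeasurable f)
    (w : Torus d) : AEStronglyMeasurable (fun x => f (x + w)) :=
  hf.comp_measurePreserving (measurePreserving_add_right volume w)

lemma enorm_integral_mul_le {Y : Type*} [MeasurableSpace Y] {ν : Measure Y} (k f : Y → ℝ) :
    ‖∫ y, k y * f y ∂ν‖ₑ ≤ ∫⁻ y, ‖k y‖ₑ * ‖f y‖ₑ ∂ν := by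
  refine (enorm_integral_le_lintegral_enorm _).trans_eq ?_
  simp only [enorm_mul]

lemma lintegral_enorm_eq_ofReal {K : Torus d → ℝ} (hK : Continuous K) :
    ∫⁻ y, ‖K y‖ₑ = ENNReal.ofReal (∫ y, |K y|) := by
  rw [← ofReal_integral_norm_eq_lintegral_enorm (Continuous.integrable_torus hK)]
  rfl

lemma eLpNorm_conv_le {K f : Torus d → ℝ} (hK : Continuous K) (hf : AEStronglyMeasurable f)
    {p : ℝ≥0∞} (hp1 : 1 ≤ p) (hp : p ≠ ⊤) :
    eLpNorm (conv K f) p volume ≤ ENNReal.ofReal (∫ y, |K y|) * eLpNorm f p volume := by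
  rw [← lintegral_enorm_eq_ofReal hK]
  refine eLpNorm_le_of_enorm_le_lintegral (μ := volume) (ν := volume) (k := fun y => ‖K y‖ₑ)
    (F := fun x y => f (x - y)) hK.measurable.enorm
    (by rw [lintegral_enorm_eq_ofReal hK]; exact ENNReal.ofReal_ne_top)
    (AEStronglyMeasurable.comp_sub_torus hf)
    (Eventually.of_forall fun x => enorm_integral_mul_le _ _) hp1 hp
    (fun y _ => (eLpNorm_comp_sub hf p y).le)

/-! ### Continuity of translations -/

/-- Translations are measure preserving continuous maps depending continuously on the displacement,
and composition with such maps is continuous in Lᵖ for finite p. -/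
lemma tendsto_eLpNorm_translate {f : Torus d → ℝ} {p : ℝ≥0∞} (hp1 : 1 ≤ p) (hp : p ≠ ⊤)
    (hf : MemLp f p) :
    Tendsto (fun w : Torus d => eLpNorm (fun x => f (x - w) - f x) p volume) (𝓝 0) (𝓝 0) := by
  have : Fact (1 ≤ p) := ⟨hp1⟩
  let g : Torus d → C(Torus d, Torus d) := fun w => ⟨fun x => x - w, by fun_prop⟩
  have hg : Continuous g := ContinuousMap.continuous_of_continuous_uncurry g (by
    change Continuous fun z : Torus d × Torus d => z.2 - z.1
    fun_prop)
  have hgm : ∀ w, MeasurePreserving (g w) volume volume :=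
    fun w => measurePreserving_sub_right volume w
  have key := (tendsto_const_nhds (x := hf.toLp f) (f := 𝓝 (0 : Torus d))).compMeasurePreservingLp
    (hg.tendsto 0) hgm (hgm 0) hp
  simp only [Lp.toLp_compMeasurePreserving] at key
  rw [Lp.tendsto_Lp_iff_tendsto_eLpNorm''] at key
  refine key.congr fun w => ?_
  congr 1
  funext x
  simp [g]

lemma IsKernel.continuous {C δ : ℝ} {η : Torus d → ℝ} (h : IsKernel C δ η) : Continuous η :=
  h.smooth.continuous

lemma IsKernel.integral_abs {C δ : ℝ} {η : Torus d → ℝ} (h : IsKernel C δ η) :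
    ∫ x, |η x| = 1 := by
  simp only [abs_of_nonneg (h.nonneg _), h.integral_eq_one]

lemma IsKernel.lintegral_enorm {C δ : ℝ} {η : Torus d → ℝ} (h : IsKernel C δ η) :
    ∫⁻ x, ‖η x‖ₑ = 1 := by
  rw [lintegral_enorm_eq_ofReal h.continuous, h.integral_abs, ENNReal.ofReal_one]

lemma IsKernel.eLpNorm_conv_le {C δ : ℝ} {η : Torus d → ℝ} (h : IsKernel C δ η)
    {f : Torus d → ℝ} (hf : AEStronglyMeasurable f) {p : ℝ≥0∞} (hp1 : 1 ≤ p) (hp : p ≠ ⊤) :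
    eLpNorm (conv η f) p volume ≤ eLpNorm f p volume := by
  have := CNS.eLpNorm_conv_le h.continuous hf hp1 hp
  rwa [h.integral_abs, ENNReal.ofReal_one, one_mul] at this

/-! ### Mollification and its convergence -/

/-- A sequence of kernels whose widths tend to zero. -/
structure Mollifier (C : ℝ) (δ : ℕ → ℝ) (η : ℕ → Torus d → ℝ) : Prop where
  const_nonneg : 0 ≤ C
  pos : ∀ n, 0 < δ n
  tendsto : Tendsto δ atTop (𝓝 0)
  kernel : ∀ n, IsKernel C (δ n) (η n)

lemma exists_mollifier (d : ℕ) : ∃ (C : ℝ) (δ : ℕ → ℝ) (η : ℕ → Torus d → ℝ), Mollifier C δ η := by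
  obtain ⟨C, hC0, hC⟩ := exists_kernel d
  choose η hη using fun n : ℕ => hC (1 / ((n : ℝ) + 1)) (by positivity)
    (by rw [div_le_one (by positivity)]; linarith [n.cast_nonneg (α := ℝ)])
  exact ⟨C, fun n => 1 / ((n : ℝ) + 1), η, hC0, fun n => by positivity,
    tendsto_one_div_add_atTop_nhds_zero_nat, hη⟩

namespace Mollifier

variable {C : ℝ} {δ : ℕ → ℝ} {η : ℕ → Torus d → ℝ}

/-- The kernel only sees displacements of size δ, for which translation differences are uniformly
small in Lᵖ. The factor `c` is there so that density-weighted averages are covered along with plain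
convolution. -/
lemma tendsto_of_le_average (h : Mollifier C δ η) {f : Torus d → ℝ} {p : ℝ≥0∞} (hp1 : 1 ≤ p)
    (hp : p ≠ ⊤) (hf : MemLp f p) {c : ℝ≥0∞} (hc : c ≠ ⊤) {g : ℕ → Torus d → ℝ}
    (hg : ∀ n, ∀ᵐ x, ‖g n x‖ₑ ≤ c * ∫⁻ y, ‖η n y‖ₑ * ‖f (x - y) - f x‖ₑ) :
    Tendsto (fun n => eLpNorm (g n) p volume) atTop (𝓝 0) := by
  have hmeas : AEStronglyMeasurable (Function.uncurry fun x y : Torus d => f (x - y) - f x)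
      (volume.prod volume) :=
    (AEStronglyMeasurable.comp_sub_torus hf.1).sub hf.1.comp_fst
  have hT := tendsto_eLpNorm_translate hp1 hp hf
  rw [ENNReal.tendsto_nhds_zero] at hT ⊢
  intro ε hε
  rcases eq_or_ne ε ⊤ with rfl | hε'
  · simp
  obtain ⟨ε', hε'0, hcε⟩ : ∃ ε' : ℝ≥0∞, 0 < ε' ∧ c * ε' ≤ ε := by
    -- Dividing by c + 1 rather than c also covers c = 0.
    refine ⟨ε / (c + 1), ENNReal.div_pos hε.ne' (by simp [hc]), ?_⟩
    calc c * (ε / (c + 1)) ≤ (c + 1) * (ε / (c + 1)) := by gcongr; exact le_self_add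
      _ = ε := ENNReal.mul_div_cancel (by simp) (by simp [hc])
  obtain ⟨r, hr, hrT⟩ := Metric.eventually_nhds_iff.1 (hT ε' hε'0)
  filter_upwards [h.tendsto.eventually (gt_mem_nhds hr)] with n hn
  have hk := h.kernel n
  have hint : ∫⁻ y, c * ‖η n y‖ₑ = c := by
    rw [lintegral_const_mul _ hk.continuous.measurable.enorm, hk.lintegral_enorm, mul_one]
  have := eLpNorm_le_of_enorm_le_lintegral (μ := (volume : Measure (Torus d)))
    (ν := (volume : Measure (Torus d))) (k := fun y => c * ‖η n y‖ₑ)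
    (F := fun x y => f (x - y) - f x) (hk.continuous.measurable.enorm.const_mul c)
    (by rw [hint]; exact hc) hmeas (g := g n)
    (by
      filter_upwards [hg n] with x hx
      refine hx.trans_eq ?_
      rw [← lintegral_const_mul' _ _ hc]
      simp only [mul_assoc]) hp1 hp (B := ε')
    (fun y hy => by
      refine hrT ?_
      rw [dist_zero_right]
      refine (hk.supp y fun h0 => hy (by simp [h0])).trans_lt hn)
  rw [hint] at this
  exact this.trans hcε

lemma tendsto_conv (h : Mollifier C δ η) {f : Torus d → ℝ} {p : ℝ≥0∞} (hp1 : 1 ≤ p)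
    (hp : p ≠ ⊤) (hf : MemLp f p) :
    Tendsto (fun n => eLpNorm (fun x => conv (η n) f x - f x) p volume) atTop (𝓝 0) := by
  refine h.tendsto_of_le_average hp1 hp hf (c := 1) (by simp) fun n => ?_
  refine Eventually.of_forall fun x => ?_
  have hk := h.kernel n
  have e : conv (η n) f x - f x = ∫ y, η n y * (f (x - y) - f x) := by
    simp only [mul_sub]
    rw [integral_sub (integrable_conv_right hk.continuous (hf.integrable hp1) x)
      ((Continuous.integrable_torus hk.continuous).mul_const _), integral_mul_const,
      hk.integral_eq_one, one_mul, conv]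
  rw [e, one_mul]
  exact enorm_integral_mul_le _ _

end Mollifier

/-! ### Weak derivatives and translation estimates -/

/-- `g` is the weak partial derivative `∂f/∂x_j`. -/
def HasWeakPD (j : Fin d) (f g : Torus d → ℝ) : Prop :=
  ∀ φ : Torus d → ℝ, IsSmooth φ → ∫ x, f x * pd j φ x = - ∫ x, g x * φ x

/-- Test with y ↦ η(x - y): the sign from the reflection cancels the sign in the definition of the
weak derivative. -/
lemma HasWeakPD.conv_pd {j : Fin d} {f g η : Torus d → ℝ} (h : HasWeakPD j f g)
    (hη : IsSmooth η) : conv (pd j η) f = conv η g := by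
  funext x
  have h1 := h _ (hη.sub_left x)
  rw [hη.pd_sub_left x j] at h1
  simp only [mul_neg, integral_neg, neg_inj] at h1
  rw [conv_eq, conv_eq]
  simpa only [mul_comm] using h1

lemma HasWeakPD.hasPD_conv {j : Fin d} {f g η : Torus d → ℝ} (h : HasWeakPD j f g)
    (hη : IsSmooth η) (hf : Integrable f) : HasPD j (conv η f) (conv η g) := by
  rw [← h.conv_pd hη]
  exact CNS.hasPD_conv (hη.hasPD j) hη.continuous (hη.continuous_pd j) hf

/-- The fundamental theorem of calculus along the coordinate line, then Minkowski's inequality over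
the segment. -/
lemma HasPD.eLpNorm_shift_sub_le {j : Fin d} {f f' : Torus d → ℝ} (h : HasPD j f f')
    (hf' : Continuous f') {p : ℝ≥0∞} (hp1 : 1 ≤ p) (hp : p ≠ ⊤) (s : ℝ) :
    eLpNorm (fun x => f (x + shift j s) - f x) p volume ≤
      ENNReal.ofReal |s| * eLpNorm f' p volume := by
  have hint : ∫⁻ _t in Set.uIoc 0 s, (1 : ℝ≥0∞) = ENNReal.ofReal |s| := by
    simp [Set.uIoc, Real.volume_Ioc, max_sub_min_eq_abs]
  have hc := continuous_shift j
  rw [← hint]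
  refine eLpNorm_le_of_enorm_le_lintegral (μ := volume) (ν := volume.restrict (Set.uIoc 0 s))
    (k := fun _ => 1) (F := fun x t => f' (x + shift j t)) measurable_const
    (by rw [hint]; simp)
    (by fun_prop : Continuous fun z : Torus d × ℝ => f' (z.1 + shift j z.2)).aestronglyMeasurable
    (Eventually.of_forall fun x => ?_) hp1 hp
    (fun t _ => (eLpNorm_comp_add hf'.aestronglyMeasurable p _).le)
  have e := intervalIntegral.integral_eq_sub_of_hasDerivAt (a := 0) (b := s)
    (fun t _ => h.hasDerivAt x t)
    ((by fun_prop : Continuous fun t : ℝ => f' (x + shift j t)).intervalIntegrable _ _)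
  simp only [shift_zero, add_zero] at e
  rw [← e, ← ofReal_norm, intervalIntegral.norm_intervalIntegral_eq, ofReal_norm]
  simpa using enorm_integral_le_lintegral_enorm (μ := volume.restrict (Set.uIoc 0 s))
    (fun t => f' (x + shift j t))

/-- The classical estimate for the mollification, whose derivative is the mollified `g`, passes to
the limit; the approximation error enters twice, once at each end of the shift. -/
lemma HasWeakPD.eLpNorm_shift_sub_le {j : Fin d} {f g : Torus d → ℝ} (h : HasWeakPD j f g)
    {p : ℝ≥0∞} (hp1 : 1 ≤ p) (hp : p ≠ ⊤) (hf : MemLp f p) (hg : MemLp g p) (s : ℝ) :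
    eLpNorm (fun x => f (x + shift j s) - f x) p volume ≤
      ENNReal.ofReal |s| * eLpNorm g p volume := by
  obtain ⟨C, δ, η, hη⟩ := exists_mollifier d
  have hT := hη.tendsto_conv hp1 hp hf
  have hlim : Tendsto (fun n => eLpNorm (fun x => conv (η n) f x - f x) p volume +
      ENNReal.ofReal |s| * eLpNorm g p volume +
      eLpNorm (fun x => conv (η n) f x - f x) p volume) atTop
      (𝓝 (0 + ENNReal.ofReal |s| * eLpNorm g p volume + 0)) :=
    (hT.add tendsto_const_nhds).add hT
  rw [zero_add, add_zero] at hlim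
  refine ge_of_tendsto hlim (Eventually.of_forall fun n => ?_)
  have hk := hη.kernel n
  have hcf := continuous_conv hk.continuous (hf.integrable hp1)
  have hcg := continuous_conv hk.continuous (hg.integrable hp1)
  have hm1 : AEStronglyMeasurable (fun x => conv (η n) f x - f x) volume :=
    hcf.aestronglyMeasurable.sub hf.1
  have hm2 := aestronglyMeasurable_comp_add hm1 (shift j s)
  have hm3 : AEStronglyMeasurable (fun x => conv (η n) f (x + shift j s) - conv (η n) f x)
    (volume : Measure (Torus d)) := (by fun_prop : Continuous _).aestronglyMeasurable
  have e : (fun x => f (x + shift j s) - f x) =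
      ((fun x => conv (η n) f x - f x) + fun x => conv (η n) f (x + shift j s) - conv (η n) f x)
      - fun x => conv (η n) f (x + shift j s) - f (x + shift j s) := by
    funext x; simp only [Pi.add_apply, Pi.sub_apply]; ring
  rw [e]
  refine (eLpNorm_sub_le (hm1.add hm3) hm2 hp1).trans ?_
  refine add_le_add ((eLpNorm_add_le hm1 hm3 hp1).trans ?_) ?_
  · gcongr
    refine ((h.hasPD_conv hk.smooth (hf.integrable hp1)).eLpNorm_shift_sub_le hcg hp1 hp s).trans ?_
    gcongr
    exact hk.eLpNorm_conv_le hg.1 hp1 hp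
  · exact (eLpNorm_comp_add hm1 p (shift j s)).le

lemma exists_real_repr (w : UnitAddCircle) : ∃ s : ℝ, (s : UnitAddCircle) = w ∧ |s| = ‖w‖ := by
  obtain ⟨y, rfl⟩ := QuotientAddGroup.mk_surjective w
  refine ⟨y - round y, ?_, ?_⟩
  · have : ((round y : ℝ) : UnitAddCircle) = 0 := by
      rw [AddCircle.coe_eq_zero_iff]; exact ⟨round y, by simp⟩
    rw [AddCircle.coe_sub, this, sub_zero]
  · exact UnitAddCircle.norm_eq.symm

/-- Decompose the displacement into coordinate shifts and move one coordinate at a time; invariance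
of the norm under translation makes the pieces independent of the base point. -/
lemma eLpNorm_translate_sub_le {f : Torus d → ℝ} {g : Fin d → Torus d → ℝ}
    (h : ∀ j, HasWeakPD j f (g j)) {p : ℝ≥0∞} (hp1 : 1 ≤ p) (hp : p ≠ ⊤) (hf : MemLp f p)
    (hg : ∀ j, MemLp (g j) p) (w : Torus d) :
    eLpNorm (fun x => f (x + w) - f x) p volume ≤
      ENNReal.ofReal ‖w‖ * ∑ j, eLpNorm (g j) p volume := by
  -- Taking the representative nearest to 0 makes each shift no longer than the norm of w.
  choose s hs hs' using fun j => exists_real_repr (w j)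
  have key : ∀ S : Finset (Fin d), eLpNorm (fun x => f (x + ∑ j ∈ S, shift j (s j)) - f x) p volume
      ≤ ∑ j ∈ S, ENNReal.ofReal ‖w‖ * eLpNorm (g j) p volume := by
    intro S
    induction S using Finset.induction_on with
    | empty => simp
    | insert a S ha ih =>
      rw [Finset.sum_insert ha, Finset.sum_insert ha]
      set v := ∑ j ∈ S, shift j (s j)
      have hm : AEStronglyMeasurable (fun x => f (x + shift a (s a)) - f x) volume :=
        (aestronglyMeasurable_comp_add hf.1 _).sub hf.1
      have e : (fun x => f (x + (shift a (s a) + v)) - f x) =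
          (fun x => f (x + v + shift a (s a)) - f (x + v)) + fun x => f (x + v) - f x := by
        funext x
        rw [Pi.add_apply, add_comm (shift a (s a)) v, add_assoc]; ring
      rw [e]
      refine (eLpNorm_add_le (aestronglyMeasurable_comp_add hm v)
        ((aestronglyMeasurable_comp_add hf.1 _).sub hf.1) hp1).trans (add_le_add ?_ ih)
      rw [eLpNorm_comp_add hm p v]
      refine ((h a).eLpNorm_shift_sub_le hp1 hp hf (hg a) (s a)).trans ?_
      gcongr
      rw [hs']
      exact norm_le_pi_norm w a
  have hw : ∑ j, shift j (s j) = w := by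
    funext i
    rw [Finset.sum_apply]
    simp [shift_apply, hs]
  have := key Finset.univ
  rwa [hw, ← Finset.mul_sum] at this

lemma ae_comp_sub_left {P : Torus d → Prop} (h : ∀ᵐ x, P x) (x : Torus d) : ∀ᵐ y, P (x - y) :=
  (quasiMeasurePreserving_sub_left volume x).ae h

/-! ### Favre averages and the gradient bound -/

/-- The density-weighted (Favre) average `(ρ f) * η / (ρ * η)`. -/
def favre (η ρ f : Torus d → ℝ) (x : Torus d) : ℝ :=
  conv η (fun y => ρ y * f y) x / conv η ρ x

/-- The partial derivatives of `favre`. -/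
def favrePD (j : Fin d) (η ρ f : Torus d → ℝ) (x : Torus d) : ℝ :=
  (conv (pd j η) (fun y => ρ y * f y) x * conv η ρ x -
    conv η (fun y => ρ y * f y) x * conv (pd j η) ρ x) / conv η ρ x ^ 2

section Favre

variable {C δ c₁ c₂ : ℝ} {η ρ f : Torus d → ℝ}

lemma integrable_of_bounds (hρm : AEStronglyMeasurable ρ) (hρ : ∀ᵐ x, c₁ ≤ ρ x ∧ ρ x ≤ c₂) :
    Integrable ρ :=
  Integrable.of_bound hρm (max |c₁| |c₂|) (hρ.mono fun _ hx => abs_le_max_abs_abs hx.1 hx.2)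

lemma MemLp.mul_of_bounds (hc₁ : 0 < c₁) (hρm : AEStronglyMeasurable ρ)
    (hρ : ∀ᵐ x, c₁ ≤ ρ x ∧ ρ x ≤ c₂) {p : ℝ≥0∞} (hf : MemLp f p) :
    MemLp (fun x => ρ x * f x) p :=
  MemLp.of_le_mul (c := c₂) hf (hρm.mul hf.1) (hρ.mono fun x hx => by
    rw [norm_mul, Real.norm_of_nonneg (hc₁.le.trans hx.1)]
    exact mul_le_mul_of_nonneg_right hx.2 (norm_nonneg _))

lemma IsKernel.conv_mem_bounds (hη : IsKernel C δ η) (hρm : AEStronglyMeasurable ρ)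
    (hρ : ∀ᵐ x, c₁ ≤ ρ x ∧ ρ x ≤ c₂) (x : Torus d) : c₁ ≤ conv η ρ x ∧ conv η ρ x ≤ c₂ := by
  have hi := integrable_conv_right hη.continuous (integrable_of_bounds hρm hρ) x
  have hc : ∀ c : ℝ, ∫ y, η y * c = c := fun c => by
    rw [integral_mul_const, hη.integral_eq_one, one_mul]
  have hic : ∀ c : ℝ, Integrable fun y => η y * c := fun c =>
    (Continuous.integrable_torus hη.continuous).mul_const c
  have hae := ae_comp_sub_left hρ x
  constructor
  · rw [← hc c₁]
    exact integral_mono_ae (hic _) hi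
      (hae.mono fun y hy => mul_le_mul_of_nonneg_left hy.1 (hη.nonneg y))
  · refine le_of_le_of_eq ?_ (hc c₂)
    exact integral_mono_ae hi (hic _)
      (hae.mono fun y hy => mul_le_mul_of_nonneg_left hy.2 (hη.nonneg y))

lemma IsKernel.conv_pos (hη : IsKernel C δ η) (hc₁ : 0 < c₁) (hρm : AEStronglyMeasurable ρ)
    (hρ : ∀ᵐ x, c₁ ≤ ρ x ∧ ρ x ≤ c₂) (x : Torus d) : 0 < conv η ρ x :=
  hc₁.trans_le (hη.conv_mem_bounds hρm hρ x).1

lemma continuous_favre (hη : IsKernel C δ η) (hc₁ : 0 < c₁) (hρm : AEStronglyMeasurable ρ)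
    (hρ : ∀ᵐ x, c₁ ≤ ρ x ∧ ρ x ≤ c₂) (hf : Integrable fun x => ρ x * f x) :
    Continuous (favre η ρ f) :=
  (continuous_conv hη.continuous hf).div
    (continuous_conv hη.continuous (integrable_of_bounds hρm hρ))
    fun x => (hη.conv_pos hc₁ hρm hρ x).ne'

lemma continuous_favrePD (hη : IsKernel C δ η) (hc₁ : 0 < c₁) (hρm : AEStronglyMeasurable ρ)
    (hρ : ∀ᵐ x, c₁ ≤ ρ x ∧ ρ x ≤ c₂) (hf : Integrable fun x => ρ x * f x) (j : Fin d) :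
    Continuous (favrePD j η ρ f) := by
  have hρi := integrable_of_bounds hρm hρ
  have h1 := continuous_conv hη.continuous hf
  have h2 := continuous_conv hη.continuous hρi
  have h3 := continuous_conv (hη.smooth.continuous_pd j) hf
  have h4 := continuous_conv (hη.smooth.continuous_pd j) hρi
  exact ((h3.mul h2).sub (h1.mul h4)).div (h2.pow 2)
    fun x => pow_ne_zero 2 (hη.conv_pos hc₁ hρm hρ x).ne'

lemma hasPD_favre (hη : IsKernel C δ η) (hc₁ : 0 < c₁) (hρm : AEStronglyMeasurable ρ)
    (hρ : ∀ᵐ x, c₁ ≤ ρ x ∧ ρ x ≤ c₂) (hf : Integrable fun x => ρ x * f x) (j : Fin d) :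
    HasPD j (favre η ρ f) (favrePD j η ρ f) :=
  (hasPD_conv (hη.smooth.hasPD j) hη.continuous (hη.smooth.continuous_pd j) hf).div
    (hasPD_conv (hη.smooth.hasPD j) hη.continuous (hη.smooth.continuous_pd j)
      (integrable_of_bounds hρm hρ)) fun x => (hη.conv_pos hc₁ hρm hρ x).ne'

/-- The density in the numerator is at most c₂ and the averaged density below is at least c₁, so the
weight costs only the factor c₂/c₁. The gradient bound uses it with the squares of both constants.
-/
lemma enorm_integral_weight_div_le (hc₁ : 0 < c₁) {Y : Type*} [MeasurableSpace Y]
    {ν : Measure Y} (k w g : Y → ℝ) (hw : ∀ᵐ y ∂ν, |w y| ≤ c₂) {r : ℝ} (hr : c₁ ≤ r) :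
    ‖(∫ y, k y * w y * g y ∂ν) / r‖ₑ ≤
      ENNReal.ofReal (c₂ / c₁) * ∫⁻ y, ‖k y‖ₑ * ‖g y‖ₑ ∂ν := by
  have hr0 : 0 < r := hc₁.trans_le hr
  rw [div_eq_inv_mul, ← integral_const_mul, ← lintegral_const_mul' _ _ ENNReal.ofReal_ne_top]
  refine (enorm_integral_le_lintegral_enorm _).trans (lintegral_mono_ae ?_)
  filter_upwards [hw] with y hy
  have hc2 : 0 ≤ c₂ := (abs_nonneg _).trans hy
  rw [← enorm_mul, ← Real.enorm_of_nonneg (div_nonneg hc2 hc₁.le), ← enorm_mul,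
    enorm_le_iff_norm_le]
  have : r⁻¹ * |w y| ≤ c₂ / c₁ := by
    rw [div_eq_inv_mul]
    exact mul_le_mul (inv_anti₀ hc₁ hr) hy (abs_nonneg _) (by positivity)
  simp only [norm_mul, Real.norm_eq_abs, abs_of_nonneg (div_nonneg hc2 hc₁.le),
    abs_of_pos (inv_pos.2 hr0)]
  calc r⁻¹ * (|k y| * |w y| * |g y|) = (r⁻¹ * |w y|) * (|k y| * |g y|) := by ring
    _ ≤ _ := by gcongr

lemma eLpNorm_favre_le (hη : IsKernel C δ η) (hc₁ : 0 < c₁) (hρm : AEStronglyMeasurable ρ)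
    (hρ : ∀ᵐ x, c₁ ≤ ρ x ∧ ρ x ≤ c₂) {p : ℝ≥0∞} (hp1 : 1 ≤ p) (hp : p ≠ ⊤) (hf : MemLp f p) :
    eLpNorm (favre η ρ f) p volume ≤ ENNReal.ofReal (c₂ / c₁) * eLpNorm f p volume := by
  have hint : ∫⁻ y, ENNReal.ofReal (c₂ / c₁) * ‖η y‖ₑ = ENNReal.ofReal (c₂ / c₁) := by
    rw [lintegral_const_mul _ hη.continuous.measurable.enorm, hη.lintegral_enorm, mul_one]
  rw [← hint]
  refine eLpNorm_le_of_enorm_le_lintegral (μ := volume) (ν := volume)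
    (k := fun y => ENNReal.ofReal (c₂ / c₁) * ‖η y‖ₑ)
    (F := fun x y => f (x - y)) (hη.continuous.measurable.enorm.const_mul _)
    (by rw [hint]; exact ENNReal.ofReal_ne_top) (AEStronglyMeasurable.comp_sub_torus hf.1)
    (Eventually.of_forall fun x => ?_) hp1 hp (fun y _ => (eLpNorm_comp_sub hf.1 p y).le)
  have := enorm_integral_weight_div_le (c₂ := c₂) hc₁ (ν := (volume : Measure (Torus d))) η
    (fun y => ρ (x - y)) (fun y => f (x - y))
    ((ae_comp_sub_left hρ x).mono fun y hy => by
      rw [abs_of_nonneg (hc₁.le.trans hy.1)]; exact hy.2)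
    (hη.conv_mem_bounds hρm hρ x).1
  rw [← lintegral_const_mul' _ _ ENNReal.ofReal_ne_top] at this
  simpa only [favre, conv, mul_assoc] using this

/-- The Favre average reproduces constants. Subtracting f(x) therefore leaves a weighted average of
f(x - y) - f(x), and no continuity of the density is needed. -/
lemma Mollifier.tendsto_favre {δ : ℕ → ℝ} {η : ℕ → Torus d → ℝ} (h : Mollifier C δ η)
    (hc₁ : 0 < c₁) (hρm : AEStronglyMeasurable ρ)
    (hρ : ∀ᵐ x, c₁ ≤ ρ x ∧ ρ x ≤ c₂) {p : ℝ≥0∞} (hp1 : 1 ≤ p) (hp : p ≠ ⊤) (hf : MemLp f p) :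
    Tendsto (fun n => eLpNorm (fun x => favre (η n) ρ f x - f x) p volume) atTop (𝓝 0) := by
  refine h.tendsto_of_le_average hp1 hp hf (c := ENNReal.ofReal (c₂ / c₁)) ENNReal.ofReal_ne_top
    fun n => Eventually.of_forall fun x => ?_
  have hη := h.kernel n
  have hr := hη.conv_pos hc₁ hρm hρ x
  have this := enorm_integral_weight_div_le (c₂ := c₂) hc₁ (ν := (volume : Measure (Torus d))) (η n)
    (fun y => ρ (x - y)) (fun y => f (x - y) - f x)
    ((ae_comp_sub_left hρ x).mono fun y hy => by
      rw [abs_of_nonneg (hc₁.le.trans hy.1)]; exact hy.2)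
    (hη.conv_mem_bounds hρm hρ x).1
  have e : favre (η n) ρ f x - f x =
      (∫ y, η n y * ρ (x - y) * (f (x - y) - f x)) / conv (η n) ρ x := by
    have i1 := integrable_conv_right hη.continuous
      ((MemLp.mul_of_bounds hc₁ hρm hρ hf).integrable hp1) x
    have i2 := (integrable_conv_right hη.continuous (integrable_of_bounds hρm hρ) x).mul_const (f x)
    rw [eq_div_iff hr.ne', sub_mul, favre, div_mul_cancel₀ _ hr.ne', mul_comm (f x)]
    simp only [conv] at *
    rw [← integral_mul_const, ← integral_sub i1 i2]
    congr 1; funext y; ring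
  rw [e]
  exact this

/-- The quotient rule contains ∂η * ρ, of size 1/δ. Written as one double integral, however, the
numerator contains only differences of f at two points at distance at most 2δ. Their Lᵖ norm is O(δ)
by `eLpNorm_translate_sub_le`, which compensates the C/δ from the gradient of the kernel, so the
bound is uniform in δ. -/
lemma eLpNorm_favrePD_le (hη : IsKernel C δ η) (hC : 0 ≤ C) (hδ : 0 < δ) (hc₁ : 0 < c₁)
    (hρm : AEStronglyMeasurable ρ) (hρ : ∀ᵐ x, c₁ ≤ ρ x ∧ ρ x ≤ c₂) {p : ℝ≥0∞} (hp1 : 1 ≤ p)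
    (hp : p ≠ ⊤) (hf : MemLp f p) {g : Fin d → Torus d → ℝ} (hw : ∀ j, HasWeakPD j f (g j))
    (hg : ∀ j, MemLp (g j) p) (j : Fin d) :
    eLpNorm (favrePD j η ρ f) p volume ≤
      ENNReal.ofReal (c₂ ^ 2 / c₁ ^ 2 * (2 * C)) * ∑ k, eLpNorm (g k) p volume := by
  have hη' := hη.smooth.continuous_pd j
  have hρi := integrable_of_bounds hρm hρ
  have hρf := (MemLp.mul_of_bounds hc₁ hρm hρ hf).integrable hp1
  set a := ENNReal.ofReal (c₂ ^ 2 / c₁ ^ 2) with ha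
  have hkm : Measurable fun z : Torus d × Torus d => ‖pd j η z.1 * η z.2‖ₑ :=
    (by have := hη.continuous; fun_prop :
      Continuous fun z : Torus d × Torus d => pd j η z.1 * η z.2).measurable.enorm
  have hint : ∫⁻ z, a * ‖pd j η z.1 * η z.2‖ₑ ∂((volume : Measure (Torus d)).prod volume) ≤
      a * ENNReal.ofReal (C / δ) := by
    rw [lintegral_const_mul _ hkm]
    gcongr
    simp only [enorm_mul]
    rw [lintegral_prod_mul (f := fun y : Torus d => ‖pd j η y‖ₑ) (g := fun y : Torus d => ‖η y‖ₑ)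
      hη'.measurable.enorm.aemeasurable hη.continuous.measurable.enorm.aemeasurable,
      hη.lintegral_enorm, mul_one, lintegral_enorm_eq_ofReal hη']
    exact ENNReal.ofReal_le_ofReal (hη.integral_pd j)
  have hmp : ∀ {π : Torus d × Torus d → Torus d}, MeasurePreserving π (volume.prod volume) volume →
      AEStronglyMeasurable (fun z : Torus d × Torus d × Torus d => f (z.1 - π z.2))
        (volume.prod (volume.prod volume)) := fun hπ =>
    (AEStronglyMeasurable.comp_sub_torus hf.1).comp_measurePreserving
      ((MeasurePreserving.id (volume : Measure (Torus d))).prod hπ)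
  have key := eLpNorm_le_of_enorm_le_lintegral (μ := (volume : Measure (Torus d)))
    (ν := (volume : Measure (Torus d)).prod volume)
    (k := fun z => a * ‖pd j η z.1 * η z.2‖ₑ)
    (F := fun x z => f (x - z.1) - f (x - z.2)) (g := favrePD j η ρ f)
    (B := ENNReal.ofReal (2 * δ) * ∑ k, eLpNorm (g k) p volume) (hkm.const_mul a)
    (hint.trans_lt (ENNReal.mul_lt_top ENNReal.ofReal_lt_top ENNReal.ofReal_lt_top)).ne
    ((hmp measurePreserving_fst).sub (hmp measurePreserving_snd))
    (Eventually.of_forall fun x => ?_) hp1 hp ?_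
  · calc eLpNorm (favrePD j η ρ f) p volume ≤ _ := key
      _ ≤ a * ENNReal.ofReal (C / δ) *
          (ENNReal.ofReal (2 * δ) * ∑ k, eLpNorm (g k) p volume) := by gcongr
      _ = _ := by
        rw [← mul_assoc, ha, ← ENNReal.ofReal_mul (by positivity),
          ← ENNReal.ofReal_mul (by positivity)]
        congr 2
        field_simp
  · have hr := (hη.conv_mem_bounds hρm hρ x).1
    have hae := ae_comp_sub_left hρ x
    have this := enorm_integral_weight_div_le (c₁ := c₁ ^ 2) (c₂ := c₂ ^ 2) (by positivity)
      (ν := (volume : Measure (Torus d)).prod volume) (fun z => pd j η z.1 * η z.2)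
      (fun z => ρ (x - z.1) * ρ (x - z.2)) (fun z => f (x - z.1) - f (x - z.2))
      (by
        filter_upwards [Measure.quasiMeasurePreserving_fst.ae hae,
          Measure.quasiMeasurePreserving_snd.ae hae] with z h1 h2
        rw [abs_mul, abs_of_nonneg (hc₁.le.trans h1.1), abs_of_nonneg (hc₁.le.trans h2.1), sq]
        exact mul_le_mul h1.2 h2.2 (hc₁.le.trans h2.1) (hc₁.le.trans (h1.1.trans h1.2)))
      (pow_le_pow_left₀ hc₁.le hr 2)
    -- Both products in the quotient rule carry the same weight ∂η(y) η(z) ρ(x-y) ρ(x-z); one has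
    -- the factor f(x-y), the other f(x-z).
    have e : favrePD j η ρ f x = (∫ z, pd j η z.1 * η z.2 * (ρ (x - z.1) * ρ (x - z.2)) *
        (f (x - z.1) - f (x - z.2)) ∂((volume : Measure (Torus d)).prod volume)) /
        conv η ρ x ^ 2 := by
      have i1 := integrable_conv_right hη' hρf x
      have i2 := integrable_conv_right hη.continuous hρi x
      have i3 := integrable_conv_right hη.continuous hρf x
      have i4 := integrable_conv_right hη' hρi x
      have e1 := integral_prod_mul (μ := (volume : Measure (Torus d))) (ν := volume)
        (fun y => pd j η y * (ρ (x - y) * f (x - y))) (fun y => η y * ρ (x - y))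
      have e2 := integral_prod_mul (μ := (volume : Measure (Torus d))) (ν := volume)
        (fun y => pd j η y * ρ (x - y)) (fun y => η y * (ρ (x - y) * f (x - y)))
      rw [favrePD, mul_comm (conv η _ x)]
      simp only [conv]
      rw [← e1, ← e2, ← integral_sub (i1.mul_prod i2) (i4.mul_prod i3)]
      congr 2; funext z; ring
    rw [e]
    refine this.trans_eq ?_
    rw [← lintegral_const_mul' _ _ ENNReal.ofReal_ne_top]
    simp only [mul_assoc, ha]
  · intro z hz
    have h1 : pd j η z.1 * η z.2 ≠ 0 := fun h0 => hz (by simp [h0])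
    -- A nonzero weight puts both points within δ of 0, so the relative displacement is at most 2δ.
    have hy := hη.pd_supp j z.1 (left_ne_zero_of_mul h1)
    have hz' := hη.supp z.2 (right_ne_zero_of_mul h1)
    have hm : AEStronglyMeasurable (fun x => f (x + (z.2 - z.1)) - f x) volume :=
      (aestronglyMeasurable_comp_add hf.1 _).sub hf.1
    have e : (fun x => f (x - z.1) - f (x - z.2)) =
        fun x => (fun x => f (x + (z.2 - z.1)) - f x) (x - z.2) := by
      funext x; simp
    rw [e, eLpNorm_comp_sub hm]
    refine (eLpNorm_translate_sub_le hw hp1 hp hf hg _).trans ?_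
    gcongr
    exact (norm_sub_le _ _).trans (by linarith)

end Favre

/-! ### Hölder's inequality and convergence of products -/

section Holder

variable {X : Type*} [MeasurableSpace X] {μ : Measure X} {p q : ℝ≥0∞}

lemma holderTriple_four_four_two : ENNReal.HolderTriple 4 4 2 := by
  constructor
  rw [← two_mul, show (4 : ℝ≥0∞) = 2 * 2 by norm_num,
    ENNReal.mul_inv (by simp) (by simp), ← mul_assoc, ENNReal.mul_inv_cancel (by simp) (by simp),
    one_mul]

lemma eLpNorm_mul_le [ENNReal.HolderTriple q q p] {f g : X → ℝ} (hf : AEStronglyMeasurable f μ)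
    (hg : AEStronglyMeasurable g μ) :
    eLpNorm (fun x => f x * g x) p μ ≤ eLpNorm f q μ * eLpNorm g q μ := by
  have h := eLpNorm_smul_le_mul_eLpNorm (p := q) (q := q) (r := p) hg hf
  have e : f • g = fun x => f x * g x := rfl
  rwa [e] at h

lemma enorm_integral_mul_le_eLpNorm {f g : X → ℝ} (hf : AEStronglyMeasurable f μ)
    (hg : AEStronglyMeasurable g μ) :
    ‖∫ x, f x * g x ∂μ‖ₑ ≤ eLpNorm f 2 μ * eLpNorm g 2 μ := by
  refine (enorm_integral_le_lintegral_enorm _).trans ?_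
  rw [← eLpNorm_one_eq_lintegral_enorm]
  exact eLpNorm_mul_le hf hg

lemma tendsto_eLpNorm_mul [ENNReal.HolderTriple q q p] (hp1 : 1 ≤ p) {f g : X → ℝ}
    {F G : ℕ → X → ℝ} (hf : MemLp f q μ) (hg : MemLp g q μ)
    (hF : ∀ n, AEStronglyMeasurable (F n) μ) (hG : ∀ n, AEStronglyMeasurable (G n) μ)
    (hFf : Tendsto (fun n => eLpNorm (fun x => F n x - f x) q μ) atTop (𝓝 0))
    (hGg : Tendsto (fun n => eLpNorm (fun x => G n x - g x) q μ) atTop (𝓝 0)) :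
    Tendsto (fun n => eLpNorm (fun x => F n x * G n x - f x * g x) p μ) atTop (𝓝 0) := by
  have h1 : Tendsto (fun n => eLpNorm (fun x => F n x - f x) q μ *
      eLpNorm (fun x => G n x - g x) q μ + eLpNorm (fun x => F n x - f x) q μ * eLpNorm g q μ +
      eLpNorm f q μ * eLpNorm (fun x => G n x - g x) q μ) atTop
      (𝓝 (0 * 0 + 0 * eLpNorm g q μ + eLpNorm f q μ * 0)) :=
    ((ENNReal.Tendsto.mul hFf (by simp) hGg (by simp)).add
      (ENNReal.Tendsto.mul_const hFf (Or.inr hg.2.ne))).add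
      (ENNReal.Tendsto.const_mul hGg (Or.inr hf.2.ne))
  simp only [zero_mul, mul_zero, add_zero] at h1
  refine tendsto_of_tendsto_of_tendsto_of_le_of_le tendsto_const_nhds h1 (fun _ => zero_le)
    fun n => ?_
  have m1 : AEStronglyMeasurable (fun x => F n x - f x) μ := (hF n).sub hf.1
  have m2 : AEStronglyMeasurable (fun x => G n x - g x) μ := (hG n).sub hg.1
  have e : (fun x => F n x * G n x - f x * g x) =
      ((fun x => (F n x - f x) * (G n x - g x)) + fun x => (F n x - f x) * g x) +
        fun x => f x * (G n x - g x) := by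
    funext x; simp only [Pi.add_apply]; ring
  rw [e]
  refine (eLpNorm_add_le ((m1.mul m2).add (m1.mul hg.1)) (hf.1.mul m2) hp1).trans (add_le_add
    ((eLpNorm_add_le (m1.mul m2) (m1.mul hg.1) hp1).trans (add_le_add ?_ ?_)) ?_)
  · exact eLpNorm_mul_le m1 m2
  · exact eLpNorm_mul_le m1 hg.1
  · exact eLpNorm_mul_le hf.1 m2

lemma tendsto_of_enorm_sub {a : ℕ → ℝ} {l : ℝ}
    (h : Tendsto (fun n => ‖a n - l‖ₑ) atTop (𝓝 0)) : Tendsto a atTop (𝓝 l) := by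
  rw [tendsto_iff_edist_tendsto_0]
  simpa only [edist_eq_enorm_sub] using h

lemma tendsto_integral_of_eLpNorm_one {f : X → ℝ} {F : ℕ → X → ℝ} (hf : Integrable f μ)
    (hF : ∀ n, Integrable (F n) μ)
    (h : Tendsto (fun n => eLpNorm (fun x => F n x - f x) 1 μ) atTop (𝓝 0)) :
    Tendsto (fun n => ∫ x, F n x ∂μ) atTop (𝓝 (∫ x, f x ∂μ)) := by
  refine tendsto_of_enorm_sub ?_
  refine tendsto_of_tendsto_of_tendsto_of_le_of_le tendsto_const_nhds h (fun _ => zero_le)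
    fun n => ?_
  beta_reduce
  rw [← integral_sub (hF n) hf, eLpNorm_one_eq_lintegral_enorm]
  exact enorm_integral_le_lintegral_enorm _

/-- Strong times weak convergence: replacing `B n` by its strong limit costs at most K times the L²
distance. -/
lemma tendsto_integral_mul_of_bounded {τ : X → ℝ} {B D : ℕ → X → ℝ} {K : ℝ≥0∞} (hK : K ≠ ⊤)
    (hτ : MemLp τ 2 μ) (hB : ∀ n, MemLp (B n) 2 μ) (hD : ∀ n, MemLp (D n) 2 μ)
    (hDK : ∀ n, eLpNorm (D n) 2 μ ≤ K)
    (h : Tendsto (fun n => eLpNorm (fun x => B n x - τ x) 2 μ) atTop (𝓝 0)) {l : ℝ}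
    (hl : Tendsto (fun n => ∫ x, τ x * D n x ∂μ) atTop (𝓝 l)) :
    Tendsto (fun n => ∫ x, B n x * D n x ∂μ) atTop (𝓝 l) := by
  have h0 : Tendsto (fun n => ∫ x, (B n x - τ x) * D n x ∂μ) atTop (𝓝 0) := by
    refine tendsto_of_enorm_sub ?_
    have h2 := ENNReal.Tendsto.mul_const (b := K) h (Or.inr hK)
    rw [zero_mul] at h2
    refine tendsto_of_tendsto_of_tendsto_of_le_of_le tendsto_const_nhds h2 (fun _ => zero_le)
      fun n => ?_
    rw [sub_zero]
    exact (enorm_integral_mul_le_eLpNorm ((hB n).1.sub hτ.1) (hD n).1).trans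
      (mul_le_mul_right (hDK n) _)
  have h1 := h0.add hl
  rw [zero_add] at h1
  refine h1.congr fun n => ?_
  have i1 : Integrable (fun x => (B n x - τ x) * D n x) μ :=
    MemLp.integrable_mul ((hB n).sub hτ) (hD n)
  have i2 : Integrable (fun x => τ x * D n x) μ := MemLp.integrable_mul hτ (hD n)
  rw [← integral_add i1 i2]
  congr 1; funext x; ring

end Holder

lemma MemLp.of_continuous_torus {f : Torus d → ℝ} (hf : Continuous f) (p : ℝ≥0∞) : MemLp f p := by
  obtain ⟨C, -, hC⟩ := exists_bound_torus hf
  exact MemLp.of_bound hf.aestronglyMeasurable C (Eventually.of_forall hC)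

/-! ### Weak convergence of the averaged velocity gradient -/

/-- If smooth functions tend to zero in `L²` and have bounded derivatives, these tend to zero
weakly. -/
lemma tendsto_integral_mul_hasPD {j : Fin d} {W D : ℕ → Torus d → ℝ}
    (hWD : ∀ n, HasPD j (W n) (D n)) (hW : ∀ n, Continuous (W n)) (hD : ∀ n, Continuous (D n))
    {K : ℝ≥0∞} (hK : K ≠ ⊤) (hDK : ∀ n, eLpNorm (D n) 2 volume ≤ K)
    (hW0 : Tendsto (fun n => eLpNorm (W n) 2 volume) atTop (𝓝 0)) {τ : Torus d → ℝ}
    (hτ : MemLp τ 2) : Tendsto (fun n => ∫ x, τ x * D n x) atTop (𝓝 0) := by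
  obtain ⟨C, δ, η, hη⟩ := exists_mollifier d
  have hT := hη.tendsto_conv (p := 2) (by norm_num) (by norm_num) hτ
  refine tendsto_of_enorm_sub ?_
  simp only [sub_zero]
  rw [ENNReal.tendsto_nhds_zero]
  intro ε hε
  have hT' := ENNReal.Tendsto.mul_const (b := K) hT (Or.inr hK)
  rw [zero_mul, ENNReal.tendsto_nhds_zero] at hT'
  -- The mollification level k of τ is fixed before n tends to infinity, so the derivative of the
  -- mollified τ has a fixed finite norm.
  obtain ⟨k, hk⟩ := (hT' (ε / 2) (ENNReal.half_pos hε.ne')).exists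
  have hη' := hη.kernel k
  have hτi := hτ.integrable (by norm_num)
  have c1 := continuous_conv hη'.continuous hτi
  have c2 := continuous_conv (hη'.smooth.continuous_pd j) hτi
  have hpd : HasPD j (conv (η k) τ) (conv (pd j (η k)) τ) :=
    hasPD_conv (hη'.smooth.hasPD j) hη'.continuous (hη'.smooth.continuous_pd j) hτi
  have hW1 := ENNReal.Tendsto.const_mul (a := eLpNorm (conv (pd j (η k)) τ) 2 volume) hW0
    (Or.inr (MemLp.of_continuous_torus c2 2).2.ne)
  rw [mul_zero, ENNReal.tendsto_nhds_zero] at hW1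
  filter_upwards [hW1 (ε / 2) (ENNReal.half_pos hε.ne')] with n hn
  have i1 : Integrable (fun x => (conv (η k) τ x - τ x) * D n x) :=
    MemLp.integrable_mul (p := 2) (q := 2) ((MemLp.of_continuous_torus c1 2).sub hτ)
      (MemLp.of_continuous_torus (hD n) 2)
  -- The derivative is moved onto the mollified τ; the remainder is controlled by the bound on `D
  -- n`.
  have e : ∫ x, τ x * D n x = - (∫ x, conv (pd j (η k)) τ x * W n x)
      - ∫ x, (conv (η k) τ x - τ x) * D n x := by
    rw [integral_mul_hasPD hpd c1 c2 (hWD n) (hW n) (hD n), neg_neg, ← integral_sub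
      (Continuous.integrable_torus (by fun_prop : Continuous fun x => conv (η k) τ x * D n x)) i1]
    congr 1; funext x; ring
  rw [e, ← ENNReal.add_halves ε]
  refine enorm_sub_le.trans (add_le_add ?_ ?_)
  · rw [enorm_neg]
    exact (enorm_integral_mul_le_eLpNorm c2.aestronglyMeasurable
      (hW n).aestronglyMeasurable).trans hn
  · refine (enorm_integral_mul_le_eLpNorm (c1.aestronglyMeasurable.sub hτ.1)
      (hD n).aestronglyMeasurable).trans
      (le_trans (mul_le_mul_right (hDK n) _) hk)

/-- Density, velocity, velocity gradient and momentum flux at a fixed time. -/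
structure Slice (c₁ c₂ : ℝ) (ρ : Torus d → ℝ) (w : Fin d → Torus d → ℝ)
    (g N : Fin d → Fin d → Torus d → ℝ) : Prop where
  meas : AEStronglyMeasurable ρ
  bounds : ∀ᵐ x, c₁ ≤ ρ x ∧ ρ x ≤ c₂
  memLp_vel : ∀ i, MemLp (w i) 4
  memLp_grad : ∀ i j, MemLp (g i j) 2
  memLp_flux : ∀ i j, MemLp (N i j) 2
  weak : ∀ i j, HasWeakPD j (w i) (g i j)

/-- The momentum flux left over after subtracting convection and pressure of the averaged
quantities. -/
def residualFlux (p : ℝ → ℝ) (η ρ : Torus d → ℝ) (w : Fin d → Torus d → ℝ)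
    (N : Fin d → Fin d → Torus d → ℝ) (i j : Fin d) (x : Torus d) : ℝ :=
  conv η (N i j) x - conv η (fun y => ρ y * w j y) x * favre η ρ (w i) x -
    if i = j then p (conv η ρ x) else 0

/-- The work of the residual flux, the time derivative of the energy of averaged quantities. -/
def fluxWork (p : ℝ → ℝ) (η ρ : Torus d → ℝ) (w : Fin d → Torus d → ℝ)
    (N : Fin d → Fin d → Torus d → ℝ) : ℝ :=
  ∑ i, ∑ j, ∫ x, residualFlux p η ρ w N i j x * favrePD j η ρ (w i) x

namespace Slice

variable {c₁ c₂ : ℝ} {ρ : Torus d → ℝ} {w : Fin d → Torus d → ℝ}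
  {g N : Fin d → Fin d → Torus d → ℝ}

lemma memLp_vel_two (h : Slice c₁ c₂ ρ w g N) (i : Fin d) : MemLp (w i) 2 :=
  (h.memLp_vel i).mono_exponent (by norm_num)

lemma integrable_mom (h : Slice c₁ c₂ ρ w g N) (hc₁ : 0 < c₁) (i : Fin d) :
    Integrable (fun x => ρ x * w i x) :=
  (MemLp.mul_of_bounds hc₁ h.meas h.bounds (h.memLp_vel i)).integrable (by norm_num)

/-- The gradient of the plain mollification converges strongly. The Favre average differs from it by
a function that vanishes in L² and has bounded derivatives, so the difference of the gradients
vanishes weakly. -/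
lemma tendsto_favrePD {C : ℝ} {δ : ℕ → ℝ} {η : ℕ → Torus d → ℝ} (h : Slice c₁ c₂ ρ w g N)
    (hη : Mollifier C δ η) (hc₁ : 0 < c₁) (i j : Fin d) {τ : Torus d → ℝ} (hτ : MemLp τ 2) :
    Tendsto (fun n => ∫ x, τ x * favrePD j (η n) ρ (w i) x) atTop (𝓝 (∫ x, τ x * g i j x)) := by
  have hk := hη.kernel
  have hw2 := h.memLp_vel_two i
  have hwi := hw2.integrable (by norm_num)
  have hgi := (h.memLp_grad i j).integrable (by norm_num)
  have hm := h.integrable_mom hc₁ i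
  have hcPD := fun n => continuous_favrePD (hk n) hc₁ h.meas h.bounds hm j
  have hcV := fun n => continuous_favre (hk n) hc₁ h.meas h.bounds hm
  have hcg := fun n => continuous_conv (hk n).continuous hgi
  have hcw := fun n => continuous_conv (hk n).continuous hwi
  have hTg := hη.tendsto_conv (p := 2) (by norm_num) (by norm_num) (h.memLp_grad i j)
  have hTw := hη.tendsto_conv (p := 2) (by norm_num) (by norm_num) hw2
  have hTV := hη.tendsto_favre hc₁ h.meas h.bounds (p := 2) (by norm_num) (by norm_num) hw2
  have hW : ∀ n, HasPD j (fun x => favre (η n) ρ (w i) x + -1 * conv (η n) (w i) x)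
      (fun x => favrePD j (η n) ρ (w i) x + -1 * conv (η n) (g i j) x) := fun n =>
    (hasPD_favre (hk n) hc₁ h.meas h.bounds hm j).add
      (((h.weak i j).hasPD_conv (hk n).smooth hwi).const_mul (-1))
  have hcW : ∀ n, Continuous fun x => favre (η n) ρ (w i) x + -1 * conv (η n) (w i) x :=
    fun n => (hcV n).add (continuous_const.mul (hcw n))
  have hcD : ∀ n, Continuous fun x => favrePD j (η n) ρ (w i) x + -1 * conv (η n) (g i j) x :=
    fun n => (hcPD n).add (continuous_const.mul (hcg n))
  set K := ENNReal.ofReal (c₂ ^ 2 / c₁ ^ 2 * (2 * C)) * ∑ k, eLpNorm (g i k) 2 volume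
  have hK : K ≠ ⊤ := ENNReal.mul_ne_top ENNReal.ofReal_ne_top
    (ENNReal.sum_ne_top.2 fun k _ => (h.memLp_grad i k).2.ne)
  have hneg : ∀ f : Torus d → ℝ, eLpNorm (fun x => -1 * f x) 2 volume = eLpNorm f 2 volume :=
    fun f => by
      rw [← eLpNorm_neg]; congr 1; funext x; simp
  have hDK : ∀ n, eLpNorm (fun x => favrePD j (η n) ρ (w i) x + -1 * conv (η n) (g i j) x) 2 volume
      ≤ K + eLpNorm (g i j) 2 volume := fun n => by
    refine (eLpNorm_add_le (hcPD n).aestronglyMeasurable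
      (g := fun x => -1 * conv (η n) (g i j) x)
      (continuous_const.mul (hcg n)).aestronglyMeasurable (by norm_num)).trans (add_le_add ?_ ?_)
    · exact eLpNorm_favrePD_le (hk n) hη.const_nonneg (hη.pos n) hc₁ h.meas h.bounds (by norm_num)
        (by norm_num) hw2 (h.weak i) (h.memLp_grad i) j
    · rw [hneg]
      exact (hk n).eLpNorm_conv_le (h.memLp_grad i j).1 (by norm_num) (by norm_num)
  have hW0 : Tendsto (fun n => eLpNorm
      (fun x => favre (η n) ρ (w i) x + -1 * conv (η n) (w i) x) 2 volume) atTop (𝓝 0) := by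
    have := hTV.add hTw
    rw [add_zero] at this
    refine tendsto_of_tendsto_of_tendsto_of_le_of_le tendsto_const_nhds this (fun _ => zero_le)
      fun n => ?_
    have e : (fun x => favre (η n) ρ (w i) x + -1 * conv (η n) (w i) x) =
        (fun x => favre (η n) ρ (w i) x - w i x) - fun x => conv (η n) (w i) x - w i x := by
      funext x; simp only [Pi.sub_apply]; ring
    beta_reduce
    rw [e]
    exact eLpNorm_sub_le ((hcV n).aestronglyMeasurable.sub hw2.1)
      ((hcw n).aestronglyMeasurable.sub hw2.1) (by norm_num)
  have h1 := tendsto_integral_mul_hasPD hW hcW hcD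
    (ENNReal.add_ne_top.2 ⟨hK, (h.memLp_grad i j).2.ne⟩) hDK hW0 hτ
  have h2 : Tendsto (fun n => ∫ x, conv (η n) (g i j) x * τ x) atTop (𝓝 (∫ x, g i j x * τ x)) :=
    tendsto_integral_mul_of_bounded (K := eLpNorm τ 2 volume) hτ.2.ne (h.memLp_grad i j)
      (fun n => MemLp.of_continuous_torus (hcg n) 2) (fun _ => hτ) (fun _ => le_rfl) hTg
      tendsto_const_nhds
  have h3 := h1.add h2
  rw [zero_add] at h3
  simp only [mul_comm (g i j _)] at h3
  refine h3.congr fun n => ?_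
  have i1 : Integrable fun x => τ x * (favrePD j (η n) ρ (w i) x + -1 * conv (η n) (g i j) x) :=
    MemLp.integrable_mul hτ (MemLp.of_continuous_torus (hcD n) 2)
  have i2 : Integrable fun x => conv (η n) (g i j) x * τ x :=
    MemLp.integrable_mul (MemLp.of_continuous_torus (hcg n) 2) hτ
  rw [← integral_add i1 i2]
  congr 1; funext x; ring

end Slice

/-! ### Composition with functions of the density -/

section Composition

variable {c₁ c₂ : ℝ} {ρ : Torus d → ℝ} {F : ℝ → ℝ} {L : ℝ≥0}

lemma aestronglyMeasurable_comp_of_continuousOn {X : Type*} [MeasurableSpace X] {μ : Measure X}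
    {ρ : X → ℝ} (hF : ContinuousOn F (Set.Icc c₁ c₂))
    (hρm : AEStronglyMeasurable ρ μ) (hρ : ∀ᵐ x ∂μ, c₁ ≤ ρ x ∧ ρ x ≤ c₂) :
    AEStronglyMeasurable (fun x => F (ρ x)) μ := by
  by_cases hc : c₁ ≤ c₂
  · have h1 : Continuous (Set.IccExtend hc (Set.domRestrict (Set.Icc c₁ c₂) F)) :=
      hF.domRestrict.Icc_extend'
    refine (h1.comp_aestronglyMeasurable hρm).congr (hρ.mono fun x hx => ?_)
    exact Set.IccExtend_of_mem hc _ hx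
  · have : μ = 0 := by
      rw [← ae_eq_bot]
      by_contra hne
      have : (ae μ).NeBot := ⟨hne⟩
      obtain ⟨x, hx⟩ := hρ.exists
      exact hc (hx.1.trans hx.2)
    rw [this]
    exact aestronglyMeasurable_zero_measure _

lemma exists_bound_on_Icc (hF : ContinuousOn F (Set.Icc c₁ c₂)) :
    ∃ P : ℝ, 0 ≤ P ∧ ∀ r, c₁ ≤ r → r ≤ c₂ → |F r| ≤ P := by
  obtain ⟨P, hP⟩ := isCompact_Icc.exists_bound_of_continuousOn hF
  exact ⟨max P 0, le_max_right _ _, fun r h1 h2 => (hP r ⟨h1, h2⟩).trans (le_max_left _ _)⟩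

lemma memLp_comp_of_continuousOn {X : Type*} [MeasurableSpace X] {μ : Measure X}
    [IsFiniteMeasure μ] {ρ : X → ℝ} (hF : ContinuousOn F (Set.Icc c₁ c₂))
    (hρm : AEStronglyMeasurable ρ μ) (hρ : ∀ᵐ x ∂μ, c₁ ≤ ρ x ∧ ρ x ≤ c₂) (p : ℝ≥0∞) :
    MemLp (fun x => F (ρ x)) p μ := by
  obtain ⟨P, -, hP⟩ := exists_bound_on_Icc hF
  exact MemLp.of_bound (aestronglyMeasurable_comp_of_continuousOn hF hρm hρ) P
    (hρ.mono fun x hx => hP _ hx.1 hx.2)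

lemma Mollifier.tendsto_comp {C : ℝ} {δ : ℕ → ℝ} {η : ℕ → Torus d → ℝ} (h : Mollifier C δ η)
    (hF : LipschitzOnWith L F (Set.Icc c₁ c₂)) (hρm : AEStronglyMeasurable ρ)
    (hρ : ∀ᵐ x, c₁ ≤ ρ x ∧ ρ x ≤ c₂) {p : ℝ≥0∞} (hp1 : 1 ≤ p) (hp : p ≠ ⊤) :
    Tendsto (fun n => eLpNorm (fun x => F (conv (η n) ρ x) - F (ρ x)) p volume) atTop (𝓝 0) := by
  have hρp : MemLp ρ p := memLp_comp_of_continuousOn (F := id) continuousOn_id hρm hρ p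
  have h1 := ENNReal.Tendsto.const_mul (a := ENNReal.ofReal L) (h.tendsto_conv hp1 hp hρp)
    (Or.inr ENNReal.ofReal_ne_top)
  rw [mul_zero] at h1
  refine tendsto_of_tendsto_of_tendsto_of_le_of_le tendsto_const_nhds h1 (fun _ => zero_le)
    fun n => ?_
  refine eLpNorm_le_mul_eLpNorm_of_ae_le_mul (hρ.mono fun x hx => ?_) p
  exact hF.norm_sub_le ((h.kernel n).conv_mem_bounds hρm hρ x) hx

end Composition

/-! ### Limit and bounds of the flux work at a fixed time -/

namespace Slice

variable {C c₁ c₂ : ℝ} {ρ : Torus d → ℝ} {w : Fin d → Torus d → ℝ}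
  {g N : Fin d → Fin d → Torus d → ℝ} {p : ℝ → ℝ}

lemma memLp_mom (h : Slice c₁ c₂ ρ w g N) (hc₁ : 0 < c₁) (i : Fin d) :
    MemLp (fun x => ρ x * w i x) 4 :=
  MemLp.mul_of_bounds hc₁ h.meas h.bounds (h.memLp_vel i)

lemma continuous_conv_mom {δ : ℝ} {η : Torus d → ℝ} (h : Slice c₁ c₂ ρ w g N) (hc₁ : 0 < c₁)
    (hη : IsKernel C δ η) (i : Fin d) : Continuous (conv η (fun y => ρ y * w i y)) :=
  continuous_conv hη.continuous (h.integrable_mom hc₁ i)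

lemma continuous_conv_density {δ : ℝ} {η : Torus d → ℝ} (h : Slice c₁ c₂ ρ w g N)
    (hη : IsKernel C δ η) : Continuous (conv η ρ) :=
  continuous_conv hη.continuous (integrable_of_bounds h.meas h.bounds)

lemma continuous_conv_flux {δ : ℝ} {η : Torus d → ℝ} (h : Slice c₁ c₂ ρ w g N)
    (hη : IsKernel C δ η) (i j : Fin d) : Continuous (conv η (N i j)) :=
  continuous_conv hη.continuous ((h.memLp_flux i j).integrable (by norm_num))

lemma continuous_vel {δ : ℝ} {η : Torus d → ℝ} (h : Slice c₁ c₂ ρ w g N) (hc₁ : 0 < c₁)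
    (hη : IsKernel C δ η) (i : Fin d) : Continuous (favre η ρ (w i)) :=
  continuous_favre hη hc₁ h.meas h.bounds (h.integrable_mom hc₁ i)

lemma continuous_velPD {δ : ℝ} {η : Torus d → ℝ} (h : Slice c₁ c₂ ρ w g N) (hc₁ : 0 < c₁)
    (hη : IsKernel C δ η) (i j : Fin d) : Continuous (favrePD j η ρ (w i)) :=
  continuous_favrePD hη hc₁ h.meas h.bounds (h.integrable_mom hc₁ i) j

lemma continuous_comp_density {δ : ℝ} {η : Torus d → ℝ} (h : Slice c₁ c₂ ρ w g N)
    (hη : IsKernel C δ η) (hp : ContinuousOn p (Set.Icc c₁ c₂)) :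
    Continuous fun x => p (conv η ρ x) :=
  hp.comp_continuous (h.continuous_conv_density hη)
    fun x => hη.conv_mem_bounds h.meas h.bounds x

lemma continuous_residualFlux {δ : ℝ} {η : Torus d → ℝ} (h : Slice c₁ c₂ ρ w g N) (hc₁ : 0 < c₁)
    (hη : IsKernel C δ η) (hp : ContinuousOn p (Set.Icc c₁ c₂)) (i j : Fin d) :
    Continuous (residualFlux p η ρ w N i j) := by
  unfold residualFlux
  refine ((h.continuous_conv_flux hη i j).sub
    ((h.continuous_conv_mom hc₁ hη j).mul (h.continuous_vel hc₁ hη i))).sub ?_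
  split_ifs
  · exact h.continuous_comp_density hη hp
  · exact continuous_const

/-- The limit of the residual flux: minus the viscous stress. -/
lemma memLp_limitFlux (h : Slice c₁ c₂ ρ w g N) (hc₁ : 0 < c₁)
    (hp : ContinuousOn p (Set.Icc c₁ c₂)) (i j : Fin d) :
    MemLp (fun x => N i j x - ρ x * w j x * w i x - if i = j then p (ρ x) else 0) 2 := by
  have := holderTriple_four_four_two
  refine ((h.memLp_flux i j).sub ((h.memLp_vel i).mul (h.memLp_mom hc₁ j))).sub ?_
  split_ifs
  · exact memLp_comp_of_continuousOn hp h.meas h.bounds 2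
  · exact MemLp.zero

/-- Each term converges strongly in L²: the averaged flux as a mollification, the convection as a
product of two sequences converging in L⁴, the pressure by Lipschitz continuity. -/
lemma tendsto_residualFlux {δ : ℕ → ℝ} {η : ℕ → Torus d → ℝ} (h : Slice c₁ c₂ ρ w g N)
    (hη : Mollifier C δ η) (hc₁ : 0 < c₁) {L : ℝ≥0} (hp : LipschitzOnWith L p (Set.Icc c₁ c₂))
    (i j : Fin d) :
    Tendsto (fun n => eLpNorm (fun x => residualFlux p (η n) ρ w N i j x -
      (N i j x - ρ x * w j x * w i x - if i = j then p (ρ x) else 0)) 2 volume) atTop (𝓝 0) := by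
  have := holderTriple_four_four_two
  have hk := hη.kernel
  have hm := h.memLp_mom hc₁ j
  have t1 := hη.tendsto_conv (p := 2) (by norm_num) (by norm_num) (h.memLp_flux i j)
  have t2 := hη.tendsto_conv (p := 4) (by norm_num) (by norm_num) hm
  have t3 := hη.tendsto_favre hc₁ h.meas h.bounds (p := 4) (by norm_num) (by norm_num)
    (h.memLp_vel i)
  have t4 := tendsto_eLpNorm_mul (p := 2) (q := 4) (by norm_num) hm (h.memLp_vel i)
    (fun n => (h.continuous_conv_mom hc₁ (hk n) j).aestronglyMeasurable)
    (fun n => (h.continuous_vel hc₁ (hk n) i).aestronglyMeasurable) t2 t3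
  have t5 := hη.tendsto_comp hp h.meas h.bounds (p := 2) (by norm_num) (by norm_num)
  have t6 := (t1.add t4).add t5
  simp only [add_zero] at t6
  refine tendsto_of_tendsto_of_tendsto_of_le_of_le tendsto_const_nhds t6 (fun _ => zero_le)
    fun n => ?_
  have m1 : AEStronglyMeasurable (fun x => conv (η n) (N i j) x - N i j x) volume :=
    (h.continuous_conv_flux (hk n) i j).aestronglyMeasurable.sub (h.memLp_flux i j).1
  have m2 : AEStronglyMeasurable (fun x => conv (η n) (fun y => ρ y * w j y) x *
      favre (η n) ρ (w i) x - ρ x * w j x * w i x) volume :=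
    ((h.continuous_conv_mom hc₁ (hk n) j).mul
      (h.continuous_vel hc₁ (hk n) i)).aestronglyMeasurable.sub (hm.1.mul (h.memLp_vel i).1)
  have m3 : AEStronglyMeasurable (fun x => p (conv (η n) ρ x) - p (ρ x)) volume :=
    (h.continuous_comp_density (hk n) hp.continuousOn).aestronglyMeasurable.sub
      (aestronglyMeasurable_comp_of_continuousOn hp.continuousOn h.meas h.bounds)
  have m4 : AEStronglyMeasurable (fun x => if i = j then p (conv (η n) ρ x) - p (ρ x) else 0)
      volume := by
    split_ifs
    · exact m3
    · exact aestronglyMeasurable_const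
  have e : (fun x => residualFlux p (η n) ρ w N i j x -
      (N i j x - ρ x * w j x * w i x - if i = j then p (ρ x) else 0)) =
      ((fun x => conv (η n) (N i j) x - N i j x) - fun x => conv (η n) (fun y => ρ y * w j y) x *
        favre (η n) ρ (w i) x - ρ x * w j x * w i x) -
        fun x => if i = j then p (conv (η n) ρ x) - p (ρ x) else 0 := by
    funext x
    simp only [residualFlux, Pi.sub_apply]
    split_ifs <;> ring
  beta_reduce
  rw [e]
  refine (eLpNorm_sub_le (m1.sub m2) m4 (by norm_num)).trans (add_le_add
    (eLpNorm_sub_le m1 m2 (by norm_num)) ?_)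
  split_ifs
  · exact le_rfl
  · simp

lemma tendsto_fluxWork {δ : ℕ → ℝ} {η : ℕ → Torus d → ℝ} (h : Slice c₁ c₂ ρ w g N)
    (hη : Mollifier C δ η) (hc₁ : 0 < c₁) {L : ℝ≥0} (hp : LipschitzOnWith L p (Set.Icc c₁ c₂)) :
    Tendsto (fun n => fluxWork p (η n) ρ w N) atTop (𝓝 (∑ i, ∑ j, ∫ x,
      (N i j x - ρ x * w j x * w i x - if i = j then p (ρ x) else 0) * g i j x)) := by
  refine tendsto_finsetSum _ fun i _ => tendsto_finsetSum _ fun j _ => ?_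
  have hk := hη.kernel
  refine tendsto_integral_mul_of_bounded
    (K := ENNReal.ofReal (c₂ ^ 2 / c₁ ^ 2 * (2 * C)) * ∑ k, eLpNorm (g i k) 2 volume)
    (ENNReal.mul_ne_top ENNReal.ofReal_ne_top
      (ENNReal.sum_ne_top.2 fun k _ => (h.memLp_grad i k).2.ne))
    (h.memLp_limitFlux hc₁ hp.continuousOn i j)
    (fun n => MemLp.of_continuous_torus
      (h.continuous_residualFlux hc₁ (hk n) hp.continuousOn i j) 2)
    (fun n => MemLp.of_continuous_torus (h.continuous_velPD hc₁ (hk n) i j) 2)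
    (fun n => eLpNorm_favrePD_le (hk n) hη.const_nonneg (hη.pos n) hc₁ h.meas h.bounds
      (by norm_num) (by norm_num) (h.memLp_vel_two i) (h.weak i) (h.memLp_grad i) j)
    (h.tendsto_residualFlux hη hc₁ hp i j)
    (h.tendsto_favrePD hη hc₁ i j (h.memLp_limitFlux hc₁ hp.continuousOn i j))

/-- The right-hand side does not depend on δ, so it serves as majorant when the limit is taken under
the time integral. -/
lemma enorm_fluxWork_le {δ : ℝ} {η : Torus d → ℝ} (h : Slice c₁ c₂ ρ w g N)
    (hη : IsKernel C δ η) (hC : 0 ≤ C) (hδ : 0 < δ) (hc₁ : 0 < c₁)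
    (hp : ContinuousOn p (Set.Icc c₁ c₂)) {P : ℝ} (hP0 : 0 ≤ P)
    (hP : ∀ r, c₁ ≤ r → r ≤ c₂ → |p r| ≤ P) :
    ‖fluxWork p η ρ w N‖ₑ ≤ ∑ i, ∑ j, (eLpNorm (N i j) 2 volume +
      ENNReal.ofReal c₂ * eLpNorm (w j) 4 volume *
        (ENNReal.ofReal (c₂ / c₁) * eLpNorm (w i) 4 volume) + ENNReal.ofReal P) *
      (ENNReal.ofReal (c₂ ^ 2 / c₁ ^ 2 * (2 * C)) * ∑ k, eLpNorm (g i k) 2 volume) := by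
  have := holderTriple_four_four_two
  refine (enorm_sum_le _ _).trans (Finset.sum_le_sum fun i _ => (enorm_sum_le _ _).trans
    (Finset.sum_le_sum fun j _ => ?_))
  have hcR := h.continuous_residualFlux hc₁ hη hp i j
  refine (enorm_integral_mul_le_eLpNorm hcR.aestronglyMeasurable
    (h.continuous_velPD hc₁ hη i j).aestronglyMeasurable).trans (mul_le_mul' ?_
    (eLpNorm_favrePD_le hη hC hδ hc₁ h.meas h.bounds (by norm_num) (by norm_num)
      (h.memLp_vel_two i) (h.weak i) (h.memLp_grad i) j))
  have m1 := (h.continuous_conv_flux hη i j).aestronglyMeasurable (μ := volume)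
  have m2 := (h.continuous_conv_mom hc₁ hη j).aestronglyMeasurable (μ := volume)
  have m3 := (h.continuous_vel hc₁ hη i).aestronglyMeasurable (μ := volume)
  have m4 : AEStronglyMeasurable (fun x => if i = j then p (conv η ρ x) else 0)
      (volume : Measure (Torus d)) := by
    split_ifs
    · exact (h.continuous_comp_density hη hp).aestronglyMeasurable
    · exact aestronglyMeasurable_const
  have e : residualFlux p η ρ w N i j = (conv η (N i j) -
      fun x => conv η (fun y => ρ y * w j y) x * favre η ρ (w i) x) -
      fun x => if i = j then p (conv η ρ x) else 0 := rfl
  rw [e]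
  refine (eLpNorm_sub_le (m1.sub (m2.mul m3)) m4 (by norm_num)).trans (add_le_add
    ((eLpNorm_sub_le m1 (m2.mul m3) (by norm_num)).trans (add_le_add ?_ ?_)) ?_)
  · exact hη.eLpNorm_conv_le (h.memLp_flux i j).1 (by norm_num) (by norm_num)
  · refine (eLpNorm_mul_le m2 m3 (q := 4)).trans (mul_le_mul' ?_ ?_)
    · refine (hη.eLpNorm_conv_le (h.memLp_mom hc₁ j).1 (by norm_num) (by norm_num)).trans ?_
      refine eLpNorm_le_mul_eLpNorm_of_ae_le_mul (h.bounds.mono fun x hx => ?_) 4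
      rw [norm_mul, Real.norm_of_nonneg (hc₁.le.trans hx.1)]
      exact mul_le_mul_of_nonneg_right hx.2 (norm_nonneg _)
    · exact eLpNorm_favre_le hη hc₁ h.meas h.bounds (by norm_num) (by norm_num) (h.memLp_vel i)
  · refine (eLpNorm_le_of_ae_bound (C := P) (Eventually.of_forall fun x => ?_)).trans (by simp)
    split_ifs
    · have := hη.conv_mem_bounds h.meas h.bounds x
      exact hP _ this.1 this.2
    · simpa using hP0

end Slice

/-! ### Energy balance of the averaged quantities at a fixed time -/

/-- The time derivative of the averaged density. -/
def massRate (η ρ : Torus d → ℝ) (w : Fin d → Torus d → ℝ) (x : Torus d) : ℝ :=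
  -∑ j, conv (pd j η) (fun y => ρ y * w j y) x

/-- The time derivative of the averaged momentum. -/
def momRate (η : Torus d → ℝ) (N : Fin d → Fin d → Torus d → ℝ) (i : Fin d) (x : Torus d) : ℝ :=
  -∑ j, conv (pd j η) (N i j) x

/-- The time derivative of the energy density of averaged quantities; `P₁` is the derivative of
the pressure potential. -/
def energyRate (P₁ : ℝ → ℝ) (η ρ : Torus d → ℝ) (w : Fin d → Torus d → ℝ)
    (N : Fin d → Fin d → Torus d → ℝ) (x : Torus d) : ℝ :=
  ∑ i, (favre η ρ (w i) x * momRate η N i x - 1 / 2 * favre η ρ (w i) x ^ 2 * massRate η ρ w x) +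
    P₁ (conv η ρ x) * massRate η ρ w x

/-- Integration by parts with R, M and V = M/R. The flux divergence against V gives (η * N) : ∇V;
the term ½|V|² div M gives the convective flux V⊗M against ∇V; the pressure potential gives p(R) div
V. The averages enter nonlinearly but exactly, so no commutator appears. -/
lemma Slice.integral_energyRate {C δ c₁ c₂ : ℝ} {η ρ : Torus d → ℝ} {w : Fin d → Torus d → ℝ}
    {g N : Fin d → Fin d → Torus d → ℝ} {p p' P₁ : ℝ → ℝ} (h : Slice c₁ c₂ ρ w g N)
    (hη : IsKernel C δ η) (hc₁ : 0 < c₁) (hp : ∀ r, 0 < r → HasDerivAt p (p' r) r)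
    (hp' : ContinuousOn p' (Set.Ioi 0)) (hP₁ : ∀ r, 0 < r → HasDerivAt P₁ (p' r / r) r) :
    ∫ x, energyRate P₁ η ρ w N x = fluxWork p η ρ w N := by
  have hr := hη.conv_pos hc₁ h.meas h.bounds
  have hη' := hη.smooth.continuous_pd
  have cr := h.continuous_conv_density hη
  have cr' := fun j => continuous_conv (hη' j) (integrable_of_bounds h.meas h.bounds)
  have cm := h.continuous_conv_mom hc₁ hη
  have cm' := fun j => continuous_conv (hη' j) (h.integrable_mom hc₁ j)
  have cN := h.continuous_conv_flux hη
  have cN' := fun i j => continuous_conv (hη' j) ((h.memLp_flux i j).integrable (by norm_num))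
  have cV := h.continuous_vel hc₁ hη
  have cV' := h.continuous_velPD hc₁ hη
  have cp : Continuous fun x => p (conv η ρ x) :=
    ContinuousOn.comp_continuous (s := Set.Ioi 0)
      (fun r hr => (hp r hr).continuousAt.continuousWithinAt) cr hr
  have cp' : Continuous fun x => p' (conv η ρ x) := hp'.comp_continuous cr hr
  have cP : Continuous fun x => P₁ (conv η ρ x) :=
    ContinuousOn.comp_continuous (s := Set.Ioi 0)
      (fun r hr => (hP₁ r hr).continuousAt.continuousWithinAt) cr hr
  have dr := fun j => hasPD_conv (hη.smooth.hasPD j) hη.continuous (hη' j)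
    (integrable_of_bounds h.meas h.bounds)
  have dm := fun j => hasPD_conv (hη.smooth.hasPD j) hη.continuous (hη' j)
    (h.integrable_mom hc₁ j)
  have dN := fun i j => hasPD_conv (hη.smooth.hasPD j) hη.continuous (hη' j)
    ((h.memLp_flux i j).integrable (by norm_num))
  have dV := fun i j => hasPD_favre hη hc₁ h.meas h.bounds (h.integrable_mom hc₁ i) j
  have hint : ∀ {f : Torus d → ℝ}, Continuous f → Integrable f := Continuous.integrable_torus
  have T1 : ∀ i j, ∫ x, conv (pd j η) (N i j) x * favre η ρ (w i) x =
      -∫ x, conv η (N i j) x * favrePD j η ρ (w i) x := fun i j =>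
    integral_mul_hasPD (dN i j) (cN i j) (cN' i j) (dV i j) (cV i) (cV' i j)
  have T2 : ∀ i j, ∫ x, conv (pd j η) (fun y => ρ y * w j y) x * favre η ρ (w i) x ^ 2 =
      -(2 * ∫ x, conv η (fun y => ρ y * w j y) x * favre η ρ (w i) x * favrePD j η ρ (w i) x) :=
    fun i j => by
    have d2 := (dV i j).mul (dV i j)
    have := integral_mul_hasPD (dm j) (cm j) (cm' j) d2
      ((cV i).mul (cV i)) (((cV' i j).mul (cV i)).add ((cV i).mul (cV' i j)))
    rw [← integral_const_mul]
    simp only [sq]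
    rw [this]
    congr 2; funext x; ring
  -- Since P₁' = p'/r and M = RV, M · ∇P₁(R) = V · ∇p(R); a second integration by parts moves the
  -- gradient onto V.
  have T3 : ∀ j, ∫ x, conv (pd j η) (fun y => ρ y * w j y) x * P₁ (conv η ρ x) =
      ∫ x, p (conv η ρ x) * favrePD j η ρ (w j) x := fun j => by
    have d1 := (dr j).comp (F := P₁) (F' := fun r => p' r / r) fun x => hP₁ _ (hr x)
    have d2 := (dr j).comp (F := p) (F' := p') fun x => hp _ (hr x)
    have e1 := integral_mul_hasPD (dm j) (cm j) (cm' j) d1 cP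
      ((cp'.div cr fun x => (hr x).ne').mul (cr' j))
    have e2 := integral_mul_hasPD d2 cp (cp'.mul (cr' j)) (dV j j) (cV j) (cV' j j)
    have e3 : ∀ x, conv η (fun y => ρ y * w j y) x * (p' (conv η ρ x) / conv η ρ x *
        conv (pd j η) ρ x) = p' (conv η ρ x) * conv (pd j η) ρ x * favre η ρ (w j) x := fun x => by
      rw [favre]; ring
    rw [e1]
    simp only [e3]
    rw [e2, neg_neg]
  have eR : ∀ x, energyRate P₁ η ρ w N x =
      (∑ i, ∑ j, (-(conv (pd j η) (N i j) x * favre η ρ (w i) x) +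
        1 / 2 * (conv (pd j η) (fun y => ρ y * w j y) x * favre η ρ (w i) x ^ 2))) -
      ∑ j, conv (pd j η) (fun y => ρ y * w j y) x * P₁ (conv η ρ x) := fun x => by
    simp only [energyRate, massRate, momRate, Finset.sum_add_distrib, mul_neg, Finset.mul_sum,
      Finset.sum_neg_distrib, sub_neg_eq_add]
    rw [← sub_eq_add_neg]
    congr 1
    · congr 1
      · congr 1
        exact Finset.sum_congr rfl fun i _ => Finset.sum_congr rfl fun j _ => by ring
      · exact Finset.sum_congr rfl fun i _ => Finset.sum_congr rfl fun j _ => by ring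
    · exact Finset.sum_congr rfl fun j _ => by ring
  have eF : fluxWork p η ρ w N = (∑ i, ∑ j, ((∫ x, conv η (N i j) x * favrePD j η ρ (w i) x) -
      ∫ x, conv η (fun y => ρ y * w j y) x * favre η ρ (w i) x * favrePD j η ρ (w i) x)) -
      ∑ j, ∫ x, p (conv η ρ x) * favrePD j η ρ (w j) x := by
    have : ∀ i j, ∫ x, residualFlux p η ρ w N i j x * favrePD j η ρ (w i) x =
        ((∫ x, conv η (N i j) x * favrePD j η ρ (w i) x) -
        ∫ x, conv η (fun y => ρ y * w j y) x * favre η ρ (w i) x * favrePD j η ρ (w i) x) -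
        if i = j then ∫ x, p (conv η ρ x) * favrePD j η ρ (w i) x else 0 := fun i j => by
      have j1 : Integrable fun x => conv η (N i j) x * favrePD j η ρ (w i) x :=
        hint ((cN i j).mul (cV' i j))
      have j2 : Integrable fun x => conv η (fun y => ρ y * w j y) x * favre η ρ (w i) x *
          favrePD j η ρ (w i) x := hint (((cm j).mul (cV i)).mul (cV' i j))
      have j3 : Integrable fun x => p (conv η ρ x) * favrePD j η ρ (w i) x :=
        hint (cp.mul (cV' i j))
      rw [← integral_sub j1 j2]
      by_cases hij : i = j
      · subst hij
        simp only [if_true]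
        rw [← integral_sub (j1.sub' j2) j3]
        congr 1; funext x; simp only [residualFlux, if_true]; ring
      · simp only [if_neg hij, residualFlux, sub_zero]
        congr 1; funext x; ring
    simp only [fluxWork, this]
    simp only [Finset.sum_sub_distrib, Finset.sum_ite_eq, Finset.mem_univ, if_true]
  have i1 : ∀ i j, Integrable fun x => -(conv (pd j η) (N i j) x * favre η ρ (w i) x) :=
    fun i j => hint ((cN' i j).mul (cV i)).neg
  have i2 : ∀ i j, Integrable fun x =>
      1 / 2 * (conv (pd j η) (fun y => ρ y * w j y) x * favre η ρ (w i) x ^ 2) :=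
    fun i j => hint (continuous_const.mul ((cm' j).mul ((cV i).pow 2)))
  have i3 : ∀ j, Integrable fun x =>
      conv (pd j η) (fun y => ρ y * w j y) x * P₁ (conv η ρ x) :=
    fun j => hint ((cm' j).mul cP)
  have i12 : ∀ i j, Integrable fun x => -(conv (pd j η) (N i j) x * favre η ρ (w i) x) +
      1 / 2 * (conv (pd j η) (fun y => ρ y * w j y) x * favre η ρ (w i) x ^ 2) :=
    fun i j => (i1 i j).add (i2 i j)
  simp only [eR]
  rw [eF, integral_sub (integrable_finsetSum _ fun i _ => integrable_finsetSum _ fun j _ =>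
      i12 i j) (integrable_finsetSum _ fun j _ => i3 j),
    integral_finsetSum _ (fun i _ => integrable_finsetSum _ fun j _ => i12 i j),
    integral_finsetSum _ (fun j _ => i3 j)]
  congr 1
  · refine Finset.sum_congr rfl fun i _ => ?_
    rw [integral_finsetSum _ (fun j _ => i12 i j)]
    refine Finset.sum_congr rfl fun j _ => ?_
    rw [integral_add (i1 i j) (i2 i j), integral_neg, integral_const_mul, T1, T2]
    ring
  · exact Finset.sum_congr rfl fun j _ => T3 j

/-! ### Ladyzhenskaya's inequality -/

/-- The average of `h` over the closed coordinate line through `x` in direction `j`. -/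
def lineAverage (j : Fin d) (h : Torus d → ℝ) (x : Torus d) : ℝ :=
  ∫ t in (0 : ℝ)..1, h (x + shift j t)

lemma continuous_lineAverage {j : Fin d} {h : Torus d → ℝ} (hh : Continuous h) :
    Continuous (lineAverage j h) := by
  have := continuous_shift j
  exact intervalIntegral.continuous_parametric_intervalIntegral_of_continuous'
    (f := fun x t => h (x + shift j t)) (by unfold Function.uncurry; fun_prop) 0 1

lemma shift_one (j : Fin d) : shift j 1 = 0 := by
  ext i
  rw [shift_apply]
  split_ifs
  · exact AddCircle.coe_period 1
  · rfl

lemma lineAverage_add_shift (j : Fin d) (h : Torus d → ℝ) (x : Torus d) (s : ℝ) :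
    lineAverage j h (x + shift j s) = lineAverage j h x := by
  have hp : Function.Periodic (fun t : ℝ => h (x + shift j t)) 1 := fun t => by
    simp only [shift_add, shift_one, add_zero]
  have := hp.intervalIntegral_add_eq s 0
  simp only [zero_add] at this
  rw [lineAverage, lineAverage, ← this]
  simp only [add_assoc, ← shift_add]
  rw [intervalIntegral.integral_comp_add_left (fun t => h (x + shift j t)) s, add_zero]

lemma integral_lineAverage {j : Fin d} {h : Torus d → ℝ} (hh : Continuous h) :
    ∫ x, lineAverage j h x = ∫ x, h x := by
  obtain ⟨C, -, hC⟩ := exists_bound_torus hh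
  have hs := continuous_shift j
  have hint : Integrable (fun z : Torus d × ℝ => h (z.1 + shift j z.2))
      ((volume : Measure (Torus d)).prod (volume.restrict (Set.Ioc 0 1))) :=
    Integrable.of_bound (by fun_prop : Continuous fun z : Torus d × ℝ =>
      h (z.1 + shift j z.2)).aestronglyMeasurable C (Eventually.of_forall fun z => hC _)
  simp only [lineAverage, intervalIntegral.integral_of_le zero_le_one]
  rw [integral_integral_swap (f := fun x t => h (x + shift j t)) hint]
  simp only [integral_add_right_eq_self h]
  simp

/-- The value at x exceeds the value at any other point of the closed line by at most the integral
of |f'| over the line; average over that point. -/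
lemma le_lineAverage {j : Fin d} {f f' : Torus d → ℝ} (h : HasPD j f f') (hf : Continuous f)
    (hf' : Continuous f') (x : Torus d) :
    f x ≤ lineAverage j (fun x => f x + |f' x|) x := by
  have hs := continuous_shift j
  have c1 : Continuous fun t : ℝ => f (x + shift j t) := by fun_prop
  have c2 : Continuous fun t : ℝ => f' (x + shift j t) := by fun_prop
  have c3 : Continuous fun t : ℝ => |f' (x + shift j t)| := by fun_prop
  have key : ∀ s ∈ Set.Icc (0 : ℝ) 1,
      f x - ∫ t in (0 : ℝ)..1, |f' (x + shift j t)| ≤ f (x + shift j s) := fun s hs => by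
    have e := intervalIntegral.integral_eq_sub_of_hasDerivAt (a := 0) (b := s)
      (fun t _ => h.hasDerivAt x t) (c2.intervalIntegrable _ _)
    simp only [shift_zero, add_zero] at e
    have h1 := intervalIntegral.abs_integral_le_integral_abs (f := fun t => f' (x + shift j t))
      (μ := volume) hs.1
    have h2 : ∫ t in (0 : ℝ)..s, |f' (x + shift j t)| ≤ ∫ t in (0 : ℝ)..1, |f' (x + shift j t)| :=
      intervalIntegral.integral_mono_interval le_rfl hs.1 hs.2
        (Eventually.of_forall fun t => abs_nonneg _) (c3.intervalIntegrable _ _)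
    have h3 := neg_abs_le (∫ t in (0 : ℝ)..s, f' (x + shift j t))
    linarith
  have h4 := intervalIntegral.integral_mono_on (μ := volume) (a := (0 : ℝ)) (b := 1) zero_le_one
    intervalIntegrable_const (c1.intervalIntegrable _ _) key
  rw [intervalIntegral.integral_const] at h4
  rw [lineAverage, intervalIntegral.integral_add (c1.intervalIntegrable _ _)
    (c3.intervalIntegrable _ _)]
  simp only [sub_zero, one_smul] at h4
  linarith

/-- The average in direction 0 depends only on coordinate 1 and conversely, so the integral of the
product factors. -/
lemma integral_mul_lineAverage {h₀ h₁ : Torus 2 → ℝ} (hh₀ : Continuous h₀)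
    (hh₁ : Continuous h₁) :
    ∫ x, lineAverage 0 h₀ x * lineAverage 1 h₁ x = (∫ x, h₀ x) * ∫ x, h₁ x := by
  have e0 : ∀ x : Torus 2, lineAverage 0 h₀ x = lineAverage 0 h₀ ![0, x 1] := fun x => by
    obtain ⟨s, hs⟩ := QuotientAddGroup.mk_surjective (x 0)
    have : x = ![0, x 1] + shift 0 s := by
      funext i
      fin_cases i
      · simpa [shift_apply] using hs.symm
      · simp [shift_apply]
    nth_rw 1 [this]
    exact lineAverage_add_shift _ _ _ _
  have e1 : ∀ x : Torus 2, lineAverage 1 h₁ x = lineAverage 1 h₁ ![x 0, 0] := fun x => by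
    obtain ⟨s, hs⟩ := QuotientAddGroup.mk_surjective (x 1)
    have : x = ![x 0, 0] + shift 1 s := by
      funext i
      fin_cases i
      · simp [shift_apply]
      · simpa [shift_apply] using hs.symm
    nth_rw 1 [this]
    exact lineAverage_add_shift _ _ _ _
  have key : ∀ a b : UnitAddCircle → ℝ, ∫ x : Torus 2, a (x 0) * b (x 1) =
      (∫ y, a y) * ∫ y, b y := fun a b => by
    have := integral_fintype_prod_volume_eq_prod (𝕜 := ℝ) (ι := Fin 2)
      (E := fun _ => UnitAddCircle) ![a, b]
    simpa [Fin.prod_univ_two] using this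
  have k0 := key (fun _ => 1) fun y => lineAverage 0 h₀ ![0, y]
  have k1 := key (fun y => lineAverage 1 h₁ ![y, 0]) fun _ => 1
  have k2 := key (fun y => lineAverage 1 h₁ ![y, 0]) fun y => lineAverage 0 h₀ ![0, y]
  simp only [← e0, ← e1, one_mul, mul_one, integral_const, probReal_univ, smul_eq_mul] at k0 k1 k2
  rw [integral_lineAverage hh₀] at k0
  rw [integral_lineAverage hh₁] at k1
  rw [← k0, ← k1] at k2
  rw [mul_comm (∫ x, h₀ x), ← k2]
  simp only [mul_comm]

lemma lintegral_enorm_sq {X : Type*} [MeasurableSpace X] {μ : Measure X} (f : X → ℝ) :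
    ∫⁻ x, ‖f x‖ₑ ^ 2 ∂μ = eLpNorm f 2 μ ^ 2 := by
  rw [eLpNorm_eq_lintegral_rpow_enorm_toReal (by norm_num) (by norm_num), ← ENNReal.rpow_natCast,
    ← ENNReal.rpow_mul]
  simp

lemma lintegral_enorm_pow_four {X : Type*} [MeasurableSpace X] {μ : Measure X} (f : X → ℝ) :
    ∫⁻ x, ‖f x‖ₑ ^ 4 ∂μ = eLpNorm f 4 μ ^ 4 := by
  rw [eLpNorm_eq_lintegral_rpow_enorm_toReal (by norm_num) (by norm_num), ← ENNReal.rpow_natCast,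
    ← ENNReal.rpow_mul]
  simp

/-- Bound f² by its line averages in the two directions, multiply and integrate: f⁴ is dominated by
a product of functions of separate variables. Cauchy–Schwarz handles the derivative 2ff'. -/
lemma ladyzhenskaya_of_hasPD {f : Torus 2 → ℝ} {f' : Fin 2 → Torus 2 → ℝ}
    (h : ∀ j, HasPD j f (f' j)) (hf : Continuous f) (hf' : ∀ j, Continuous (f' j)) :
    ∫⁻ x, ‖f x‖ₑ ^ 4 ≤
      ∏ j, (eLpNorm f 2 volume ^ 2 + 2 * (eLpNorm f 2 volume * eLpNorm (f' j) 2 volume)) := by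
  set H : Fin 2 → Torus 2 → ℝ := fun j x => f x ^ 2 + |2 * (f x * f' j x)| with hH
  have cH : ∀ j, Continuous (H j) := fun j => by have := hf' j; fun_prop
  have nH : ∀ j x, 0 ≤ H j x := fun j x => by positivity
  have hle : ∀ j x, f x ^ 2 ≤ lineAverage j (H j) x := fun j x => by
    have d2 : HasPD j (fun x => f x ^ 2) (fun x => 2 * (f x * f' j x)) := fun x => by
      have := ((h j).mul (h j)) x
      simp only [← sq] at this
      convert this using 1; ring
    exact le_lineAverage d2 (by fun_prop) (by have := hf' j; fun_prop) x
  have h1 : ∫ x, f x ^ 4 ≤ (∫ x, H 0 x) * ∫ x, H 1 x := by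
    rw [← integral_mul_lineAverage (cH 0) (cH 1)]
    refine integral_mono (Continuous.integrable_torus (by fun_prop)) (Continuous.integrable_torus
      ((continuous_lineAverage (cH 0)).mul (continuous_lineAverage (cH 1)))) fun x => ?_
    calc f x ^ 4 = f x ^ 2 * f x ^ 2 := by ring
      _ ≤ _ := mul_le_mul (hle 0 x) (hle 1 x) (sq_nonneg _) ((sq_nonneg _).trans (hle 0 x))
  have h2 : ∀ j, ENNReal.ofReal (∫ x, H j x) ≤
      eLpNorm f 2 volume ^ 2 + 2 * (eLpNorm f 2 volume * eLpNorm (f' j) 2 volume) := fun j => by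
    have e : ∀ x, ENNReal.ofReal (H j x) = ‖f x‖ₑ ^ 2 + 2 * ‖f x * f' j x‖ₑ := fun x => by
      rw [hH]
      beta_reduce
      rw [ENNReal.ofReal_add (by positivity) (by positivity), ← sq_abs,
        ENNReal.ofReal_pow (abs_nonneg _), ← Real.enorm_eq_ofReal_abs, ← Real.enorm_eq_ofReal_abs,
        enorm_mul 2, Real.enorm_of_nonneg (show (0 : ℝ) ≤ 2 by norm_num)]
      simp
    rw [ofReal_integral_eq_lintegral_ofReal (Continuous.integrable_torus (cH j))
      (Eventually.of_forall (nH j))]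
    simp only [e]
    have m : Measurable fun x => ‖f x‖ₑ ^ 2 := (hf.measurable.enorm.pow_const 2)
    have m' : Measurable fun x => ‖f x * f' j x‖ₑ := (hf.mul (hf' j)).measurable.enorm
    rw [lintegral_add_left m, lintegral_const_mul _ m', lintegral_enorm_sq]
    gcongr
    rw [← eLpNorm_one_eq_lintegral_enorm]
    exact eLpNorm_mul_le hf.aestronglyMeasurable (hf' j).aestronglyMeasurable
  have h3 : ∫⁻ x, ‖f x‖ₑ ^ 4 = ENNReal.ofReal (∫ x, f x ^ 4) := by
    rw [ofReal_integral_eq_lintegral_ofReal (Continuous.integrable_torus (by fun_prop))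
      (Eventually.of_forall fun x => by positivity)]
    refine lintegral_congr fun x => ?_
    rw [Real.enorm_eq_ofReal_abs, ← ENNReal.ofReal_pow (abs_nonneg _)]
    congr 1
    exact Even.pow_abs (by decide) _
  rw [h3, Fin.prod_univ_two]
  refine (ENNReal.ofReal_le_ofReal h1).trans ?_
  rw [ENNReal.ofReal_mul (integral_nonneg (nH 0))]
  exact mul_le_mul' (h2 0) (h2 1)

/-- Ladyzhenskaya's inequality on the two-dimensional torus. -/
lemma ladyzhenskaya {f : Torus 2 → ℝ} {g : Fin 2 → Torus 2 → ℝ} (h : ∀ j, HasWeakPD j f (g j))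
    (hf : MemLp f 2) (hg : ∀ j, MemLp (g j) 2) :
    ∫⁻ x, ‖f x‖ₑ ^ 4 ≤
      ∏ j, (eLpNorm f 2 volume ^ 2 + 2 * (eLpNorm f 2 volume * eLpNorm (g j) 2 volume)) := by
  obtain ⟨C, δ, η, hη⟩ := exists_mollifier 2
  have hk := hη.kernel
  have hfi := hf.integrable (by norm_num)
  have hgi := fun j => (hg j).integrable (by norm_num)
  have cf := fun n => continuous_conv (hk n).continuous hfi
  have cg := fun n j => continuous_conv (hk n).continuous (hgi j)
  have hT := hη.tendsto_conv (p := 2) (by norm_num) (by norm_num) hf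
  obtain ⟨ns, -, hns⟩ := (tendstoInMeasure_of_tendsto_eLpNorm (by norm_num)
    (fun n => (cf n).aestronglyMeasurable) hf.1 hT).exists_seq_tendsto_ae
  -- Integrability of f⁴ is part of the claim, so the limit is taken by Fatou's lemma along an
  -- almost everywhere convergent subsequence.
  calc ∫⁻ x, ‖f x‖ₑ ^ 4 = ∫⁻ x, liminf (fun n => ‖conv (η (ns n)) f x‖ₑ ^ 4) atTop := by
        refine lintegral_congr_ae (hns.mono fun x hx => ?_)
        exact ((ENNReal.continuous_pow 4).tendsto _ |>.comp
          ((continuous_enorm.tendsto _).comp hx)).liminf_eq.symm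
    _ ≤ liminf (fun n => ∫⁻ x, ‖conv (η (ns n)) f x‖ₑ ^ 4) atTop :=
        lintegral_liminf_le fun n => (cf _).measurable.enorm.pow_const 4
    _ ≤ _ := by
        refine liminf_le_of_le (by isBoundedDefault) fun b hb => ?_
        obtain ⟨n, hn⟩ := hb.exists
        refine hn.trans ((ladyzhenskaya_of_hasPD (fun j => (h j).hasPD_conv (hk (ns n)).smooth hfi)
          (cf _) (cg _)).trans ?_)
        gcongr with j
        · exact (hk _).eLpNorm_conv_le hf.1 (by norm_num) (by norm_num)
        · exact (hk _).eLpNorm_conv_le hf.1 (by norm_num) (by norm_num)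
        · exact (hk _).eLpNorm_conv_le (hg j).1 (by norm_num) (by norm_num)

/-! ### Weak derivatives in time -/

/-- A set of full measure meets every interval to the right of t. Closed properties valid at almost
every time thus pass, through right limits, to every time including t = 0. -/
lemma frequently_nhdsGT_of_ae {T t : ℝ} (ht : t ∈ Set.Ico 0 T) {P : ℝ → Prop}
    (h : ∀ᵐ s ∂(volume.restrict (Set.Ioo 0 T)), P s) : ∃ᶠ s in 𝓝[>] t, s ∈ Set.Ioo 0 T ∧ P s := by
  rw [Filter.Frequently, Filter.Eventually, mem_nhdsGT_iff_exists_Ioo_subset]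
  rintro ⟨e, he, hsub⟩
  have he' : t < e := he
  set e' := min e T
  have hte : t < e' := lt_min he' ht.2
  have hsub' : Set.Ioo t e' ⊆ Set.Ioo 0 T := fun s hs =>
    ⟨ht.1.trans_lt hs.1, hs.2.trans_le (min_le_right _ _)⟩
  have h2 := ae_restrict_of_ae_restrict_of_subset hsub' h
  have hne : (ae (volume.restrict (Set.Ioo t e'))).NeBot := by
    rw [ae_neBot, Ne, Measure.restrict_eq_zero, Real.volume_Ioo]
    simpa using hte
  obtain ⟨s, hs, hP⟩ := ((ae_restrict_mem measurableSet_Ioo).and h2).exists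
  exact hsub (⟨hs.1, hs.2.trans_le (min_le_left _ _)⟩ : s ∈ Set.Ioo t e) ⟨hsub' hs, hP⟩

lemma intervalIntegrable_of_Ioo {T t : ℝ} (ht : t ∈ Set.Icc 0 T) {g : ℝ → ℝ}
    (hg : IntegrableOn g (Set.Ioo 0 T)) : IntervalIntegrable g volume 0 t := by
  rw [intervalIntegrable_iff_integrableOn_Ioo_of_le ht.1]
  exact hg.mono_set (Set.Ioo_subset_Ioo_right ht.2)

lemma tendsto_primitive {T t : ℝ} (ht : t ∈ Set.Ico 0 T) {g : ℝ → ℝ}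
    (hg : IntegrableOn g (Set.Ioo 0 T)) :
    Tendsto (fun t => ∫ s in (0 : ℝ)..t, g s) (𝓝[>] t) (𝓝 (∫ s in (0 : ℝ)..t, g s)) := by
  have hT : 0 ≤ T := ht.1.trans ht.2.le
  have hc := intervalIntegral.continuousOn_primitive_interval' (a := 0) (b₁ := 0) (b₂ := T)
    (intervalIntegrable_of_Ioo ⟨hT, le_rfl⟩ hg) Set.left_mem_uIcc
  rw [Set.uIcc_of_le hT] at hc
  have h1 := hc t ⟨ht.1, ht.2.le⟩
  refine h1.mono_left (nhdsWithin_le_iff.2 ?_)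
  filter_upwards [Ioo_mem_nhdsGT ht.2] with s hs using ⟨ht.1.trans hs.1.le, hs.2.le⟩

/-- The du Bois-Reymond lemma. -/
lemma exists_ae_eq_const_of_integral_deriv_mul {T : ℝ} (hT : 0 < T) {h : ℝ → ℝ}
    (hh : IntegrableOn h (Set.Ioo 0 T))
    (h0 : ∀ θ : ℝ → ℝ, ContDiff ℝ ∞ θ →
      (∃ a b : ℝ, 0 < a ∧ b < T ∧ ∀ t, t ∉ Set.Icc a b → θ t = 0) →
      ∫ t in Set.Ioo 0 T, deriv θ t * h t = 0) :
    ∃ c : ℝ, ∀ᵐ t ∂(volume.restrict (Set.Ioo 0 T)), h t = c := by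
  -- A bump centred in (0,T) and supported in [T/4, 3T/4]; normalised, it absorbs the mean of an
  -- arbitrary test function.
  let B : ContDiffBump (T / 2 : ℝ) := ⟨T / 8, T / 4, by positivity, by linarith⟩
  set χ : ℝ → ℝ := B.normed volume
  have hχs : ContDiff ℝ ∞ χ := B.contDiff_normed
  have hχ1 : ∫ t, χ t = 1 := B.integral_normed
  have hχsupp : ∀ t, t ∉ Set.Icc (T / 4) (3 * T / 4) → χ t = 0 := fun t ht => by
    have : t ∉ Function.support χ := by
      rw [B.support_normed_eq]
      intro hb
      rw [Metric.mem_ball, Real.dist_eq, abs_lt] at hb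
      change -(T / 4) < _ ∧ _ < T / 4 at hb
      exact ht ⟨by linarith, by linarith⟩
    simpa using this
  have hset : ∀ f : ℝ → ℝ, (∃ a b : ℝ, 0 < a ∧ b < T ∧ ∀ t, t ∉ Set.Icc a b → f t = 0) →
      ∀ k : ℝ → ℝ, ∫ t in Set.Ioo 0 T, f t * k t = ∫ t, f t * k t := fun f hf k => by
    obtain ⟨a, b, ha, hb, hab⟩ := hf
    refine setIntegral_eq_integral_of_forall_compl_eq_zero fun t ht => ?_
    rw [hab t fun hm => ht ⟨ha.trans_le hm.1, hm.2.trans_lt hb⟩, zero_mul]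
  have hbdd : ∀ f : ℝ → ℝ, Continuous f → IntegrableOn (fun t => f t * h t) (Set.Ioo 0 T) :=
    fun f hf => by
      obtain ⟨K, hK⟩ := isCompact_Icc.exists_bound_of_continuousOn (s := Set.Icc 0 T) hf.continuousOn
      exact hh.bdd_mul (c := K) hf.aestronglyMeasurable (by
        filter_upwards [ae_restrict_mem measurableSet_Ioo] with t ht
        exact hK t ⟨ht.1.le, ht.2.le⟩)
  set c := ∫ t in Set.Ioo 0 T, χ t * h t
  refine ⟨c, ?_⟩
  have key := isOpen_Ioo.ae_eq_zero_of_integral_contDiff_smul_eq_zero (U := Set.Ioo 0 T)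
    (μ := volume) (f := fun t => h t - c)
    ((hh.sub (integrable_const c)).locallyIntegrableOn) ?_
  · rw [ae_restrict_iff' measurableSet_Ioo]
    filter_upwards [key] with t ht hm
    linarith [ht hm]
  intro φ hφ hφc hφT
  have hsuppφ : ∃ a b : ℝ, 0 < a ∧ b < T ∧ ∀ t, t ∉ Set.Icc a b → φ t = 0 := by
    rcases (tsupport φ).eq_empty_or_nonempty with he | hne
    · exact ⟨T / 2, T / 2, by linarith, by linarith, fun t _ => by
        rw [tsupport_eq_empty_iff] at he; simp [he]⟩
    · obtain ⟨a, ha, ha'⟩ := hφc.exists_isMinOn hne continuousOn_id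
      obtain ⟨b, hb, hb'⟩ := hφc.exists_isMaxOn hne continuousOn_id
      refine ⟨a, b, (hφT ha).1, (hφT hb).2, fun t ht => ?_⟩
      by_contra hne
      have hm := subset_tsupport φ (Function.mem_support.2 hne)
      exact ht ⟨ha' hm, hb' hm⟩
  set I := ∫ t, φ t
  -- ψ has integral zero, so its primitive vanishes beyond the support and is an admissible test
  -- function.
  set ψ : ℝ → ℝ := fun t => φ t - I * χ t
  have hψ : ContDiff ℝ ∞ ψ := hφ.sub (contDiff_const.mul hχs)
  have hψint : Integrable ψ :=
    (hφ.continuous.integrable_of_hasCompactSupport hφc).sub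
      ((hχs.continuous.integrable_of_hasCompactSupport B.hasCompactSupport_normed).const_mul I)
  have hψ0 : ∫ t, ψ t = 0 := by
    rw [integral_sub (hφ.continuous.integrable_of_hasCompactSupport hφc)
      ((hχs.continuous.integrable_of_hasCompactSupport B.hasCompactSupport_normed).const_mul I),
      integral_const_mul, hχ1]
    simp [I]
  obtain ⟨a, b, ha, hb, hab⟩ := hsuppφ
  set a' := min a (T / 4)
  set b' := max b (3 * T / 4)
  have ha' : 0 < a' := lt_min ha (by linarith)
  have hb' : b' < T := max_lt hb (by linarith)
  have hψsupp : ∀ t, t ∉ Set.Icc a' b' → ψ t = 0 := fun t ht => by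
    have h1 : φ t = 0 := hab t fun hm => ht ⟨(min_le_left _ _).trans hm.1, hm.2.trans (le_max_left _ _)⟩
    have h2 : χ t = 0 := hχsupp t fun hm =>
      ht ⟨(min_le_right _ _).trans hm.1, hm.2.trans (le_max_right _ _)⟩
    simp only [ψ, h1, h2]; ring
  set θ : ℝ → ℝ := fun t => ∫ s in (0 : ℝ)..t, ψ s
  have hθd : ∀ t, HasDerivAt θ (ψ t) t := fun t =>
    intervalIntegral.integral_hasDerivAt_right (hψ.continuous.intervalIntegrable _ _)
      (hψ.continuous.stronglyMeasurableAtFilter _ _) hψ.continuous.continuousAt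
  have hθ' : deriv θ = ψ := funext fun t => (hθd t).deriv
  have hθs : ContDiff ℝ ∞ θ := contDiff_infty_iff_deriv.2
    ⟨fun t => (hθd t).differentiableAt, by rw [hθ']; exact hψ⟩
  have hθsupp : ∀ t, t ∉ Set.Icc a' b' → θ t = 0 := fun t ht => by
    rcases lt_or_ge t a' with h1 | h1
    · refine (intervalIntegral.integral_congr (g := fun _ => 0) fun s hs => hψsupp s fun hm => ?_).trans
        (by simp)
      rcases Set.mem_uIcc.1 hs with h2 | h2
      · linarith [hm.1, h2.2]
      · linarith [hm.1, h2.2]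
    · have h2 : b' < t := by by_contra h3; exact ht ⟨h1, not_lt.1 h3⟩
      have h3 : θ t = ∫ s, ψ s := by
        have ht0 : 0 ≤ t := ha'.le.trans h1
        simp only [θ]
        rw [intervalIntegral.integral_of_le ht0]
        refine setIntegral_eq_integral_of_forall_compl_eq_zero fun s hs => hψsupp s fun hm => ?_
        exact hs ⟨ha'.trans_le hm.1, hm.2.trans h2.le⟩
      rw [h3, hψ0]
  have hfin := h0 θ hθs ⟨a', b', ha', hb', hθsupp⟩
  rw [hθ'] at hfin
  have e1 : ∫ t in Set.Ioo 0 T, ψ t * h t = (∫ t in Set.Ioo 0 T, φ t * h t) - I * c := by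
    rw [← integral_const_mul, ← integral_sub (hbdd φ hφ.continuous)
      ((hbdd χ hχs.continuous).const_mul I)]
    congr 1; funext t; simp only [ψ]; ring
  have e2 : ∫ t in Set.Ioo 0 T, φ t * c = I * c := by
    rw [hset φ ⟨a, b, ha, hb, hab⟩, integral_mul_const]
  simp only [smul_eq_mul]
  rw [← hset φ ⟨a, b, ha, hb, hab⟩]
  simp only [mul_sub]
  rw [integral_sub (hbdd φ hφ.continuous)
    (((hφ.continuous.integrable_of_hasCompactSupport hφc).mul_const c).integrableOn), e2]
  linarith

/-- A function whose weak derivative on `(0,T)` is integrable is a primitive of it, almost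
everywhere and at every point of continuity. -/
lemma eq_primitive_of_weak_deriv {T : ℝ} (hT : 0 < T) {f g : ℝ → ℝ} {f₀ : ℝ}
    (hf : IntegrableOn f (Set.Ioo 0 T)) (hg : IntegrableOn g (Set.Ioo 0 T))
    (h0 : ∀ θ : ℝ → ℝ, ContDiff ℝ ∞ θ →
      (∃ a b : ℝ, 0 < a ∧ b < T ∧ ∀ t, t ∉ Set.Icc a b → θ t = 0) →
      ∫ t in Set.Ioo 0 T, (deriv θ t * f t + θ t * g t) = 0)
    (hinit : Tendsto f (𝓝[>] 0) (𝓝 f₀)) :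
    (∀ᵐ t ∂(volume.restrict (Set.Ioo 0 T)), f t = f₀ + ∫ s in (0 : ℝ)..t, g s) ∧
    ∀ t ∈ Set.Ioo 0 T, ContinuousAt f t → f t = f₀ + ∫ s in (0 : ℝ)..t, g s := by
  set G : ℝ → ℝ := fun t => ∫ s in (0 : ℝ)..t, g s with hG
  have hgi := intervalIntegrable_of_Ioo ⟨hT.le, le_rfl⟩ hg
  have hGac : AbsolutelyContinuousOnInterval G 0 T :=
    hgi.absolutelyContinuousOnInterval_intervalIntegral Set.left_mem_uIcc
  have hGc : ContinuousOn G (Set.Icc 0 T) := by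
    simpa [Set.uIcc_of_le hT.le] using hGac.continuousOn
  have hbdd : ∀ k f : ℝ → ℝ, Continuous k → IntegrableOn f (Set.Ioo 0 T) →
      IntegrableOn (fun t => k t * f t) (Set.Ioo 0 T) := fun k f hk hf => by
    obtain ⟨K, hK⟩ := isCompact_Icc.exists_bound_of_continuousOn (s := Set.Icc 0 T) hk.continuousOn
    exact hf.bdd_mul (c := K) hk.aestronglyMeasurable (by
      filter_upwards [ae_restrict_mem measurableSet_Ioo] with t ht
      exact hK t ⟨ht.1.le, ht.2.le⟩)
  have hGi : IntegrableOn G (Set.Ioo 0 T) :=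
    (hGc.integrableOn_compact isCompact_Icc).mono_set Set.Ioo_subset_Icc_self
  -- Integration by parts for the absolutely continuous primitive G shows that f - G has vanishing
  -- weak derivative.
  obtain ⟨c, hc⟩ := exists_ae_eq_const_of_integral_deriv_mul hT (h := fun t => f t - G t)
    (hf.sub hGi) (fun θ hθ hs => by
      have hθ' : Continuous (deriv θ) := hθ.continuous_deriv (by simp)
      have h1 := h0 θ hθ hs
      obtain ⟨a, b, ha, hb, hab⟩ := hs
      have hθac : AbsolutelyContinuousOnInterval θ 0 T :=
        ((hθ.of_le (by norm_cast)).contDiffOn : ContDiffOn ℝ 1 θ _).absolutelyContinuousOnInterval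
      have h2 := hGac.integral_mul_deriv_eq_deriv_mul hθac
      rw [hab T fun hm => absurd hm.2 (not_le.2 hb), hab 0 fun hm => absurd hm.1 (not_le.2 ha)] at h2
      have h3 : ∫ x in (0 : ℝ)..T, deriv G x * θ x = ∫ x in (0 : ℝ)..T, g x * θ x := by
        refine intervalIntegral.integral_congr_ae ?_
        filter_upwards [hgi.ae_hasDerivAt_integral] with x hx hxm
        rw [(hx (Set.uIoc_subset_uIcc hxm) 0 Set.left_mem_uIcc).deriv]
      rw [h3] at h2
      simp only [intervalIntegral.integral_of_le hT.le, integral_Ioc_eq_integral_Ioo] at h2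
      rw [integral_add (hbdd _ _ hθ' hf) (hbdd _ _ hθ.continuous hg)] at h1
      simp only [mul_sub]
      rw [integral_sub (hbdd _ _ hθ' hf) (hbdd _ _ hθ' hGi)]
      simp only [mul_comm (G _), mul_comm (g _)] at h2
      linarith)
  -- A right limit of f determines the constant. At t = 0 this identifies it with the initial value;
  -- at a point of continuity it gives the formula for f(t) itself.
  have hlim : ∀ t ∈ Set.Ico 0 T, ∀ l : ℝ, Tendsto f (𝓝[>] t) (𝓝 l) → l - G t = c := by
    intro t ht l hl
    have h1 : Tendsto (fun s => f s - G s) (𝓝[>] t) (𝓝 (l - G t)) :=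
      hl.sub (tendsto_primitive ht hg)
    by_contra hne
    have h2 := h1.eventually_ne hne
    obtain ⟨s, ⟨-, hs⟩, hs'⟩ := ((frequently_nhdsGT_of_ae ht hc).and_eventually h2).exists
    exact hs' hs
  have hc0 : f₀ = c := by
    have := hlim 0 ⟨le_rfl, hT⟩ f₀ hinit
    simpa [hG] using this
  refine ⟨hc.mono fun t ht => by rw [hc0]; linarith, fun t ht hft => ?_⟩
  have := hlim t ⟨ht.1.le, ht.2⟩ (f t) (hft.tendsto.mono_left nhdsWithin_le_nhds)
  rw [hc0]; linarith

/-! ### Chain rule along absolutely continuous curves -/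

lemma exists_lipschitzOnWith_of_hasDerivAt {F F' : ℝ → ℝ} {a b : ℝ}
    (h : ∀ r ∈ Set.Icc a b, HasDerivAt F (F' r) r) (hF' : ContinuousOn F' (Set.Icc a b)) :
    ∃ L : ℝ≥0, LipschitzOnWith L F (Set.Icc a b) := by
  obtain ⟨K, hK⟩ := isCompact_Icc.exists_bound_of_continuousOn hF'
  refine ⟨K.toNNReal, (convex_Icc a b).lipschitzOnWith_of_nnnorm_hasDerivWithin_le
    (fun r hr => (h r hr).hasDerivWithinAt) fun r hr => ?_⟩
  rw [← NNReal.coe_le_coe, coe_nnnorm]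
  exact (hK r hr).trans (Real.le_coe_toNNReal K)

lemma AbsolutelyContinuousOnInterval.lipschitz_comp {f F : ℝ → ℝ} {a b : ℝ} {s : Set ℝ} {L : ℝ≥0}
    (hf : AbsolutelyContinuousOnInterval f a b) (hF : LipschitzOnWith L F s)
    (hs : ∀ x ∈ Set.uIcc a b, f x ∈ s) : AbsolutelyContinuousOnInterval (fun x => F (f x)) a b := by
  have h1 : Tendsto (fun E : ℕ × (ℕ → ℝ × ℝ) => L *
      ∑ i ∈ Finset.range E.1, dist (f (E.2 i).1) (f (E.2 i).2))
      (AbsolutelyContinuousOnInterval.totalLengthFilter ⊓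
        𝓟 (AbsolutelyContinuousOnInterval.disjWithin a b)) (𝓝 (L * 0)) :=
    Tendsto.const_mul (L : ℝ) hf
  rw [mul_zero] at h1
  refine squeeze_zero' (Eventually.of_forall fun E => Finset.sum_nonneg fun _ _ => dist_nonneg)
    ?_ h1
  filter_upwards [mem_inf_of_right (mem_principal_self _)] with E hE
  rw [Finset.mul_sum]
  refine Finset.sum_le_sum fun i hi => ?_
  exact hF.dist_le_mul _ (hs _ (hE.1 i hi).1) _ (hs _ (hE.1 i hi).2)

/-- The chain rule for the energy density along absolutely continuous density and momentum. -/
lemma energy_chain_rule {d : ℕ} {t c₁ : ℝ} (ht : 0 ≤ t) (hc₁ : 0 < c₁) {P P₁ : ℝ → ℝ}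
    (hP : ∀ r, 0 < r → HasDerivAt P (P₁ r) r) (hP₁ : ContinuousOn P₁ (Set.Ioi 0))
    {a : ℝ → ℝ} {b : Fin d → ℝ → ℝ} {R₀ : ℝ} {M₀ : Fin d → ℝ}
    (ha : IntervalIntegrable a volume 0 t) (hb : ∀ i, IntervalIntegrable (b i) volume 0 t)
    {R : ℝ → ℝ} {M : Fin d → ℝ → ℝ} (hR : ∀ s, R s = R₀ + ∫ x in (0 : ℝ)..s, a x)
    (hM : ∀ i s, M i s = M₀ i + ∫ x in (0 : ℝ)..s, b i x)
    (hRc : ∀ s ∈ Set.Icc 0 t, c₁ ≤ R s) :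
    ∫ s in (0 : ℝ)..t, (∑ i, (M i s / R s * b i s - 1 / 2 * (M i s / R s) ^ 2 * a s) +
      P₁ (R s) * a s) =
      (∑ i, 1 / 2 * (M i t ^ 2 / R t) + P (R t)) - (∑ i, 1 / 2 * (M₀ i ^ 2 / R₀) + P R₀) := by
  have acR : AbsolutelyContinuousOnInterval R 0 t := by
    have h1 := ha.absolutelyContinuousOnInterval_intervalIntegral Set.left_mem_uIcc
    have h2 : AbsolutelyContinuousOnInterval (fun _ : ℝ => R₀) 0 t :=
      (LipschitzWith.const R₀).lipschitzOnWith.absolutelyContinuousOnInterval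
    have := h2.fun_add h1
    rwa [← funext hR] at this
  have acM : ∀ i, AbsolutelyContinuousOnInterval (M i) 0 t := fun i => by
    have h1 := (hb i).absolutelyContinuousOnInterval_intervalIntegral Set.left_mem_uIcc
    have h2 : AbsolutelyContinuousOnInterval (fun _ : ℝ => M₀ i) 0 t :=
      (LipschitzWith.const (M₀ i)).lipschitzOnWith.absolutelyContinuousOnInterval
    have := h2.fun_add h1
    rwa [← funext (hM i)] at this
  -- With an upper bound, R stays in a compact subinterval of (0,∞), where 1/r and P are Lipschitz
  -- and preserve absolute continuity.
  obtain ⟨c₂, hc₂⟩ := acR.exists_bound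
  rw [Set.uIcc_of_le ht] at hc₂
  have hpos : ∀ r ∈ Set.Icc c₁ c₂, 0 < r := fun r hr => hc₁.trans_le hr.1
  have hmem : ∀ s ∈ Set.uIcc 0 t, R s ∈ Set.Icc c₁ c₂ := fun s hs => by
    rw [Set.uIcc_of_le ht] at hs
    exact ⟨hRc s hs, (le_abs_self _).trans (hc₂ s hs)⟩
  obtain ⟨L, hL⟩ := exists_lipschitzOnWith_of_hasDerivAt (a := c₁) (b := c₂)
    (fun r hr => hasDerivAt_inv (hpos r hr).ne')
    (((continuousOn_id.pow 2).inv₀ fun r hr => pow_ne_zero 2 (hpos r hr).ne').neg)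
  obtain ⟨L', hL'⟩ := exists_lipschitzOnWith_of_hasDerivAt (a := c₁) (b := c₂)
    (fun r hr => hP r (hpos r hr)) (hP₁.mono hpos)
  have acI := AbsolutelyContinuousOnInterval.lipschitz_comp acR hL hmem
  have acP := AbsolutelyContinuousOnInterval.lipschitz_comp acR hL' hmem
  have acK : ∀ i, AbsolutelyContinuousOnInterval (fun s => 1 / 2 * (M i s * M i s * (R s)⁻¹)) 0 t :=
    fun i => (((acM i).fun_mul (acM i)).fun_mul acI).const_mul _
  have acS : ∀ S : Finset (Fin d), AbsolutelyContinuousOnInterval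
      (fun s => ∑ i ∈ S, 1 / 2 * (M i s * M i s * (R s)⁻¹)) 0 t := fun S => by
    induction S using Finset.induction_on with
    | empty =>
      simp only [Finset.sum_empty]
      exact (LipschitzWith.const (0 : ℝ)).lipschitzOnWith.absolutelyContinuousOnInterval
    | insert i S hi ih =>
      simp only [Finset.sum_insert hi]
      exact (acK i).fun_add ih
  have hmain := ((acS Finset.univ).fun_add acP).integral_deriv_eq_sub
  have hcongr : ∫ s in (0 : ℝ)..t, deriv (fun s => ∑ i, 1 / 2 * (M i s * M i s * (R s)⁻¹) + P (R s)) s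
      = ∫ s in (0 : ℝ)..t, (∑ i, (M i s / R s * b i s - 1 / 2 * (M i s / R s) ^ 2 * a s) +
      P₁ (R s) * a s) := by
    refine intervalIntegral.integral_congr_ae ?_
    filter_upwards [ha.ae_hasDerivAt_integral, eventually_all.2 fun i => (hb i).ae_hasDerivAt_integral]
      with s hs hs' hsm
    have hsm' := Set.uIoc_subset_uIcc hsm
    have dR : HasDerivAt R (a s) s := by
      have := (hs hsm' 0 Set.left_mem_uIcc).const_add R₀
      rwa [← funext hR] at this
    have dM : ∀ i, HasDerivAt (M i) (b i s) s := fun i => by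
      have := (hs' i hsm' 0 Set.left_mem_uIcc).const_add (M₀ i)
      rwa [← funext (hM i)] at this
    have hR0 : 0 < R s := hpos _ (hmem s hsm')
    have dK : ∀ i ∈ Finset.univ, HasDerivAt (fun s => 1 / 2 * (M i s * M i s * (R s)⁻¹))
        (M i s / R s * b i s - 1 / 2 * (M i s / R s) ^ 2 * a s) s := fun i _ => by
      have := ((((dM i).fun_mul (dM i)).fun_mul (dR.fun_inv hR0.ne')).const_mul (1 / 2))
      refine this.congr_deriv ?_
      field_simp
      ring
    have dP := (hP _ hR0).comp s dR
    exact ((HasDerivAt.fun_sum dK).fun_add dP).deriv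
  rw [← hcongr, hmain]
  have h0 : R 0 = R₀ := by simp [hR]
  have h0' : ∀ i, M i 0 = M₀ i := fun i => by simp [hM]
  simp only [h0, h0', div_eq_mul_inv, sq]

/-! ### Averaged balance laws -/

/-- Weak solutions of the scalar balance law `∂_t f + ∇·N = 0` with initial value `f₀`. -/
structure Balance (T : ℝ) (f : ℝ → Torus d → ℝ) (N : Fin d → ℝ → Torus d → ℝ)
    (f₀ : Torus d → ℝ) : Prop where
  integrable : Integrable (Function.uncurry f) (spaceTime d T)
  integrable_flux : ∀ j, Integrable (Function.uncurry (N j)) (spaceTime d T)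
  integrable_init : Integrable f₀
  weak : ∀ φ : ℝ → Torus d → ℝ, IsTest T φ →
    ∫ t in Set.Ioo 0 T, ∫ x, (f t x * dt φ t x + ∑ j, N j t x * pd j (φ t) x) = 0
  init : ∀ φ : Torus d → ℝ, IsSmooth φ →
    Tendsto (fun t => ∫ x, f t x * φ x) (𝓝[>] (0 : ℝ)) (𝓝 (∫ x, f₀ x * φ x))

lemma integrable_uncurry_mul {T : ℝ} {f : ℝ → Torus d → ℝ}
    (hf : Integrable (Function.uncurry f) (spaceTime d T)) {χ : Torus d → ℝ}
    (hχ : Continuous χ) :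
    Integrable (fun z : ℝ × Torus d => f z.1 z.2 * χ z.2) (spaceTime d T) := by
  obtain ⟨C, -, hC⟩ := exists_bound_torus hχ
  exact hf.mul_bdd (c := C) (hχ.comp continuous_snd).aestronglyMeasurable
    (Eventually.of_forall fun z => hC _)

lemma integrableOn_pairing {T : ℝ} {f : ℝ → Torus d → ℝ}
    (hf : Integrable (Function.uncurry f) (spaceTime d T)) {χ : Torus d → ℝ}
    (hχ : Continuous χ) : IntegrableOn (fun t => ∫ x, f t x * χ x) (Set.Ioo 0 T) :=
  (integrable_uncurry_mul hf hχ).integral_prod_left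

lemma integrableOn_conv {T : ℝ} {f : ℝ → Torus d → ℝ}
    (hf : Integrable (Function.uncurry f) (spaceTime d T)) {K : Torus d → ℝ}
    (hK : Continuous K) (x : Torus d) : IntegrableOn (fun t => conv K (f t) x) (Set.Ioo 0 T) := by
  simp only [conv_eq, mul_comm (K _)]
  exact integrableOn_pairing hf (by fun_prop)

lemma isTest_mul {T : ℝ} {θ : ℝ → ℝ} {χ : Torus d → ℝ} (hθ : ContDiff ℝ ∞ θ)
    (hs : ∃ a b : ℝ, 0 < a ∧ b < T ∧ ∀ t, t ∉ Set.Icc a b → θ t = 0) (hχ : IsSmooth χ) :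
    IsTest T (fun t x => θ t * χ x) where
  smooth := (hθ.comp contDiff_fst).mul
    (ContDiff.comp (g := fun y : Vec d => χ (toTorus y)) hχ contDiff_snd)
  support := by
    obtain ⟨a, b, ha, hb, h⟩ := hs
    exact ⟨a, b, ha, hb, fun t ht x => by rw [h t ht, zero_mul]⟩

/-- The averaged solution of a balance law, as a primitive in time of the averaged flux. -/
def primitiveConv (η f₀ : Torus d → ℝ) (N : Fin d → ℝ → Torus d → ℝ) (t : ℝ) (x : Torus d) : ℝ :=
  conv η f₀ x + ∫ s in (0 : ℝ)..t, -∑ j, conv (pd j η) (N j s) x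

namespace Balance

variable {T : ℝ} {f : ℝ → Torus d → ℝ} {N : Fin d → ℝ → Torus d → ℝ} {f₀ η : Torus d → ℝ}

lemma integrable_slice (h : Balance T f N f₀) :
    ∀ᵐ t ∂(volume.restrict (Set.Ioo 0 T)), Integrable (f t) :=
  h.integrable.prod_right_ae

lemma integrable_flux_slice (h : Balance T f N f₀) :
    ∀ᵐ t ∂(volume.restrict (Set.Ioo 0 T)), ∀ j, Integrable (N j t) :=
  eventually_all.2 fun j => (h.integrable_flux j).prod_right_ae

lemma integrableOn_rate (h : Balance T f N f₀) (hη : IsSmooth η) (x : Torus d) :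
    IntegrableOn (fun s => -∑ j, conv (pd j η) (N j s) x) (Set.Ioo 0 T) :=
  (integrable_finsetSum _ fun j _ =>
    integrableOn_conv (h.integrable_flux j) (hη.continuous_pd j) x).neg

/-- Test functions of the form θ(t)χ(x) reduce the balance law to a weak differential equation in
time for the pairing with χ. -/
lemma pairing_eq (h : Balance T f N f₀) (hT : 0 < T) {χ : Torus d → ℝ} (hχ : IsSmooth χ) :
    (∀ᵐ t ∂(volume.restrict (Set.Ioo 0 T)), ∫ x, f t x * χ x =
      (∫ x, f₀ x * χ x) + ∫ s in (0 : ℝ)..t, ∑ j, ∫ x, N j s x * pd j χ x) ∧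
    ∀ t ∈ Set.Ioo 0 T, ContinuousAt (fun s => ∫ x, f s x * χ x) t → ∫ x, f t x * χ x =
      (∫ x, f₀ x * χ x) + ∫ s in (0 : ℝ)..t, ∑ j, ∫ x, N j s x * pd j χ x := by
  refine eq_primitive_of_weak_deriv hT (integrableOn_pairing h.integrable hχ.continuous)
    (integrable_finsetSum _ fun j _ =>
      integrableOn_pairing (h.integrable_flux j) (hχ.continuous_pd j)) (fun θ hθ hs => ?_)
    (h.init χ hχ)
  refine Eq.trans ?_ (h.weak _ (isTest_mul hθ hs hχ))
  refine integral_congr_ae ?_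
  filter_upwards [h.integrable_slice, h.integrable_flux_slice] with t h1 h2
  have e1 : ∀ x, dt (fun t x => θ t * χ x) t x = deriv θ t * χ x := fun x => by
    simp only [dt]
    exact deriv_mul_const (hθ.differentiable (by simp) t) _
  have e2 : ∀ j x, pd j (fun x => θ t * χ x) x = θ t * pd j χ x := fun j x => by
    rw [((hχ.hasPD j).const_mul (θ t)).pd_eq]
  have i1 : Integrable fun x => f t x * χ x := by
    simpa only [mul_comm] using Continuous.integrable_mul_torus hχ.continuous h1
  have i2 : ∀ j, Integrable fun x => N j t x * pd j χ x := fun j => by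
    simpa only [mul_comm] using Continuous.integrable_mul_torus (hχ.continuous_pd j) (h2 j)
  simp only [e1, e2]
  rw [← integral_const_mul, ← integral_finsetSum _ (fun j _ => i2 j), ← integral_const_mul,
    ← integral_add (i1.const_mul _) ((integrable_finsetSum _ fun j _ => i2 j).const_mul _)]
  congr 1
  funext x
  rw [Finset.mul_sum]
  congr 1
  · ring
  · exact Finset.sum_congr rfl fun j _ => by ring

lemma pairing_kernel (hη : IsSmooth η) (t : ℝ) (x : Torus d) :
    (∫ y, f₀ y * η (x - y)) + ∫ s in (0 : ℝ)..t, ∑ j, ∫ y, N j s y * pd j (fun y => η (x - y)) y =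
      primitiveConv η f₀ N t x := by
  simp only [primitiveConv, conv_eq, hη.pd_sub_left x, mul_neg, integral_neg,
    Finset.sum_neg_distrib, mul_comm]

lemma continuous_primitiveConv (h : Balance T f N f₀) (hη : IsSmooth η) {t : ℝ}
    (ht : t ∈ Set.Icc 0 T) : Continuous (primitiveConv η f₀ N t) := by
  choose C hC0 hC using fun j => exists_bound_torus (hη.continuous_pd j)
  refine (continuous_conv hη.continuous h.integrable_init).add ?_
  simp only [intervalIntegral.integral_of_le ht.1, integral_Ioc_eq_integral_Ioo]
  have hsub : Set.Ioo 0 t ⊆ Set.Ioo 0 T := Set.Ioo_subset_Ioo_right ht.2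
  have hb : Integrable (fun s => ∑ j, C j * ∫ y, |N j s y|) (volume.restrict (Set.Ioo 0 t)) :=
    integrable_finsetSum _ fun j _ =>
      (((h.integrable_flux j).abs.integral_prod_left).mono_measure
        (Measure.restrict_mono hsub le_rfl)).const_mul _
  have hsl := ae_restrict_of_ae_restrict_of_subset hsub h.integrable_flux_slice
  refine continuous_of_dominated
    (fun x => ((h.integrableOn_rate hη x).mono_set hsub).aestronglyMeasurable)
    (fun x => ?_) hb ?_
  · filter_upwards [hsl] with s hs
    rw [norm_neg]
    exact (norm_sum_le _ _).trans
      (Finset.sum_le_sum fun j _ => abs_conv_le (hC j) (hs j) x)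
  · filter_upwards [hsl] with s hs
    exact (continuous_finsetSum _ fun j _ => continuous_conv (hη.continuous_pd j) (hs j)).neg

/-- For each x the identity fails on a null set of times depending on x. A countable dense set of
points and continuity in x give one null set for all points. -/
lemma ae_conv_eq (h : Balance T f N f₀) (hT : 0 < T) (hη : IsSmooth η) :
    ∀ᵐ t ∂(volume.restrict (Set.Ioo 0 T)), ∀ x, conv η (f t) x = primitiveConv η f₀ N t x := by
  have h1 : ∀ᵐ t ∂(volume.restrict (Set.Ioo 0 T)), ∀ k,
      conv η (f t) (TopologicalSpace.denseSeq (Torus d) k) =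
        primitiveConv η f₀ N t (TopologicalSpace.denseSeq (Torus d) k) := by
    refine ae_all_iff.2 fun k => ?_
    filter_upwards [(h.pairing_eq hT (hη.sub_left (TopologicalSpace.denseSeq (Torus d) k))).1]
      with t ht
    rw [pairing_kernel hη] at ht
    rw [← ht, conv_eq]
    simp only [mul_comm]
  filter_upwards [h1, h.integrable_slice, ae_restrict_mem measurableSet_Ioo] with t ht hi hm
  have := (TopologicalSpace.denseRange_denseSeq (Torus d)).equalizer
    (continuous_conv hη.continuous hi)
    (h.continuous_primitiveConv hη ⟨hm.1.le, hm.2.le⟩) (funext ht)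
  exact congrFun this

lemma conv_eq_of_continuousAt (h : Balance T f N f₀) (hT : 0 < T) (hη : IsSmooth η) {t : ℝ}
    (ht : t ∈ Set.Ioo 0 T)
    (hc : ∀ φ : Torus d → ℝ, IsSmooth φ → ContinuousAt (fun s => ∫ x, f s x * φ x) t)
    (x : Torus d) : conv η (f t) x = primitiveConv η f₀ N t x := by
  have := (h.pairing_eq hT (hη.sub_left x)).2 t ht (hc _ (hη.sub_left x))
  rw [pairing_kernel hη] at this
  rw [← this, conv_eq]
  simp only [mul_comm]

lemma tendsto_primitiveConv (h : Balance T f N f₀) (hη : IsSmooth η) {t : ℝ}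
    (ht : t ∈ Set.Ico 0 T) (x : Torus d) :
    Tendsto (fun s => primitiveConv η f₀ N s x) (𝓝[>] t) (𝓝 (primitiveConv η f₀ N t x)) :=
  (tendsto_primitive ht (h.integrableOn_rate hη x)).const_add _

end Balance

lemma primitiveConv_zero (η f₀ : Torus d → ℝ) (N : Fin d → ℝ → Torus d → ℝ) (x : Torus d) :
    primitiveConv η f₀ N 0 x = conv η f₀ x := by
  simp [primitiveConv]

/-! ### Measurability and integrability of averages in space-time -/

lemma ae_spaceTime_of_ae_time {T : ℝ} {P : ℝ → Prop}
    (h : ∀ᵐ t ∂(volume.restrict (Set.Ioo 0 T)), P t) : ∀ᵐ z ∂(spaceTime d T), P z.1 :=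
  Measure.quasiMeasurePreserving_fst.ae h

lemma spaceTime_mono {t T : ℝ} (h : t ≤ T) : spaceTime d t ≤ spaceTime d T :=
  Measure.prod_mono (Measure.restrict_mono (Set.Ioo_subset_Ioo_right h) le_rfl) le_rfl

lemma aestronglyMeasurable_conv {T : ℝ} {f : ℝ → Torus d → ℝ}
    (hf : AEStronglyMeasurable (Function.uncurry f) (spaceTime d T)) {K : Torus d → ℝ}
    (hK : Continuous K) :
    AEStronglyMeasurable (fun z : ℝ × Torus d => conv K (f z.1) z.2) (spaceTime d T) := by
  simp only [conv_eq]
  have hq : Measure.QuasiMeasurePreserving (fun q : (ℝ × Torus d) × Torus d => (q.1.1, q.2))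
      ((spaceTime d T).prod volume) (spaceTime d T) :=
    MeasureTheory.QuasiMeasurePreserving.prodMap
      (Measure.quasiMeasurePreserving_fst (μ := volume.restrict (Set.Ioo 0 T))
        (ν := (volume : Measure (Torus d)))) (.id volume)
  refine AEStronglyMeasurable.integral_prod_right'
    (f := fun q : (ℝ × Torus d) × Torus d => K (q.1.2 - q.2) * f q.1.1 q.2) ?_
  refine AEStronglyMeasurable.mul (Continuous.aestronglyMeasurable (by fun_prop)) ?_
  exact hf.comp_quasiMeasurePreserving hq

lemma integrable_uncurry_conv {T : ℝ} {f : ℝ → Torus d → ℝ}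
    (hf : Integrable (Function.uncurry f) (spaceTime d T)) {K : Torus d → ℝ}
    (hK : Continuous K) :
    Integrable (fun z : ℝ × Torus d => conv K (f z.1) z.2) (spaceTime d T) := by
  obtain ⟨C, -, hC⟩ := exists_bound_torus hK
  have h1 : Integrable (fun t => C * ∫ y, |f t y|) (volume.restrict (Set.Ioo 0 T)) :=
    (hf.abs.integral_prod_left).const_mul C
  refine (h1.comp_fst (volume : Measure (Torus d))).mono' (aestronglyMeasurable_conv hf.1 hK) ?_
  filter_upwards [ae_spaceTime_of_ae_time (d := d) hf.prod_right_ae] with z hz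
  exact abs_conv_le hC hz z.2

/-! ### Energy identity for the averaged evolution -/

/-- Density, momentum, velocity gradient and momentum flux evolving by the balance laws of mass and
momentum. -/
structure Evolution (T c₁ c₂ : ℝ) (ρ : ℝ → Torus d → ℝ) (w : Fin d → ℝ → Torus d → ℝ)
    (g N : Fin d → Fin d → ℝ → Torus d → ℝ) (ρ₀ : Torus d → ℝ) (m₀ : Fin d → Torus d → ℝ) :
    Prop where
  time_pos : 0 < T
  lower_pos : 0 < c₁
  meas : AEStronglyMeasurable (Function.uncurry ρ) (spaceTime d T)
  mass : Balance T ρ (fun j s x => ρ s x * w j s x) ρ₀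
  momentum : ∀ i, Balance T (fun s x => ρ s x * w i s x) (N i) (m₀ i)
  slice : ∀ᵐ s ∂(volume.restrict (Set.Ioo 0 T)),
    Slice c₁ c₂ (ρ s) (fun i => w i s) (fun i j => g i j s) (fun i j => N i j s)
  vel_bounded : ∃ M : ℝ, ∀ᵐ s ∂(volume.restrict (Set.Ioo 0 T)), ∀ i,
    eLpNorm (w i s) 2 volume ≤ ENNReal.ofReal M
  memLp_vel : ∀ i, MemLp (Function.uncurry (w i)) 4 (spaceTime d T)
  memLp_grad : ∀ i j, MemLp (Function.uncurry (g i j)) 2 (spaceTime d T)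
  memLp_flux : ∀ i j, MemLp (Function.uncurry (N i j)) 2 (spaceTime d T)

/-- A time at which the averaged density and momentum are the primitives of the averaged fluxes. -/
structure Regular (η : Torus d → ℝ) (ρ : ℝ → Torus d → ℝ) (w : Fin d → ℝ → Torus d → ℝ)
    (N : Fin d → Fin d → ℝ → Torus d → ℝ) (ρ₀ : Torus d → ℝ) (m₀ : Fin d → Torus d → ℝ)
    (t : ℝ) : Prop where
  density : ∀ x, conv η (ρ t) x = primitiveConv η ρ₀ (fun j s x => ρ s x * w j s x) t x
  momentum : ∀ i x, conv η (fun x => ρ t x * w i t x) x = primitiveConv η (m₀ i) (N i) t x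

/-- The total energy of a density and a momentum. -/
def totalEnergy (P : ℝ → ℝ) (r : Torus d → ℝ) (m : Fin d → Torus d → ℝ) : ℝ :=
  ∫ x, (∑ i, 1 / 2 * (m i x ^ 2 / r x) + P (r x))

namespace Evolution

variable {T c₁ c₂ C δ : ℝ} {ρ : ℝ → Torus d → ℝ} {w : Fin d → ℝ → Torus d → ℝ}
  {g N : Fin d → Fin d → ℝ → Torus d → ℝ} {ρ₀ : Torus d → ℝ} {m₀ : Fin d → Torus d → ℝ}
  {η : Torus d → ℝ}

lemma ae_regular (h : Evolution T c₁ c₂ ρ w g N ρ₀ m₀) (hη : IsSmooth η) :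
    ∀ᵐ t ∂(volume.restrict (Set.Ioo 0 T)), Regular η ρ w N ρ₀ m₀ t := by
  filter_upwards [h.mass.ae_conv_eq h.time_pos hη,
    eventually_all.2 fun i => (h.momentum i).ae_conv_eq h.time_pos hη] with t h1 h2
  exact ⟨h1, h2⟩

/-- The bounds hold at almost every time, where the primitive equals the averaged density; right
continuity extends them to every time. At t = 0 this bounds the averaged initial density. -/
lemma primitive_density_mem (h : Evolution T c₁ c₂ ρ w g N ρ₀ m₀) (hη : IsKernel C δ η) {t : ℝ}
    (ht : t ∈ Set.Ico 0 T) (x : Torus d) :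
    primitiveConv η ρ₀ (fun j s x => ρ s x * w j s x) t x ∈ Set.Icc c₁ c₂ := by
  refine isClosed_Icc.mem_of_frequently_of_tendsto ?_ (h.mass.tendsto_primitiveConv hη.smooth ht x)
  refine (frequently_nhdsGT_of_ae ht ((h.ae_regular hη.smooth).and h.slice)).mono ?_
  rintro s ⟨-, hs, hs'⟩
  rw [← hs.density]
  exact hη.conv_mem_bounds hs'.meas hs'.bounds x

/-- The same passage to all times, with lower semicontinuity of the L² norm under pointwise limits.
The bound depends neither on the kernel nor on the time. -/
lemma exists_primitive_momentum_le (h : Evolution T c₁ c₂ ρ w g N ρ₀ m₀) :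
    ∃ B : ℝ, ∀ {C δ : ℝ} {η : Torus d → ℝ}, IsKernel C δ η → ∀ t ∈ Set.Ico 0 T, ∀ i,
      eLpNorm (primitiveConv η (m₀ i) (N i) t) 2 volume ≤ ENNReal.ofReal B := by
  obtain ⟨M, hM⟩ := h.vel_bounded
  refine ⟨c₂ * M, fun {C δ η} hη t ht i => ?_⟩
  obtain ⟨s, hs, hsP⟩ := exists_seq_forall_of_frequently
    (frequently_nhdsGT_of_ae ht ((h.ae_regular hη.smooth).and (h.slice.and hM)))
  refine (Lp.eLpNorm_lim_le_liminf_eLpNorm (f := fun k => primitiveConv η (m₀ i) (N i) (s k))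
    (fun k => ((h.momentum i).continuous_primitiveConv hη.smooth
      (Set.Ioo_subset_Icc_self (hsP k).1)).aestronglyMeasurable) _
    (Eventually.of_forall fun x =>
      ((h.momentum i).tendsto_primitiveConv hη.smooth ht x).comp hs)).trans ?_
  refine (liminf_le_liminf (Eventually.of_forall fun k => ?_)).trans
    (liminf_const (ENNReal.ofReal (c₂ * M))).le
  obtain ⟨-, hr, hsl, hb⟩ := hsP k
  have e : primitiveConv η (m₀ i) (N i) (s k) = conv η (fun x => ρ (s k) x * w i (s k) x) :=
    funext fun x => (hr.momentum i x).symm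
  have hc : 0 ≤ c₂ := by
    obtain ⟨x, hx⟩ := hsl.bounds.exists
    exact h.lower_pos.le.trans (hx.1.trans hx.2)
  simp only [e]
  refine (hη.eLpNorm_conv_le ((hsl.integrable_mom h.lower_pos i).1) (by norm_num)
    (by norm_num)).trans ?_
  rw [ENNReal.ofReal_mul hc]
  refine le_trans (eLpNorm_le_mul_eLpNorm_of_ae_le_mul (hsl.bounds.mono fun x hx => ?_) 2)
    (mul_le_mul_right (hb i) _)
  rw [norm_mul, Real.norm_of_nonneg (h.lower_pos.le.trans hx.1)]
  exact mul_le_mul_of_nonneg_right hx.2 (norm_nonneg _)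

/-- For a fixed kernel the rates are integrable and their coefficients bounded. The bound on V
degenerates with the kernel, which is harmless: the lemma serves only Fubini and measurability in
time. -/
lemma integrable_energyRate (h : Evolution T c₁ c₂ ρ w g N ρ₀ m₀) (hη : IsKernel C δ η)
    {P₁ : ℝ → ℝ} (hP₁ : ContinuousOn P₁ (Set.Icc c₁ c₂)) :
    Integrable (fun z : ℝ × Torus d => energyRate P₁ η (ρ z.1) (fun i => w i z.1)
      (fun i j => N i j z.1) z.2) (spaceTime d T) := by
  have hη' := hη.smooth.continuous_pd
  have mR := aestronglyMeasurable_conv h.meas hη.continuous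
  have bR : ∀ᵐ z ∂(spaceTime d T), c₁ ≤ conv η (ρ z.1) z.2 ∧ conv η (ρ z.1) z.2 ≤ c₂ :=
    (ae_spaceTime_of_ae_time h.slice).mono fun z hz => hη.conv_mem_bounds hz.meas hz.bounds z.2
  have mV : ∀ i, AEStronglyMeasurable
      (fun z : ℝ × Torus d => favre η (ρ z.1) (w i z.1) z.2) (spaceTime d T) := fun i =>
    ((aestronglyMeasurable_conv (h.momentum i).integrable.1 hη.continuous).aemeasurable.div
      mR.aemeasurable).aestronglyMeasurable
  obtain ⟨K, hK0, hK⟩ := exists_bound_torus hη.continuous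
  obtain ⟨M, hM⟩ := h.vel_bounded
  have bV : ∀ i, ∀ᵐ z ∂(spaceTime d T),
      ‖favre η (ρ z.1) (w i z.1) z.2‖ ≤ K * (c₂ * max M 0) / c₁ := by
    intro i
    filter_upwards [bR, ae_spaceTime_of_ae_time (h.slice.and hM)] with z hR hz
    have hc := h.lower_pos
    have hR0 := hc.trans_le hR.1
    have hc₂ : 0 ≤ c₂ := hR0.le.trans hR.2
    rw [favre, norm_div, Real.norm_of_nonneg hR0.le]
    have h1 : ∫ y, |ρ z.1 y * w i z.1 y| ≤ c₂ * max M 0 := by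
      have e1 : Integrable (w i z.1) := (hz.1.memLp_vel i).integrable (by norm_num)
      have e2 : ∫ y, |w i z.1 y| ≤ max M 0 := by
        have e3 : ENNReal.ofReal (∫ y, |w i z.1 y|) ≤ ENNReal.ofReal M := by
          rw [ofReal_integral_eq_lintegral_ofReal e1.abs
            (Eventually.of_forall fun y => abs_nonneg _)]
          simp only [← Real.enorm_eq_ofReal_abs, ← eLpNorm_one_eq_lintegral_enorm]
          exact (eLpNorm_le_eLpNorm_of_exponent_le (by norm_num) e1.1).trans (hz.2 i)
        rcases le_total M 0 with hM0 | hM0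
        · rw [ENNReal.ofReal_of_nonpos hM0, nonpos_iff_eq_zero, ENNReal.ofReal_eq_zero] at e3
          exact e3.trans (le_max_right _ _)
        · exact ((ENNReal.ofReal_le_ofReal_iff hM0).1 e3).trans (le_max_left _ _)
      refine le_trans (integral_mono_ae (hz.1.integrable_mom hc i).abs (e1.abs.const_mul c₂)
        (hz.1.bounds.mono fun y hy => ?_)) ?_
      · simp only [abs_mul, abs_of_nonneg (hc.le.trans hy.1)]
        exact mul_le_mul_of_nonneg_right hy.2 (abs_nonneg _)
      · rw [integral_const_mul]
        exact mul_le_mul_of_nonneg_left e2 hc₂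
    gcongr
    · exact (abs_conv_le hK (hz.1.integrable_mom hc i) z.2).trans
        (mul_le_mul_of_nonneg_left h1 hK0)
    · exact hR.1
  have iA : Integrable (fun z : ℝ × Torus d => massRate η (ρ z.1) (fun i => w i z.1) z.2)
      (spaceTime d T) :=
    (integrable_finsetSum _ fun j _ =>
      integrable_uncurry_conv (h.mass.integrable_flux j) (hη' j)).neg
  have iB : ∀ i, Integrable (fun z : ℝ × Torus d => momRate η (fun i j => N i j z.1) i z.2)
      (spaceTime d T) := fun i =>
    (integrable_finsetSum _ fun j _ =>
      integrable_uncurry_conv ((h.momentum i).integrable_flux j) (hη' j)).neg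
  obtain ⟨L, -, hL⟩ := exists_bound_on_Icc hP₁
  refine Integrable.add (integrable_finsetSum _ fun i _ => ?_) ?_
  · refine ((iB i).bdd_mul (mV i) (bV i)).sub (iA.bdd_mul
      (c := 1 / 2 * (K * (c₂ * max M 0) / c₁) ^ 2)
      (((mV i).pow 2).const_mul (1 / 2 : ℝ)) ?_)
    filter_upwards [bV i] with z hz
    rw [norm_mul, norm_pow, Real.norm_of_nonneg (by norm_num : (0 : ℝ) ≤ 1 / 2)]
    gcongr
  · refine iA.bdd_mul (c := L) (aestronglyMeasurable_comp_of_continuousOn hP₁ mR bR) ?_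
    filter_upwards [bR] with z hz using hL _ hz.1 hz.2

/-- The chain rule in time at each fixed x, integrated over the torus and combined with Fubini and
the spatial identity `Slice.integral_energyRate`. -/
lemma energy_identity (h : Evolution T c₁ c₂ ρ w g N ρ₀ m₀) (hη : IsKernel C δ η)
    {p p' P P₁ : ℝ → ℝ} (hp : ∀ r, 0 < r → HasDerivAt p (p' r) r)
    (hp' : ContinuousOn p' (Set.Ioi 0)) (hP : ∀ r, 0 < r → HasDerivAt P (P₁ r) r)
    (hP₁ : ∀ r, 0 < r → HasDerivAt P₁ (p' r / r) r) {t : ℝ} (ht : t ∈ Set.Ioo 0 T)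
    (hreg : Regular η ρ w N ρ₀ m₀ t) :
    totalEnergy P (conv η (ρ t)) (fun i => conv η (fun x => ρ t x * w i t x)) -
      totalEnergy P (conv η ρ₀) (fun i => conv η (m₀ i)) =
      ∫ s in Set.Ioo 0 t, fluxWork p η (ρ s) (fun i => w i s) (fun i j => N i j s) := by
  have hc := h.lower_pos
  have hP₁c : ContinuousOn P₁ (Set.Ioi 0) := fun r hr =>
    (hP₁ r hr).continuousAt.continuousWithinAt
  have hsub : Set.Ioo 0 t ⊆ Set.Ioo 0 T := Set.Ioo_subset_Ioo_right ht.2.le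
  set R := primitiveConv η ρ₀ (fun j s x => ρ s x * w j s x) with hR
  set m := fun i => primitiveConv η (m₀ i) (N i) with hm
  have hpt : ∀ x, ∫ s in Set.Ioo 0 t, energyRate P₁ η (ρ s) (fun i => w i s)
      (fun i j => N i j s) x = (∑ i, 1 / 2 * (m i t x ^ 2 / R t x) + P (R t x)) -
        (∑ i, 1 / 2 * (m i 0 x ^ 2 / R 0 x) + P (R 0 x)) := by
    intro x
    have h1 := energy_chain_rule (d := d) ht.1.le hc hP hP₁c
      (a := fun s => -∑ j, conv (pd j η) (fun y => ρ s y * w j s y) x)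
      (b := fun i s => -∑ j, conv (pd j η) (N i j s) x) (R₀ := conv η ρ₀ x)
      (M₀ := fun i => conv η (m₀ i) x) (R := fun s => R s x) (M := fun i s => m i s x)
      (intervalIntegrable_of_Ioo ⟨ht.1.le, ht.2.le⟩ (h.mass.integrableOn_rate hη.smooth x))
      (fun i => intervalIntegrable_of_Ioo ⟨ht.1.le, ht.2.le⟩
        ((h.momentum i).integrableOn_rate hη.smooth x))
      (fun s => rfl) (fun i s => rfl)
      (fun s hs => (h.primitive_density_mem hη ⟨hs.1, hs.2.trans_lt ht.2⟩ x).1)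
    simp only [hR, hm, primitiveConv_zero]
    rw [← h1, intervalIntegral.integral_of_le ht.1.le, integral_Ioc_eq_integral_Ioo]
    refine integral_congr_ae ?_
    filter_upwards [ae_restrict_of_ae_restrict_of_subset hsub (h.ae_regular hη.smooth)] with s hs
    simp only [energyRate, favre, massRate, momRate, hs.density, hs.momentum, hR, hm]
  have hcont : ∀ s ∈ Set.Ico 0 T,
      Continuous fun x => ∑ i, 1 / 2 * (m i s x ^ 2 / R s x) + P (R s x) := by
    intro s hs
    have hs' : s ∈ Set.Icc 0 T := ⟨hs.1, hs.2.le⟩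
    have hR0 : ∀ x, 0 < R s x := fun x => hc.trans_le (h.primitive_density_mem hη hs x).1
    have cR := h.mass.continuous_primitiveConv hη.smooth hs'
    have cm := fun i => (h.momentum i).continuous_primitiveConv hη.smooth hs'
    refine (continuous_finsetSum _ fun i _ =>
      (((cm i).pow 2).div cR fun x => (hR0 x).ne').const_mul _).add ?_
    exact continuous_iff_continuousAt.2 fun x =>
      ((hP _ (hR0 x)).continuousAt).comp cR.continuousAt
  have hint : Integrable (fun z : ℝ × Torus d => energyRate P₁ η (ρ z.1) (fun i => w i z.1)
      (fun i j => N i j z.1) z.2) ((volume.restrict (Set.Ioo 0 t)).prod volume) :=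
    (h.integrable_energyRate hη (hP₁c.mono fun r hr => hc.trans_le hr.1)).mono_measure
      (spaceTime_mono ht.2.le)
  have hswap := integral_integral_swap (f := fun s x => energyRate P₁ η (ρ s) (fun i => w i s)
      (fun i j => N i j s) x) hint
  simp only [hpt] at hswap
  rw [integral_sub (Continuous.integrable_torus (hcont t ⟨ht.1.le, ht.2⟩))
    (Continuous.integrable_torus (hcont 0 ⟨le_rfl, h.time_pos⟩))] at hswap
  simp only [totalEnergy, hreg.density, hreg.momentum]
  simp only [hR, hm, primitiveConv_zero] at hswap
  rw [← hswap]
  refine integral_congr_ae ?_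
  filter_upwards [ae_restrict_of_ae_restrict_of_subset hsub h.slice] with s hs
  exact hs.integral_energyRate hη hc hp hp' hP₁

end Evolution

/-! ### Convergence of the averaged energy -/

/-- Finite-energy states: densities between two bounds and square integrable momenta. -/
structure State (c₁ c₂ : ℝ) (r : Torus d → ℝ) (m : Fin d → Torus d → ℝ) : Prop where
  meas : AEStronglyMeasurable r
  bounds : ∀ᵐ x, c₁ ≤ r x ∧ r x ≤ c₂
  memLp : ∀ i, MemLp (m i) 2

lemma Mollifier.exists_subseq_ae_tendsto {C : ℝ} {δ : ℕ → ℝ} {η : ℕ → Torus d → ℝ}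
    (hη : Mollifier C δ η) {f : Torus d → ℝ} (hf : Integrable f) :
    ∃ ns : ℕ → ℕ, ∀ᵐ x, Tendsto (fun k => conv (η (ns k)) f x) atTop (𝓝 (f x)) := by
  obtain ⟨ns, -, hns⟩ := (tendstoInMeasure_of_tendsto_eLpNorm (p := 1) (by norm_num)
    (fun n => (continuous_conv (hη.kernel n).continuous hf).aestronglyMeasurable) hf.1
    (hη.tendsto_conv le_rfl (by norm_num) (memLp_one_iff_integrable.2 hf))).exists_seq_tendsto_ae
  exact ⟨ns, hns⟩

/-- Uniform bounds on the averages pass to their almost everywhere limits along subsequences. This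
upgrades mere integrability of density and momentum at a single time to finite energy. -/
lemma Mollifier.state {C : ℝ} {δ : ℕ → ℝ} {η : ℕ → Torus d → ℝ} (hη : Mollifier C δ η)
    {c₁ c₂ B : ℝ} {r : Torus d → ℝ} {m : Fin d → Torus d → ℝ} (hr : Integrable r)
    (hm : ∀ i, Integrable (m i)) (hR : ∀ n x, conv (η n) r x ∈ Set.Icc c₁ c₂)
    (hM : ∀ n i, eLpNorm (conv (η n) (m i)) 2 volume ≤ ENNReal.ofReal B) : State c₁ c₂ r m where
  meas := hr.1
  bounds := by
    obtain ⟨ns, hns⟩ := hη.exists_subseq_ae_tendsto hr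
    filter_upwards [hns] with x hx
    exact isClosed_Icc.mem_of_tendsto hx (Eventually.of_forall fun k => hR _ x)
  memLp i := by
    obtain ⟨ns, hns⟩ := hη.exists_subseq_ae_tendsto (hm i)
    refine ⟨(hm i).1, ((Lp.eLpNorm_lim_le_liminf_eLpNorm
      (f := fun k => conv (η (ns k)) (m i)) (fun k => (continuous_conv
        (hη.kernel _).continuous (hm i)).aestronglyMeasurable) _ hns).trans
      ((liminf_le_liminf (Eventually.of_forall fun k => hM _ i)).trans
        (liminf_const (ENNReal.ofReal B)).le)).trans_lt ENNReal.ofReal_lt_top⟩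

lemma totalEnergy_eq {P : ℝ → ℝ} {r : Torus d → ℝ} {m : Fin d → Torus d → ℝ}
    (hm : ∀ i, Integrable fun x => m i x ^ 2 / r x) (hP : Integrable fun x => P (r x)) :
    totalEnergy P r m = ∑ i, 1 / 2 * (∫ x, m i x ^ 2 / r x) + ∫ x, P (r x) := by
  rw [totalEnergy, integral_add (integrable_finsetSum _ fun i _ => (hm i).const_mul _) hP,
    integral_finsetSum _ fun i _ => (hm i).const_mul _]
  simp only [integral_const_mul]

namespace State

variable {c₁ c₂ : ℝ} {r : Torus d → ℝ} {m : Fin d → Torus d → ℝ}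

lemma memLp_vel (h : State c₁ c₂ r m) (hc₁ : 0 < c₁) (i : Fin d) :
    MemLp (fun x => m i x / r x) 2 := by
  refine (h.memLp i).of_le_mul (c := c₁⁻¹)
    ((h.memLp i).1.aemeasurable.div h.meas.aemeasurable).aestronglyMeasurable ?_
  filter_upwards [h.bounds] with x hx
  rw [norm_div, Real.norm_of_nonneg (hc₁.le.trans hx.1), div_eq_inv_mul]
  gcongr
  exact hx.1

lemma integrable_kinetic (h : State c₁ c₂ r m) (hc₁ : 0 < c₁) (i : Fin d) :
    Integrable fun x => m i x ^ 2 / r x := by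
  have := (h.memLp i).integrable_mul (h.memLp_vel hc₁ i)
  refine this.congr (Eventually.of_forall fun x => ?_)
  simp only [Pi.mul_apply]
  ring

lemma integrable_comp (h : State c₁ c₂ r m) {P : ℝ → ℝ} (hP : ContinuousOn P (Set.Icc c₁ c₂)) :
    Integrable fun x => P (r x) :=
  memLp_one_iff_integrable.1 (memLp_comp_of_continuousOn hP h.meas h.bounds 1)

lemma integrable_energy (h : State c₁ c₂ r m) (hc₁ : 0 < c₁) {P : ℝ → ℝ}
    (hP : ContinuousOn P (Set.Icc c₁ c₂)) :
    Integrable fun x => ∑ i, 1 / 2 * (m i x ^ 2 / r x) + P (r x) :=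
  (integrable_finsetSum _ fun i _ => (h.integrable_kinetic hc₁ i).const_mul _).add
    (h.integrable_comp hP)

/-- The kinetic energy is the product of M and M/R. The second factor is the Favre average of m/r,
so both converge in L² and their product in L¹. -/
lemma tendsto_totalEnergy (h : State c₁ c₂ r m) (hc₁ : 0 < c₁) {C : ℝ} {δ : ℕ → ℝ}
    {η : ℕ → Torus d → ℝ} (hη : Mollifier C δ η) {P : ℝ → ℝ} {L : ℝ≥0}
    (hP : LipschitzOnWith L P (Set.Icc c₁ c₂)) :
    Tendsto (fun n => totalEnergy P (conv (η n) r) (fun i => conv (η n) (m i))) atTop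
      (𝓝 (totalEnergy P r m)) := by
  have hr := integrable_of_bounds h.meas h.bounds
  have cR := fun n => continuous_conv (hη.kernel n).continuous hr
  have bR := fun n => (hη.kernel n).conv_mem_bounds h.meas h.bounds
  have cM := fun n i => continuous_conv (hη.kernel n).continuous
    ((h.memLp i).integrable (by norm_num))
  have cK : ∀ n i, Continuous fun x => conv (η n) (m i) x ^ 2 / conv (η n) r x := fun n i =>
    ((cM n i).pow 2).div (cR n) fun x => (hc₁.trans_le (bR n x).1).ne'
  have cP : ∀ n, Continuous fun x => P (conv (η n) r x) := fun n =>
    hP.continuousOn.comp_continuous (cR n) (bR n)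
  rw [totalEnergy_eq (h.integrable_kinetic hc₁) (h.integrable_comp hP.continuousOn)]
  simp only [fun n => totalEnergy_eq (fun i => Continuous.integrable_torus (cK n i))
    (Continuous.integrable_torus (cP n))]
  refine (tendsto_finsetSum _ fun i _ => Tendsto.const_mul _ ?_).add ?_
  · have hmw : ∀ᵐ x, r x * (m i x / r x) = m i x := by
      filter_upwards [h.bounds] with x hx
      rw [mul_div_cancel₀ _ (hc₁.trans_le hx.1).ne']
    have hfav : ∀ n x, favre (η n) r (fun x => m i x / r x) x =
        conv (η n) (m i) x / conv (η n) r x := fun n x => by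
      rw [favre, conv_congr_ae hmw]
    have hV := hη.tendsto_favre hc₁ h.meas h.bounds (by norm_num) (by norm_num)
      (h.memLp_vel hc₁ i)
    simp only [hfav] at hV
    have hM := hη.tendsto_conv (p := 2) (by norm_num) (by norm_num) (h.memLp i)
    have := tendsto_eLpNorm_mul (p := 1) le_rfl (h.memLp i) (h.memLp_vel hc₁ i)
      (fun n => (cM n i).aestronglyMeasurable)
      (fun n => ((cM n i).div (cR n)
        fun x => (hc₁.trans_le (bR n x).1).ne').aestronglyMeasurable) hM hV
    refine tendsto_integral_of_eLpNorm_one (h.integrable_kinetic hc₁ i)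
      (fun n => Continuous.integrable_torus (cK n i)) (this.congr fun n => ?_)
    congr 1
    funext x
    rw [Pi.div_apply]
    ring
  · exact tendsto_integral_of_eLpNorm_one (h.integrable_comp hP.continuousOn)
      (fun n => Continuous.integrable_torus (cP n))
      (hη.tendsto_comp hP h.meas h.bounds le_rfl (by norm_num))

end State

/-! ### Passage to the limit in the time integral -/

lemma memLp_eLpNorm_slice {T : ℝ} {f : ℝ → Torus d → ℝ} {q : ℝ≥0∞} (hq0 : q ≠ 0) (hq : q ≠ ⊤)
    (hf : MemLp (Function.uncurry f) q (spaceTime d T)) :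
    MemLp (fun s => (eLpNorm (f s) q volume).toReal) q (volume.restrict (Set.Ioo 0 T)) := by
  have hm : AEMeasurable (fun z : ℝ × Torus d => ‖f z.1 z.2‖ₑ ^ q.toReal) (spaceTime d T) :=
    hf.1.enorm.pow_const _
  have hm' : AEMeasurable (fun s => ∫⁻ x, ‖f s x‖ₑ ^ q.toReal) (volume.restrict (Set.Ioo 0 T)) :=
    hm.lintegral_prod_right'
  have hn : ∀ s, eLpNorm (f s) q volume = (∫⁻ x, ‖f s x‖ₑ ^ q.toReal) ^ (1 / q.toReal) :=
    fun s => eLpNorm_eq_lintegral_rpow_enorm_toReal hq0 hq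
  have hq' := ENNReal.toReal_pos hq0 hq
  refine ⟨?_, ?_⟩
  · simp only [hn]
    exact (hm'.pow_const _).ennreal_toReal.aestronglyMeasurable
  · rw [eLpNorm_lt_top_iff_lintegral_rpow_enorm_lt_top hq0 hq]
    have h1 := (eLpNorm_lt_top_iff_lintegral_rpow_enorm_lt_top hq0 hq).1 hf.2
    rw [spaceTime, lintegral_prod (fun z => ‖Function.uncurry f z‖ₑ ^ q.toReal) hm] at h1
    refine (lintegral_mono fun s => ?_).trans_lt h1
    calc ‖(eLpNorm (f s) q volume).toReal‖ₑ ^ q.toReal ≤ eLpNorm (f s) q volume ^ q.toReal := by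
          gcongr
          rw [Real.enorm_of_nonneg ENNReal.toReal_nonneg]
          exact ENNReal.ofReal_toReal_le
      _ = _ := by
          rw [hn, ← ENNReal.rpow_mul, one_div, inv_mul_cancel₀ hq'.ne', ENNReal.rpow_one]
          rfl

lemma Slice.abs_fluxWork_le {C δ c₁ c₂ : ℝ} {ρ : Torus d → ℝ} {w : Fin d → Torus d → ℝ}
    {g N : Fin d → Fin d → Torus d → ℝ} {p : ℝ → ℝ} {η : Torus d → ℝ} (h : Slice c₁ c₂ ρ w g N)
    (hη : IsKernel C δ η) (hC : 0 ≤ C) (hδ : 0 < δ) (hc₁ : 0 < c₁)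
    (hp : ContinuousOn p (Set.Icc c₁ c₂)) {K : ℝ} (hK0 : 0 ≤ K)
    (hK : ∀ r, c₁ ≤ r → r ≤ c₂ → |p r| ≤ K) :
    |fluxWork p η ρ w N| ≤ ∑ i, ∑ j, ((eLpNorm (N i j) 2 volume).toReal +
      c₂ * (c₂ / c₁) * ((eLpNorm (w j) 4 volume).toReal * (eLpNorm (w i) 4 volume).toReal) + K) *
      (c₂ ^ 2 / c₁ ^ 2 * (2 * C) * ∑ k, (eLpNorm (g i k) 2 volume).toReal) := by
  have hc₂ : 0 ≤ c₂ := by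
    obtain ⟨x, hx⟩ := h.bounds.exists
    exact hc₁.le.trans (hx.1.trans hx.2)
  have h1 := h.enorm_fluxWork_le hη hC hδ hc₁ hp hK0 hK
  have eN := fun i j => (ENNReal.ofReal_toReal (h.memLp_flux i j).eLpNorm_ne_top).symm
  have eg := fun i j => (ENNReal.ofReal_toReal (h.memLp_grad i j).eLpNorm_ne_top).symm
  have ew := fun i => (ENNReal.ofReal_toReal (h.memLp_vel i).eLpNorm_ne_top).symm
  have n0 := fun i j => ENNReal.toReal_nonneg (a := eLpNorm (N i j) 2 volume)
  have g0 := fun i j => ENNReal.toReal_nonneg (a := eLpNorm (g i j) 2 volume)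
  have a0 := fun i => ENNReal.toReal_nonneg (a := eLpNorm (w i) 4 volume)
  generalize hn : (fun i j => (eLpNorm (N i j) 2 volume).toReal) = n at *
  generalize hγ : (fun i j => (eLpNorm (g i j) 2 volume).toReal) = γ at *
  generalize ha : (fun i => (eLpNorm (w i) 4 volume).toReal) = a at *
  simp only [funext_iff] at hn hγ ha
  simp only [hn, hγ, ha] at *
  simp only [eN, eg, ew] at h1
  have s0 : ∀ i, 0 ≤ ∑ k, γ i k := fun i => Finset.sum_nonneg fun k _ => g0 i k
  have x0 : ∀ i j, 0 ≤ n i j + c₂ * (c₂ / c₁) * (a j * a i) + K := fun i j => by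
    have := n0 i j; have := a0 i; have := a0 j
    positivity
  have t0 : ∀ i j, 0 ≤ (n i j + c₂ * (c₂ / c₁) * (a j * a i) + K) *
      (c₂ ^ 2 / c₁ ^ 2 * (2 * C) * ∑ k, γ i k) := fun i j =>
    mul_nonneg (x0 i j) (mul_nonneg (by positivity) (s0 i))
  rw [← ENNReal.ofReal_le_ofReal_iff (Finset.sum_nonneg fun i _ => Finset.sum_nonneg fun j _ =>
    t0 i j), ← Real.enorm_eq_ofReal_abs,
    ENNReal.ofReal_sum_of_nonneg fun i _ => Finset.sum_nonneg fun j _ => t0 i j]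
  refine h1.trans (Finset.sum_le_sum fun i _ => ?_)
  rw [ENNReal.ofReal_sum_of_nonneg fun j _ => t0 i j]
  refine Finset.sum_le_sum fun j _ => le_of_eq ?_
  have := n0 i j; have := a0 i; have := a0 j
  rw [ENNReal.ofReal_mul (x0 i j),
    ENNReal.ofReal_mul (show 0 ≤ c₂ ^ 2 / c₁ ^ 2 * (2 * C) by positivity),
    ENNReal.ofReal_sum_of_nonneg fun k _ => g0 i k,
    ENNReal.ofReal_add (by positivity) hK0, ENNReal.ofReal_add (by positivity) (by positivity),
    show c₂ * (c₂ / c₁) * (a j * a i) = c₂ * a j * (c₂ / c₁ * a i) by ring,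
    ENNReal.ofReal_mul (show 0 ≤ c₂ * a j by positivity), ENNReal.ofReal_mul hc₂,
    ENNReal.ofReal_mul (show 0 ≤ c₂ / c₁ by positivity)]

namespace Evolution

variable {T c₁ c₂ C : ℝ} {ρ : ℝ → Torus d → ℝ} {w : Fin d → ℝ → Torus d → ℝ}
  {g N : Fin d → Fin d → ℝ → Torus d → ℝ} {ρ₀ : Torus d → ℝ} {m₀ : Fin d → Torus d → ℝ}
  {δ : ℕ → ℝ} {η : ℕ → Torus d → ℝ}

lemma state_init (h : Evolution T c₁ c₂ ρ w g N ρ₀ m₀) (hη : Mollifier C δ η) :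
    State c₁ c₂ ρ₀ m₀ := by
  obtain ⟨B, hB⟩ := h.exists_primitive_momentum_le
  have h0 : (0 : ℝ) ∈ Set.Ico 0 T := ⟨le_rfl, h.time_pos⟩
  refine hη.state h.mass.integrable_init (fun i => (h.momentum i).integrable_init)
    (B := B) (fun n x => ?_) (fun n i => ?_)
  · have := h.primitive_density_mem (hη.kernel n) h0 x
    rwa [primitiveConv_zero] at this
  · have := hB (hη.kernel n) 0 h0 i
    rwa [funext (primitiveConv_zero (η n) (m₀ i) (N i))] at this

lemma state (h : Evolution T c₁ c₂ ρ w g N ρ₀ m₀) (hη : Mollifier C δ η) {t : ℝ}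
    (ht : t ∈ Set.Ioo 0 T) (hreg : ∀ n, Regular (η n) ρ w N ρ₀ m₀ t) (hr : Integrable (ρ t))
    (hm : ∀ i, Integrable fun x => ρ t x * w i t x) :
    State c₁ c₂ (ρ t) (fun i x => ρ t x * w i t x) := by
  obtain ⟨B, hB⟩ := h.exists_primitive_momentum_le
  have h0 : t ∈ Set.Ico 0 T := ⟨ht.1.le, ht.2⟩
  refine hη.state hr hm (B := B) (fun n x => ?_) (fun n i => ?_)
  · rw [(hreg n).density]
    exact h.primitive_density_mem (hη.kernel n) h0 x
  · rw [funext ((hreg n).momentum i)]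
    exact hB (hη.kernel n) t h0 i

lemma tendsto_integral_fluxWork (h : Evolution T c₁ c₂ ρ w g N ρ₀ m₀) (hη : Mollifier C δ η)
    {p p' P₁ : ℝ → ℝ} (hp : ∀ r, 0 < r → HasDerivAt p (p' r) r)
    (hp' : ContinuousOn p' (Set.Ioi 0)) (hP₁ : ∀ r, 0 < r → HasDerivAt P₁ (p' r / r) r)
    {t : ℝ} (ht : t ≤ T) :
    Tendsto (fun n => ∫ s in Set.Ioo 0 t, fluxWork p (η n) (ρ s) (fun i => w i s)
      (fun i j => N i j s)) atTop (𝓝 (∫ s in Set.Ioo 0 t, ∑ i, ∑ j, ∫ x,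
        (N i j s x - ρ s x * w j s x * w i s x - if i = j then p (ρ s x) else 0) *
          g i j s x)) := by
  have hc := h.lower_pos
  have hIcc : Set.Icc c₁ c₂ ⊆ Set.Ioi 0 := fun r hr => hc.trans_le hr.1
  obtain ⟨L, hL⟩ := exists_lipschitzOnWith_of_hasDerivAt (fun r hr => hp r (hIcc hr))
    (hp'.mono hIcc)
  obtain ⟨K, hK0, hK⟩ := exists_bound_on_Icc hL.continuousOn
  have hsub : Set.Ioo 0 t ⊆ Set.Ioo 0 T := Set.Ioo_subset_Ioo_right ht
  have hsl := ae_restrict_of_ae_restrict_of_subset hsub h.slice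
  have hle := Measure.restrict_mono hsub (le_rfl : (volume : Measure ℝ) ≤ volume)
  set n₂ : Fin d → Fin d → ℝ → ℝ := fun i j s => (eLpNorm (N i j s) 2 volume).toReal with hn₂
  set g₂ : Fin d → Fin d → ℝ → ℝ := fun i j s => (eLpNorm (g i j s) 2 volume).toReal with hg₂
  set a₄ : Fin d → ℝ → ℝ := fun i s => (eLpNorm (w i s) 4 volume).toReal with ha₄
  have mn : ∀ i j, MemLp (n₂ i j) 2 (volume.restrict (Set.Ioo 0 t)) := fun i j =>
    (memLp_eLpNorm_slice (by norm_num) (by norm_num) (h.memLp_flux i j)).mono_measure hle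
  have mg : ∀ i j, MemLp (g₂ i j) 2 (volume.restrict (Set.Ioo 0 t)) := fun i j =>
    (memLp_eLpNorm_slice (by norm_num) (by norm_num) (h.memLp_grad i j)).mono_measure hle
  have ma : ∀ i, MemLp (a₄ i) 4 (volume.restrict (Set.Ioo 0 t)) := fun i =>
    (memLp_eLpNorm_slice (by norm_num) (by norm_num) (h.memLp_vel i)).mono_measure hle
  have maa : ∀ i j, MemLp (fun s => a₄ j s * a₄ i s) 2 (volume.restrict (Set.Ioo 0 t)) :=
    fun i j => by
      have := holderTriple_four_four_two
      exact (ma i).mul (ma j)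
  set c := c₂ ^ 2 / c₁ ^ 2 * (2 * C) with hcdef
  -- In each summand both factors are square integrable in time; for the product of velocity norms
  -- this is where L⁴ in time is used.
  have hb : Integrable (fun s => ∑ i, ∑ j, (n₂ i j s + c₂ * (c₂ / c₁) * (a₄ j s * a₄ i s) + K) *
      (c * ∑ k, g₂ i k s)) (volume.restrict (Set.Ioo 0 t)) := by
    refine integrable_finsetSum _ fun i _ => integrable_finsetSum _ fun j _ => ?_
    exact MemLp.integrable_mul (((mn i j).add ((maa i j).const_mul _)).add (memLp_const K))
      ((memLp_finsetSum _ fun k _ => mg i k).const_mul c)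
  refine tendsto_integral_of_dominated_convergence _ (fun n => ?_) hb (fun n => ?_) ?_
  -- Measurability in time of the flux work is inherited from the spatial integral of the energy
  -- rate, to which it is equal.
  · have := ((h.integrable_energyRate (hη.kernel n)
      (fun r hr => (hP₁ r (hIcc hr)).continuousAt.continuousWithinAt)).mono_measure
      (spaceTime_mono ht)).integral_prod_left.aestronglyMeasurable
    refine this.congr ?_
    filter_upwards [hsl] with s hs
    exact hs.integral_energyRate (hη.kernel n) hc hp hp' hP₁
  · filter_upwards [hsl] with s hs
    exact hs.abs_fluxWork_le (hη.kernel n) hη.const_nonneg (hη.pos n) hc hL.continuousOn hK0 hK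
  · filter_upwards [hsl] with s hs
    exact hs.tendsto_fluxWork hη hc hL

theorem totalEnergy_sub (h : Evolution T c₁ c₂ ρ w g N ρ₀ m₀) (hη : Mollifier C δ η)
    {p p' P P₁ : ℝ → ℝ} (hp : ∀ r, 0 < r → HasDerivAt p (p' r) r)
    (hp' : ContinuousOn p' (Set.Ioi 0)) (hP : ∀ r, 0 < r → HasDerivAt P (P₁ r) r)
    (hP₁ : ∀ r, 0 < r → HasDerivAt P₁ (p' r / r) r) {t : ℝ} (ht : t ∈ Set.Ioo 0 T)
    (hreg : ∀ n, Regular (η n) ρ w N ρ₀ m₀ t) (hr : Integrable (ρ t))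
    (hm : ∀ i, Integrable fun x => ρ t x * w i t x) :
    totalEnergy P (ρ t) (fun i x => ρ t x * w i t x) - totalEnergy P ρ₀ m₀ =
      ∫ s in Set.Ioo 0 t, ∑ i, ∑ j, ∫ x,
        (N i j s x - ρ s x * w j s x * w i s x - if i = j then p (ρ s x) else 0) *
          g i j s x := by
  have hIcc : Set.Icc c₁ c₂ ⊆ Set.Ioi 0 := fun r hr => h.lower_pos.trans_le hr.1
  obtain ⟨L, hL⟩ := exists_lipschitzOnWith_of_hasDerivAt (fun r hr => hP r (hIcc hr))
    (fun r hr => (hP₁ r (hIcc hr)).continuousAt.continuousWithinAt)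
  have h1 := ((h.state hη ht hreg hr hm).tendsto_totalEnergy h.lower_pos hη hL).sub
    ((h.state_init hη).tendsto_totalEnergy h.lower_pos hη hL)
  simp only [fun n => h.energy_identity (hη.kernel n) hp hp' hP hP₁ ht (hreg n)] at h1
  exact tendsto_nhds_unique h1 (h.tendsto_integral_fluxWork hη hp hp' hP₁ ht.2.le)

end Evolution

/-! ### The pressure potential -/

section Pressure

variable {p : ℝ → ℝ}

/-- The derivative of the pressure potential. -/
def pressurePotentialDeriv (p : ℝ → ℝ) (r : ℝ) : ℝ := (∫ z in (1 : ℝ)..r, p z / z ^ 2) + p r / r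

lemma hasDerivAt_integral_pressure (hp : ContinuousOn p (Set.Ioi 0)) {r : ℝ} (hr : 0 < r) :
    HasDerivAt (fun r => ∫ z in (1 : ℝ)..r, p z / z ^ 2) (p r / r ^ 2) r := by
  have hc : ContinuousOn (fun z => p z / z ^ 2) (Set.Ioi 0) :=
    hp.div (by fun_prop) fun z hz => pow_ne_zero 2 (ne_of_gt hz)
  refine intervalIntegral.integral_hasDerivAt_right
    (hc.mono fun z hz => ?_).intervalIntegrable
    (hc.stronglyMeasurableAtFilter isOpen_Ioi r hr) (hc.continuousAt (Ioi_mem_nhds hr))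
  exact (lt_min one_pos hr).trans_le hz.1

lemma hasDerivAt_pressurePotential (hp : ContinuousOn p (Set.Ioi 0)) {r : ℝ} (hr : 0 < r) :
    HasDerivAt (pressurePotential p) (pressurePotentialDeriv p r) r := by
  refine ((hasDerivAt_id r).mul (hasDerivAt_integral_pressure hp hr)).congr_deriv ?_
  simp only [pressurePotentialDeriv, id]
  field_simp

lemma hasDerivAt_pressurePotentialDeriv {p' : ℝ → ℝ} (hp : ∀ r, 0 < r → HasDerivAt p (p' r) r)
    {r : ℝ} (hr : 0 < r) : HasDerivAt (pressurePotentialDeriv p) (p' r / r) r := by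
  have hc : ContinuousOn p (Set.Ioi 0) := fun r hr => (hp r hr).continuousAt.continuousWithinAt
  refine ((hasDerivAt_integral_pressure hc hr).add
    ((hp r hr).div (hasDerivAt_id r) hr.ne')).congr_deriv ?_
  simp only [id]
  field_simp
  ring

end Pressure

/-! ### Time slices and the two-dimensional fourth-power bound -/

instance (T : ℝ) : IsFiniteMeasure (spaceTime d T) := by unfold spaceTime; infer_instance

lemma MemLp.coord {X : Type*} [MeasurableSpace X] {μ : Measure X} {f : X → Vec d} {q : ℝ≥0∞}
    (hf : MemLp f q μ) (i : Fin d) : MemLp (fun x => f x i) q μ :=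
  (EuclideanSpace.proj (𝕜 := ℝ) i).comp_memLp' hf

lemma ae_memLp_slice {T : ℝ} {f : ℝ → Torus d → ℝ} {q : ℝ≥0∞} (hq1 : 1 ≤ q) (hq : q ≠ ⊤)
    (hf : MemLp (Function.uncurry f) q (spaceTime d T)) :
    ∀ᵐ s ∂(volume.restrict (Set.Ioo 0 T)), MemLp (f s) q := by
  have hq0 : q ≠ 0 := (one_pos.trans_le hq1).ne'
  have hm : AEMeasurable (fun z : ℝ × Torus d => ‖f z.1 z.2‖ₑ ^ q.toReal) (spaceTime d T) :=
    hf.1.enorm.pow_const _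
  have hm' : AEMeasurable (fun s => ∫⁻ x, ‖f s x‖ₑ ^ q.toReal) (volume.restrict (Set.Ioo 0 T)) :=
    hm.lintegral_prod_right'
  have h1 := (eLpNorm_lt_top_iff_lintegral_rpow_enorm_lt_top hq0 hq).1 hf.2
  rw [spaceTime, lintegral_prod (fun z => ‖Function.uncurry f z‖ₑ ^ q.toReal) hm] at h1
  filter_upwards [(hf.integrable hq1).prod_right_ae, ae_lt_top' hm' h1.ne] with s hs hs'
  exact ⟨hs.1, (eLpNorm_lt_top_iff_lintegral_rpow_enorm_lt_top hq0 hq).2 hs'⟩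

/-- With the L² norm of f bounded in time, the right-hand side of Ladyzhenskaya's inequality is a
product of two factors affine in the norms of the partial derivatives, each square integrable in
time. -/
lemma memLp_four_of_ladyzhenskaya {T M : ℝ} {f : ℝ → Torus 2 → ℝ} {g : Fin 2 → ℝ → Torus 2 → ℝ}
    (hf : MemLp (Function.uncurry f) 2 (spaceTime 2 T))
    (hg : ∀ j, MemLp (Function.uncurry (g j)) 2 (spaceTime 2 T))
    (hw : ∀ᵐ s ∂(volume.restrict (Set.Ioo 0 T)), ∀ j, HasWeakPD j (f s) (g j s))
    (hM : ∀ᵐ s ∂(volume.restrict (Set.Ioo 0 T)), eLpNorm (f s) 2 volume ≤ ENNReal.ofReal M) :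
    MemLp (Function.uncurry f) 4 (spaceTime 2 T) := by
  refine ⟨hf.1, ?_⟩
  have hm : AEMeasurable (fun z : ℝ × Torus 2 => ‖f z.1 z.2‖ₑ ^ 4) (spaceTime 2 T) :=
    hf.1.enorm.pow_const _
  have hfin : ∫⁻ z, ‖Function.uncurry f z‖ₑ ^ 4 ∂(spaceTime 2 T) < ⊤ := by
    rw [spaceTime, lintegral_prod (fun z => ‖Function.uncurry f z‖ₑ ^ 4) hm]
    obtain ⟨b, hbd⟩ : ∃ b : Fin 2 → ℝ → ℝ, ∀ j s, b j s =
        max M 0 ^ 2 + 2 * (max M 0 * (eLpNorm (g j s) 2 volume).toReal) := ⟨_, fun _ _ => rfl⟩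
    have hb : ∀ j, MemLp (b j) 2 (volume.restrict (Set.Ioo 0 T)) := fun j => by
      have h1 := memLp_eLpNorm_slice (q := 2) two_ne_zero ENNReal.ofNat_ne_top (hg j)
      rw [funext (hbd j)]
      exact MemLp.add (memLp_const (max M 0 ^ 2)) ((h1.const_mul (max M 0)).const_mul 2)
    have hI : Integrable (fun s => b 0 s * b 1 s) (volume.restrict (Set.Ioo 0 T)) :=
      (hb 0).integrable_mul (hb 1)
    refine lt_of_le_of_lt (lintegral_mono_ae ?_) hI.lintegral_lt_top
    filter_upwards [hw, hM, ae_memLp_slice (by norm_num) (by norm_num) hf,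
      eventually_all.2 fun j => ae_memLp_slice (by norm_num) (by norm_num) (hg j)]
      with s h1 h2 h3 h4
    have h2' : eLpNorm (f s) 2 volume ≤ ENNReal.ofReal (max M 0) :=
      h2.trans (ENNReal.ofReal_le_ofReal (le_max_left _ _))
    have hM0 : 0 ≤ max M 0 := le_max_right _ _
    have e : ∀ j, ENNReal.ofReal (b j s) = ENNReal.ofReal (max M 0) ^ 2 +
        2 * (ENNReal.ofReal (max M 0) * eLpNorm (g j s) 2 volume) := fun j => by
      rw [hbd, ENNReal.ofReal_add (by positivity) (by positivity), ENNReal.ofReal_pow hM0,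
        ENNReal.ofReal_mul (by norm_num), ENNReal.ofReal_mul hM0,
        ENNReal.ofReal_toReal (h4 j).eLpNorm_ne_top]
      simp
    have hb0 : 0 ≤ b 0 s := by rw [hbd]; positivity
    rw [ENNReal.ofReal_mul hb0, e, e]
    refine (ladyzhenskaya h1 h3 h4).trans ?_
    rw [Fin.prod_univ_two]
    gcongr
  rw [lintegral_enorm_pow_four] at hfin
  by_contra hne
  rw [not_lt_top_iff] at hne
  simp [hne] at hfin

lemma isTest_zero (T : ℝ) : IsTest T (fun (_ : ℝ) (_ : Torus d) => (0 : ℝ)) where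
  smooth := contDiff_const
  -- Any endpoints inside the limits serve, even with an empty interval between them.
  support := ⟨1, T - 1, one_pos, by linarith, fun _ _ _ => rfl⟩

/-! ### Viscous stress and momentum flux -/

/-- The viscous stress tensor `ν(ϱ) 𝔻u + μ(ϱ) (∇·u) I`. -/
def stress (ν μ : ℝ → ℝ) (r : ℝ) (A : Matrix (Fin d) (Fin d) ℝ) (i j : Fin d) : ℝ :=
  ν r * strain A i j + if i = j then μ r * A.trace else 0

/-- The momentum flux `ϱ u ⊗ u + p(ϱ) I - 𝕊`. -/
def momentumFlux (p ν μ : ℝ → ℝ) (ϱ : ℝ → Torus d → ℝ) (u : ℝ → Torus d → Vec d)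
    (G : ℝ → Torus d → Matrix (Fin d) (Fin d) ℝ) (i j : Fin d) (t : ℝ) (x : Torus d) : ℝ :=
  ϱ t x * u t x j * u t x i + (if i = j then p (ϱ t x) else 0) - stress ν μ (ϱ t x) (G t x) i j

/-- The strain is symmetric, so contraction with it sees only the symmetric part of A. -/
lemma contract_strain (A : Matrix (Fin d) (Fin d) ℝ) :
    contract (strain A) A = contract (strain A) (strain A) := by
  have h : contract (strain A) A.transpose = contract (strain A) A := by
    simp only [contract]
    rw [Finset.sum_comm]
    refine Finset.sum_congr rfl fun i _ => Finset.sum_congr rfl fun j _ => ?_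
    simp only [strain, Matrix.smul_apply, Matrix.add_apply, Matrix.transpose_apply]
    ring
  have h2 : contract (strain A) (strain A) =
      1 / 2 * (contract (strain A) A + contract (strain A) A.transpose) := by
    simp only [contract, ← Finset.sum_add_distrib, Finset.mul_sum]
    refine Finset.sum_congr rfl fun i _ => Finset.sum_congr rfl fun j _ => ?_
    simp only [strain, Matrix.smul_apply, Matrix.add_apply, Matrix.transpose_apply, smul_eq_mul]
    ring
  rw [h2, h]
  ring

lemma sum_stress_mul (ν μ : ℝ → ℝ) (r : ℝ) (A : Matrix (Fin d) (Fin d) ℝ) :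
    ∑ i, ∑ j, stress ν μ r A i j * A i j =
      ν r * contract (strain A) (strain A) + μ r * A.trace ^ 2 := by
  rw [← contract_strain]
  simp only [stress, add_mul, Finset.sum_add_distrib, ite_mul, zero_mul, Finset.sum_ite_eq,
    Finset.mem_univ, if_true, contract, Finset.mul_sum, mul_assoc]
  congr 1
  rw [← Finset.mul_sum, ← Finset.mul_sum, Matrix.trace, sq]
  rfl

section Fields

variable {T c₁ c₂ : ℝ} {p ν μ : ℝ → ℝ} {ϱ : ℝ → Torus d → ℝ} {u : ℝ → Torus d → Vec d}
  {G : ℝ → Torus d → Matrix (Fin d) (Fin d) ℝ}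

lemma memLp_comp_mul {X : Type*} [MeasurableSpace X] {m : Measure X} {r f : X → ℝ}
    (hr : AEStronglyMeasurable r m) (hb : ∀ᵐ x ∂m, c₁ ≤ r x ∧ r x ≤ c₂) (hc₁ : 0 < c₁)
    {F : ℝ → ℝ} (hF : ContinuousOn F (Set.Ioi 0)) {q : ℝ≥0∞} (hf : MemLp f q m) :
    MemLp (fun x => F (r x) * f x) q m := by
  have hF' : ContinuousOn F (Set.Icc c₁ c₂) := hF.mono fun r hr => hc₁.trans_le hr.1
  obtain ⟨K, -, hK⟩ := exists_bound_on_Icc hF'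
  refine hf.of_le_mul (c := K)
    ((aestronglyMeasurable_comp_of_continuousOn hF' hr hb).mul hf.1) ?_
  filter_upwards [hb] with x hx
  rw [norm_mul]
  exact mul_le_mul_of_nonneg_right (hK _ hx.1 hx.2) (norm_nonneg _)

lemma memLp_strain (hG : ∀ i j, MemLp (fun z : ℝ × Torus d => G z.1 z.2 i j) 2 (spaceTime d T))
    (i j : Fin d) : MemLp (fun z : ℝ × Torus d => strain (G z.1 z.2) i j) 2 (spaceTime d T) :=
  ((hG i j).add (hG j i)).const_mul (1 / 2 : ℝ)

lemma memLp_trace (hG : ∀ i j, MemLp (fun z : ℝ × Torus d => G z.1 z.2 i j) 2 (spaceTime d T)) :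
    MemLp (fun z : ℝ × Torus d => (G z.1 z.2).trace) 2 (spaceTime d T) :=
  memLp_finsetSum _ fun i _ => hG i i

lemma memLp_stress (hϱ : AEStronglyMeasurable (Function.uncurry ϱ) (spaceTime d T))
    (hb : ∀ᵐ z ∂(spaceTime d T), c₁ ≤ ϱ z.1 z.2 ∧ ϱ z.1 z.2 ≤ c₂) (hc₁ : 0 < c₁)
    (hν : ContinuousOn ν (Set.Ioi 0)) (hμ : ContinuousOn μ (Set.Ioi 0))
    (hG : ∀ i j, MemLp (fun z : ℝ × Torus d => G z.1 z.2 i j) 2 (spaceTime d T)) (i j : Fin d) :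
    MemLp (fun z : ℝ × Torus d => stress ν μ (ϱ z.1 z.2) (G z.1 z.2) i j) 2 (spaceTime d T) := by
  refine (memLp_comp_mul hϱ hb hc₁ hν (memLp_strain hG i j)).add ?_
  split_ifs
  · exact memLp_comp_mul hϱ hb hc₁ hμ (memLp_trace hG)
  · exact MemLp.zero

lemma memLp_momentumFlux (hϱ : AEStronglyMeasurable (Function.uncurry ϱ) (spaceTime d T))
    (hb : ∀ᵐ z ∂(spaceTime d T), c₁ ≤ ϱ z.1 z.2 ∧ ϱ z.1 z.2 ≤ c₂) (hc₁ : 0 < c₁)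
    (hp : ContinuousOn p (Set.Ioi 0)) (hν : ContinuousOn ν (Set.Ioi 0))
    (hμ : ContinuousOn μ (Set.Ioi 0))
    (hu : ∀ i, MemLp (fun z : ℝ × Torus d => u z.1 z.2 i) 4 (spaceTime d T))
    (hG : ∀ i j, MemLp (fun z : ℝ × Torus d => G z.1 z.2 i j) 2 (spaceTime d T)) (i j : Fin d) :
    MemLp (Function.uncurry (momentumFlux p ν μ ϱ u G i j)) 2 (spaceTime d T) := by
  refine MemLp.sub (MemLp.add ?_ ?_) (memLp_stress hϱ hb hc₁ hν hμ hG i j)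
  · have := holderTriple_four_four_two
    have h1 : MemLp (fun z : ℝ × Torus d => u z.1 z.2 j * u z.1 z.2 i) 2 (spaceTime d T) :=
      (hu i).mul (hu j)
    have := memLp_comp_mul hϱ hb hc₁ continuousOn_id h1
    refine this.ae_eq (Eventually.of_forall fun z => ?_)
    exact (mul_assoc _ _ _).symm
  · split_ifs
    · have := memLp_comp_mul hϱ hb hc₁ hp (memLp_const (1 : ℝ) (p := 2))
      exact this.ae_eq (Eventually.of_forall fun z => mul_one _)
    · exact MemLp.zero

variable {ϱ₀ : Torus d → ℝ} {u₀ : Torus d → Vec d}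

lemma IsWeakSolution.balance_mass (h : IsWeakSolution T p ν μ ϱ u G ϱ₀ u₀)
    (hϱ : Integrable (Function.uncurry ϱ) (spaceTime d T))
    (hm : ∀ i, Integrable (fun z : ℝ × Torus d => ϱ z.1 z.2 * u z.1 z.2 i) (spaceTime d T)) :
    Balance T ϱ (fun j s x => ϱ s x * u s x j) ϱ₀ where
  integrable := hϱ
  integrable_flux := hm
  integrable_init := h.integrable_init
  weak := h.continuity
  init := h.init

lemma IsWeakSolution.balance_momentum (h : IsWeakSolution T p ν μ ϱ u G ϱ₀ u₀)
    (hm : ∀ i, Integrable (fun z : ℝ × Torus d => ϱ z.1 z.2 * u z.1 z.2 i) (spaceTime d T))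
    (hN : ∀ i j, Integrable (Function.uncurry (momentumFlux p ν μ ϱ u G i j)) (spaceTime d T))
    (i : Fin d) :
    Balance T (fun s x => ϱ s x * u s x i) (momentumFlux p ν μ ϱ u G i)
      (fun x => ϱ₀ x * u₀ x i) where
  integrable := hm i
  integrable_flux := hN i
  integrable_init := (EuclideanSpace.proj (𝕜 := ℝ) i).integrable_comp h.integrable_init_mom
  weak φ hφ := by
    -- A test field with a single nonzero component isolates one scalar balance law.
    have h1 := h.momentum (fun k => if k = i then φ else fun _ _ => 0) fun k => by
      split_ifs
      exacts [hφ, isTest_zero T]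
    refine Eq.trans ?_ h1
    refine integral_congr_ae (Eventually.of_forall fun t => integral_congr_ae
      (Eventually.of_forall fun x => ?_))
    have hdt : ∀ k, dt (if k = i then φ else fun _ _ => 0) t x = if k = i then dt φ t x else 0 :=
      fun k => by split_ifs <;> simp [dt]
    have hpd : ∀ k j, grad (fun k => (if k = i then φ else fun _ _ => 0) t) x k j =
        if k = i then pd j (φ t) x else 0 :=
      fun k j => by simp only [grad]; split_ifs <;> simp [pd]
    have htr : (grad (fun k => (if k = i then φ else fun _ _ => 0) t) x).trace =
        pd i (φ t) x := by
      simp [Matrix.trace, hpd]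
    simp only [hdt, htr, contract, hpd, mul_ite, mul_zero, Finset.sum_ite_eq', Finset.mem_univ,
      if_true, momentumFlux, stress]
    have hs : ∀ F : Fin d → Fin d → ℝ, ∑ k, ∑ j, (if k = i then F k j else 0) = ∑ j, F i j :=
      fun F => by
        rw [Finset.sum_comm]
        simp
    have e : ∑ j, ϱ t x * u t x j * u t x i * pd j (φ t) x =
        ∑ j, ϱ t x * u t x i * u t x j * pd j (φ t) x :=
      Finset.sum_congr rfl fun j _ => by ring
    simp only [hs, sub_mul, add_mul, ite_mul, zero_mul, Finset.sum_sub_distrib,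
      Finset.sum_add_distrib, Finset.sum_ite_eq, Finset.mem_univ, if_true, e, Finset.mul_sum]
    simp only [mul_assoc]
    ring
  init φ hφ := by
    have h1 := h.init_mom (fun k => if k = i then φ else fun _ => 0) fun k => by
      split_ifs
      exacts [hφ, contDiff_const]
    simpa only [ite_apply, mul_ite, mul_zero, Finset.sum_ite_eq', Finset.mem_univ, if_true]
      using h1

end Fields

/-! ### Energy equality for weak solutions -/

lemma energyDensity_eq (p : ℝ → ℝ) {r : ℝ} (hr : 0 < r) (v : Vec d) :
    energyDensity p r v = ∑ i, 1 / 2 * ((r * v i) ^ 2 / r) + pressurePotential p r := by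
  rw [energyDensity, EuclideanSpace.real_norm_sq_eq, Finset.mul_sum]
  congr 1
  refine Finset.sum_congr rfl fun i _ => ?_
  field_simp

section Solution

variable {T c₁ c₂ : ℝ} {p ν μ : ℝ → ℝ} {ϱ : ℝ → Torus d → ℝ} {u : ℝ → Torus d → Vec d}
  {G : ℝ → Torus d → Matrix (Fin d) (Fin d) ℝ} {ϱ₀ : Torus d → ℝ} {u₀ : Torus d → Vec d}

lemma IsWeakSolution.evolution (hsol : IsWeakSolution T p ν μ ϱ u G ϱ₀ u₀) (hT : 0 < T)
    (hp : ContinuousOn p (Set.Ioi 0)) (hν : ContinuousOn ν (Set.Ioi 0))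
    (hμ : ContinuousOn μ (Set.Ioi 0))
    (hϱ : AEStronglyMeasurable (Function.uncurry ϱ) (spaceTime d T)) (hc₁ : 0 < c₁)
    (hb : ∀ᵐ z ∂(spaceTime d T), c₁ ≤ ϱ z.1 z.2 ∧ ϱ z.1 z.2 ≤ c₂) (hu₂ : MemLinfL2 T u)
    (hG : MemL2H1 T u G)
    (hu : ∀ i, MemLp (fun z : ℝ × Torus d => u z.1 z.2 i) 4 (spaceTime d T)) :
    Evolution T c₁ c₂ ϱ (fun i s x => u s x i) (fun i j s x => G s x i j)
      (momentumFlux p ν μ ϱ u G) ϱ₀ (fun i x => ϱ₀ x * u₀ x i) := by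
  have hϱi : Integrable (Function.uncurry ϱ) (spaceTime d T) := memLp_one_iff_integrable.1
    (memLp_comp_of_continuousOn (F := id) continuousOn_id hϱ hb 1)
  have hm : ∀ i, Integrable (fun z : ℝ × Torus d => ϱ z.1 z.2 * u z.1 z.2 i) (spaceTime d T) :=
    fun i => (memLp_comp_mul hϱ hb hc₁ continuousOn_id (hu i)).integrable (by norm_num)
  have hN := memLp_momentumFlux hϱ hb hc₁ hp hν hμ hu hG.memLp_grad
  obtain ⟨-, M, hM⟩ := hu₂
  exact
    { time_pos := hT
      lower_pos := hc₁
      meas := hϱ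
      mass := hsol.balance_mass hϱi hm
      momentum := hsol.balance_momentum hm fun i j => (hN i j).integrable (by norm_num)
      slice := by
        filter_upwards [hϱi.prod_right_ae, Measure.ae_ae_of_ae_prod hb, hG.weakGrad,
          eventually_all.2 fun i => ae_memLp_slice (f := fun s x => u s x i) (by norm_num)
            (by norm_num) (hu i),
          eventually_all.2 fun i => eventually_all.2 fun j => ae_memLp_slice
            (f := fun s x => G s x i j) (by norm_num) (by norm_num) (hG.memLp_grad i j),
          eventually_all.2 fun i => eventually_all.2 fun j => ae_memLp_slice
            (by norm_num) (by norm_num) (hN i j)] with s h1 h2 h3 h4 h5 h6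
        exact ⟨h1.1, h2, h4, h5, h6, fun i j φ hφ => h3 φ hφ i j⟩
      vel_bounded := ⟨M, hM.mono fun s hs i =>
        (eLpNorm_mono fun x => PiLp.norm_apply_le (u s x) i).trans hs⟩
      memLp_vel := hu
      memLp_grad := hG.memLp_grad
      memLp_flux := hN }

/-- Removing convection and pressure from the momentum flux leaves minus the viscous stress, whose
work against the velocity gradient is minus the dissipation. The density bounds at times 0 and t
allow the energy to be written in terms of the velocity instead of the momentum. -/
lemma Evolution.energyEquality
    (h : Evolution T c₁ c₂ ϱ (fun i s x => u s x i) (fun i j s x => G s x i j)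
      (momentumFlux p ν μ ϱ u G) ϱ₀ (fun i x => ϱ₀ x * u₀ x i))
    (hp : ContDiffOn ℝ 1 p (Set.Ioi 0)) (hν : ContinuousOn ν (Set.Ioi 0))
    (hμ : ContinuousOn μ (Set.Ioi 0))
    (hb : ∀ᵐ z ∂(spaceTime d T), c₁ ≤ ϱ z.1 z.2 ∧ ϱ z.1 z.2 ≤ c₂)
    {C : ℝ} {δ : ℕ → ℝ} {η : ℕ → Torus d → ℝ} (hη : Mollifier C δ η) {t : ℝ}
    (ht : t ∈ Set.Ioo 0 T)
    (hreg : ∀ n, Regular (η n) ϱ (fun i s x => u s x i) (momentumFlux p ν μ ϱ u G) ϱ₀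
      (fun i x => ϱ₀ x * u₀ x i) t) (hr : Integrable (ϱ t))
    (hm : ∀ i, Integrable fun x => ϱ t x * u t x i) :
    EnergyEquality p ν μ ϱ u G ϱ₀ u₀ t := by
  have hc₁ := h.lower_pos
  have hp' : ∀ r, 0 < r → HasDerivAt p (deriv p r) r := fun r hr =>
    ((hp.differentiableOn (by norm_num)).differentiableAt (Ioi_mem_nhds hr)).hasDerivAt
  have hpd : ContinuousOn (deriv p) (Set.Ioi 0) :=
    hp.continuousOn_deriv_of_isOpen isOpen_Ioi (by norm_num)
  have hP : ∀ r, 0 < r → HasDerivAt (pressurePotential p) (pressurePotentialDeriv p r) r :=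
    fun r hr => hasDerivAt_pressurePotential hp.continuousOn hr
  have hPc : ContinuousOn (pressurePotential p) (Set.Icc c₁ c₂) := fun r hr =>
    (hP r (hc₁.trans_le hr.1)).continuousAt.continuousWithinAt
  have s0 := h.state_init hη
  have st := h.state hη ht hreg hr hm
  have e0 : ∀ᵐ x, ∑ i, 1 / 2 * ((ϱ₀ x * u₀ x i) ^ 2 / ϱ₀ x) + pressurePotential p (ϱ₀ x) =
      energyDensity p (ϱ₀ x) (u₀ x) :=
    s0.bounds.mono fun x hx => (energyDensity_eq p (hc₁.trans_le hx.1) _).symm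
  have et : ∀ᵐ x, ∑ i, 1 / 2 * ((ϱ t x * u t x i) ^ 2 / ϱ t x) + pressurePotential p (ϱ t x) =
      energyDensity p (ϱ t x) (u t x) :=
    st.bounds.mono fun x hx => (energyDensity_eq p (hc₁.trans_le hx.1) _).symm
  have hle : spaceTime d t ≤ spaceTime d T := spaceTime_mono ht.2.le
  have hϱ := h.meas
  have hG := h.memLp_grad
  have iS : Integrable (fun z : ℝ × Torus d =>
      ν (ϱ z.1 z.2) * contract (strain (G z.1 z.2)) (strain (G z.1 z.2))) (spaceTime d t) := by
    refine Integrable.mono_measure (Integrable.congr (integrable_finsetSum Finset.univ fun i _ =>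
      integrable_finsetSum Finset.univ fun j _ =>
        (memLp_comp_mul hϱ hb hc₁ hν (memLp_strain hG i j)).integrable_mul
          (memLp_strain hG i j)) (Eventually.of_forall fun z => ?_)) hle
    simp only [contract, Finset.mul_sum, Pi.mul_apply, mul_assoc, Function.uncurry]
  have iB : Integrable (fun z : ℝ × Torus d => μ (ϱ z.1 z.2) * (G z.1 z.2).trace ^ 2)
      (spaceTime d t) := by
    refine Integrable.mono_measure (Integrable.congr
      ((memLp_comp_mul hϱ hb hc₁ hμ (memLp_trace hG)).integrable_mul (memLp_trace hG))
      (Eventually.of_forall fun z => ?_)) hle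
    simp only [Pi.mul_apply, Function.uncurry]
    ring
  have iW : ∀ i j, Integrable (fun z : ℝ × Torus d =>
      stress ν μ (ϱ z.1 z.2) (G z.1 z.2) i j * G z.1 z.2 i j) (spaceTime d t) := fun i j =>
    ((memLp_stress hϱ hb hc₁ hν hμ hG i j).integrable_mul (hG i j)).mono_measure hle
  refine ⟨(s0.integrable_energy hc₁ hPc).congr e0, (st.integrable_energy hc₁ hPc).congr et,
    iS, iB, ?_⟩
  have key := h.totalEnergy_sub hη hp' hpd hP
    (fun r hr => hasDerivAt_pressurePotentialDeriv hp' hr) ht hreg hr hm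
  rw [totalEnergy, totalEnergy, integral_congr_ae e0, integral_congr_ae et] at key
  have hwork : ∫ s in Set.Ioo 0 t, ∑ i, ∑ j, ∫ x, (momentumFlux p ν μ ϱ u G i j s x -
      ϱ s x * u s x j * u s x i - if i = j then p (ϱ s x) else 0) * G s x i j =
      -((∫ s in Set.Ioo 0 t, ∫ x, ν (ϱ s x) * contract (strain (G s x)) (strain (G s x))) +
        ∫ s in Set.Ioo 0 t, ∫ x, μ (ϱ s x) * (G s x).trace ^ 2) := by
    rw [← integral_add iS.integral_prod_left iB.integral_prod_left, ← integral_neg]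
    refine integral_congr_ae ?_
    filter_upwards [iS.prod_right_ae, iB.prod_right_ae,
      eventually_all.2 fun i => eventually_all.2 fun j => (iW i j).prod_right_ae] with s h1 h2 h3
    rw [← integral_add h1 h2]
    simp only [← sum_stress_mul]
    rw [integral_finsetSum _ fun i _ => integrable_finsetSum _ fun j _ => h3 i j]
    simp only [integral_finsetSum _ fun j _ => h3 _ j, ← Finset.sum_neg_distrib, ← integral_neg]
    refine Finset.sum_congr rfl fun i _ => Finset.sum_congr rfl fun j _ => ?_
    congr 1
    funext x
    rw [momentumFlux]
    ring
  rw [hwork] at key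
  linarith

/-- The energy equality for weak solutions with bounded density and velocity in `L⁴`. The proof
averages momentum and density separately and tests with their quotient, so that the translation
estimate on the gradient of the velocity makes fractional regularity of the density unnecessary. -/
lemma IsWeakSolution.energyEquality (hsol : IsWeakSolution T p ν μ ϱ u G ϱ₀ u₀) (hT : 0 < T)
    (hp : ContDiffOn ℝ 1 p (Set.Ioi 0)) (hν : ContinuousOn ν (Set.Ioi 0))
    (hμ : ContinuousOn μ (Set.Ioi 0))
    (hϱ : AEStronglyMeasurable (Function.uncurry ϱ) (spaceTime d T)) (hc₁ : 0 < c₁)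
    (hb : ∀ᵐ z ∂(spaceTime d T), c₁ ≤ ϱ z.1 z.2 ∧ ϱ z.1 z.2 ≤ c₂) (hu₂ : MemLinfL2 T u)
    (hG : MemL2H1 T u G)
    (hu : ∀ i, MemLp (fun z : ℝ × Torus d => u z.1 z.2 i) 4 (spaceTime d T)) :
    (∀ᵐ t ∂(volume.restrict (Set.Ioo 0 T)), EnergyEquality p ν μ ϱ u G ϱ₀ u₀ t) ∧
    (∀ t ∈ Set.Ioo 0 T, WeaklyContinuousAt ϱ u t → EnergyEquality p ν μ ϱ u G ϱ₀ u₀ t) := by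
  obtain ⟨C, δ, η, hη⟩ := exists_mollifier d
  have h := hsol.evolution hT hp.continuousOn hν hμ hϱ hc₁ hb hu₂ hG hu
  have hs := fun n => (hη.kernel n).smooth
  constructor
  · filter_upwards [ae_all_iff.2 fun n => h.ae_regular (hs n), h.mass.integrable_slice,
      eventually_all.2 fun i => (h.momentum i).integrable_slice,
      ae_restrict_mem measurableSet_Ioo] with t h1 h2 h3 h4
    exact h.energyEquality hp hν hμ hb hη h4 h1 h2 h3
  · intro t ht hc
    refine h.energyEquality hp hν hμ hb hη ht (fun n => ⟨fun x =>
      h.mass.conv_eq_of_continuousAt hT (hs n) ht hc.density x, fun i x =>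
      (h.momentum i).conv_eq_of_continuousAt hT (hs n) ht (fun φ hφ => ?_) x⟩) hc.integrable
      fun i => (EuclideanSpace.proj (𝕜 := ℝ) i).integrable_comp hc.integrable_mom
    have h1 := hc.momentum (fun k => if k = i then φ else fun _ => 0) fun k => by
      split_ifs
      exacts [hφ, contDiff_const]
    simpa only [ite_apply, mul_ite, mul_zero, Finset.sum_ite_eq', Finset.mem_univ, if_true]
      using h1

end Solution

/-- In two dimensions, `L^∞(L²) ∩ L²(H¹) ⊆ L⁴`. -/
lemma MemL2H1.memLp_four {T : ℝ} {u : ℝ → Torus 2 → Vec 2}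
    {G : ℝ → Torus 2 → Matrix (Fin 2) (Fin 2) ℝ} (hG : MemL2H1 T u G) (hu : MemLinfL2 T u)
    (i : Fin 2) : MemLp (fun z : ℝ × Torus 2 => u z.1 z.2 i) 4 (spaceTime 2 T) := by
  obtain ⟨-, M, hM⟩ := hu
  exact memLp_four_of_ladyzhenskaya (f := fun s x => u s x i) (g := fun j s x => G s x i j)
    (MemLp.coord hG.memLp i) (hG.memLp_grad i)
    (hG.weakGrad.mono fun s hs j φ hφ => hs φ hφ i j)
    (hM.mono fun s hs => (eLpNorm_mono fun x => PiLp.norm_apply_le (u s x) i).trans hs)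

end CNS

end

theorem theorem1p1 (d : ℕ) (hd : d = 2 ∨ d = 3) (T : ℝ) (hT : 0 < T)
    (p ν μ : ℝ → ℝ)
    (hp : ContDiffOn ℝ 2 p (Set.Ioi 0))
    (hν : ContinuousOn ν (Set.Ioi 0)) (hν_nonneg : ∀ r : ℝ, 0 < r → 0 ≤ ν r)
    (hμ : ContinuousOn μ (Set.Ioi 0)) (hμ_nonneg : ∀ r : ℝ, 0 < r → 0 ≤ μ r)
    (ϱ : ℝ → CNS.Torus d → ℝ) (u : ℝ → CNS.Torus d → CNS.Vec d)
    (G : ℝ → CNS.Torus d → Matrix (Fin d) (Fin d) ℝ)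
    (ϱ₀ : CNS.Torus d → ℝ) (u₀ : CNS.Torus d → CNS.Vec d)
    (hϱ_meas : AEStronglyMeasurable (Function.uncurry ϱ) (CNS.spaceTime d T))
    (c₁ c₂ : ℝ) (hc₁ : 0 < c₁)
    (hϱ_bounds : ∀ᵐ z ∂(CNS.spaceTime d T), c₁ ≤ ϱ z.1 z.2 ∧ ϱ z.1 z.2 ≤ c₂)
    (hu_LinfL2 : CNS.MemLinfL2 T u)
    (hu_L2H1 : CNS.MemL2H1 T u G)
    (hsol : CNS.IsWeakSolution T p ν μ ϱ u G ϱ₀ u₀)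
    (h2 : d = 2 → CNS.HalfBesov T 2 ϱ)
    (h3 : d = 3 → MemLp (Function.uncurry u) 4 (CNS.spaceTime d T) ∧
      CNS.HalfBesov T (12 / 5) ϱ) :
    (∀ᵐ t ∂(volume.restrict (Set.Ioo 0 T)), CNS.EnergyEquality p ν μ ϱ u G ϱ₀ u₀ t) ∧
    (∀ t ∈ Set.Ioo 0 T, CNS.WeaklyContinuousAt ϱ u t →
      CNS.EnergyEquality p ν μ ϱ u G ϱ₀ u₀ t) := by
  refine hsol.energyEquality hT (hp.of_le (by norm_num)) hν hμ hϱ_meas hc₁ hϱ_bounds hu_LinfL2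
    hu_L2H1 ?_
  -- Only the L⁴ bound on the velocity distinguishes the dimensions: it is derived for d = 2 and
  -- assumed for d = 3.
  rcases hd with rfl | hd
  · exact hu_L2H1.memLp_four hu_LinfL2
  · exact CNS.MemLp.coord (h3 hd).1
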